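/- **Setting.** Let $\Omega=(a,b)$ be a bounded interval, $T>0$, and let $k\ge 1$, $r\ge 1$ be integers. Let $u$ solve the one-dimensional heat equation $\partial_t u-\partial_{xx}u=f$ in $\Omega\times(0,T]$ with Neumann boundary conditions $\partial_x u=0$ at $x=a,b$, where $u\in C^1([0,T];H^{2r}(\Omega))$, $f\in C^k([0,T];L^2(\Omega))\cap C([0,T];H^{2r}(\Omega))$ and $f\ge 0$ on $\Omega\times[0,T]$. Put $u_{\min}=\min_{x\in[a,b]}u(x,0)$. Let $f$ also denote a fixed extension of $f$ to $[-(k-1)T,T]$ of the same regularity, i.e. in $C^k([-(k-1)T,T];L^2(\Omega))\cap C([-(k-1)T,T];H^{2r}(\Omega))$. **Space discretization.** For $M\ge1$ let $h=(b-a)/M$ and $I_i=[a+(i-1)h,a+ih]$, $i=1,\dots,M$. Let $x_{(i-1)r+j}$, $j=0,\dots,r$, be the points of the $(r+1)$-point Gauss–Lobatto quadrature on $I_i$ (so $x_0=a$, $x_{Mr}=b$), and let $S_h^r$ be the space of continuous functions on $[a,b]$ whose restriction to each $I_i$ is a polynomial of degree $\le r$, with nodal basis $\varphi_0,\dots,\varphi_{Mr}$,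 $\varphi_m(x_l)=\delta_{ml}$. Let $w_0,\dots,w_{Mr}$ be the weights of the composite Gauss–Lobatto quadrature, obtained by adding up over $i=1,\dots,M$ the weights on $I_i$. Let ${\bf M}=\mathrm{diag}(w_0,\dots,w_{Mr})$ and ${\bf A}_{ml}=-\int_a^b\varphi_l'\varphi_m'\,dx$. **Time discretization and cut-off.** For $N\ge1$ let $\tau=T/N$ and $t_n=n\tau$ ($n\in\mathbb Z$). Let ${\bf f}(t)$ be the vector of the values $f(x_m,t)$. Starting from an arbitrary $u_h^0\in S_h^r$, with vector of nodal values ${\bf u}^0$, define for $n=1,\dots,N$ $$\hat{\bf u}^n=e^{\tau{\bf M}^{-1}{\bf A}}{\bf u}^{n-1}+\int_{t_{n-1}}^{t_n}e^{(t_n-s){\bf M}^{-1}{\bf A}}\sum_{j=1}^kL_j(s)\,{\bf f}(t_{n-j})\,ds,\qquad {\bf u}^n=\max(\hat{\bf u}^n,u_{\min})\ \text{ componentwise},$$ where $L_1,\dots,L_k$ are the polynomials of degree $\le k-1$ (depending on $n$) with $L_j(t_{n-i})=\delta_{ij}$ for $i,j=1,\dots,k$, and let $u_h^n\in S_h^r$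 be the function with nodal values ${\bf u}^n$. **Theorem.** For all $M,N\ge1$ one has $u_h^n(x_j)\ge u_{\min}$ for $j=0,\dots,Mr$ and $n=1,\dots,N$. Moreover, there is a constant $c>0$, independent of $M$, $N$ (hence of $h$, $\tau$) and of $u_h^0$, such that $$\max_{1\le n\le N}\|u(t_n)-u_h^n\|_{L^2(\Omega)}\le c(\tau^k+h^r)+c\,\|u(t_0)-u_h^0\|_{L^2(\Omega)} .$$ -/

import Mathlib

open MeasureTheory Set
open scoped Polynomial ContDiff Matrix

noncomputable section

namespace ExpCutoff

/-! ### Sobolev spaces on the interval `(a, b)` -/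

/-- The space `L²(a, b)`. -/
abbrev L2 (a b : ℝ) : Type := Lp ℝ 2 (volume.restrict (Ioo a b))

/-- `g'` is the weak derivative of `g` on `(a, b)`. -/
def IsWeakDeriv (a b : ℝ) (g g' : L2 a b) : Prop :=
  ∀ φ : ℝ → ℝ, ContDiff ℝ ∞ φ → HasCompactSupport φ → tsupport φ ⊆ Ioo a b →
    ∫ x in Ioo a b, g x * deriv φ x = -∫ x in Ioo a b, g' x * φ x

theorem integrable_mul_test {a b : ℝ} (g : L2 a b) {φ : ℝ → ℝ} (hφ : Continuous φ)
    (hc : HasCompactSupport φ) : Integrable (fun x => g x * φ x) (volume.restrict (Ioo a b)) :=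
  MemLp.integrable_mul (p := 2) (q := 2) (Lp.memLp g) ((hφ.memLp_of_hasCompactSupport hc))

theorem IsWeakDeriv.zero {a b : ℝ} : IsWeakDeriv a b 0 0 := by
  intro φ _ _ _
  have h : ((0 : L2 a b) : ℝ → ℝ) =ᵐ[volume.restrict (Ioo a b)] 0 := Lp.coeFn_zero _ _ _
  have h1 : ∀ ψ : ℝ → ℝ, ∫ x in Ioo a b, (0 : L2 a b) x * ψ x = 0 := by
    intro ψ
    rw [integral_congr_ae (g := fun _ => (0 : ℝ))]
    · simp
    · filter_upwards [h] with x hx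
      rw [hx, Pi.zero_apply, zero_mul]
  rw [h1, h1, neg_zero]

theorem IsWeakDeriv.add {a b : ℝ} {g g' k k' : L2 a b} (hg : IsWeakDeriv a b g g')
    (hk : IsWeakDeriv a b k k') : IsWeakDeriv a b (g + k) (g' + k') := by
  intro φ hφ hc hs
  have key : ∀ (p q : L2 a b) (ψ : ℝ → ℝ), Continuous ψ → HasCompactSupport ψ →
      ∫ x in Ioo a b, (p + q) x * ψ x
        = (∫ x in Ioo a b, p x * ψ x) + ∫ x in Ioo a b, q x * ψ x := by
    intro p q ψ hψ hψc
    rw [← integral_add (integrable_mul_test p hψ hψc) (integrable_mul_test q hψ hψc)]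
    refine integral_congr_ae ?_
    filter_upwards [Lp.coeFn_add p q] with x hx
    rw [hx, Pi.add_apply, add_mul]
  have hd : Continuous (deriv φ) := hφ.continuous_deriv (by simp)
  rw [key _ _ _ hd hc.deriv, key _ _ _ hφ.continuous hc, hg φ hφ hc hs, hk φ hφ hc hs]
  ring

theorem IsWeakDeriv.smul {a b : ℝ} {g g' : L2 a b} (c : ℝ) (hg : IsWeakDeriv a b g g') :
    IsWeakDeriv a b (c • g) (c • g') := by
  intro φ hφ hc hs
  have key : ∀ (p : L2 a b) (ψ : ℝ → ℝ),
      ∫ x in Ioo a b, (c • p) x * ψ x = c * ∫ x in Ioo a b, p x * ψ x := by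
    intro p ψ
    rw [← integral_const_mul]
    refine integral_congr_ae ?_
    filter_upwards [Lp.coeFn_smul c p] with x hx
    simp [hx, mul_assoc]
  rw [key, key, hg φ hφ hc hs]
  ring

/-- The Sobolev space `H^m(a, b)`: an element is recorded as the list `(g, g', …, g^{(m)})` of its
weak derivatives, all in `L²(a, b)`; the norm inherited from the `ℓ²`-product is the usual
norm `(∑_{j ≤ m} ‖g^{(j)}‖²)^{1/2}`. -/
def Sobolev (a b : ℝ) (m : ℕ) : Submodule ℝ (PiLp 2 (fun _ : Fin (m + 1) => L2 a b)) where
  carrier := {g | ∀ j : Fin m, IsWeakDeriv a b (g j.castSucc) (g j.succ)}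
  zero_mem' := fun _ => IsWeakDeriv.zero
  add_mem' := fun hg hk j => (hg j).add (hk j)
  smul_mem' := fun c _ hg j => (hg j).smul c

/-- The `j`-th weak derivative of `g ∈ H^m(a, b)`, an element of `L²(a, b)` (`j ≤ m`);
for `j = 0` it is `g` itself. -/
def wderiv {a b : ℝ} {m : ℕ} (g : Sobolev a b m) (j : ℕ) : L2 a b :=
  if h : j < m + 1 then (g : PiLp 2 (fun _ : Fin (m + 1) => L2 a b)) ⟨j, h⟩ else 0

open Classical in
/-- The continuous representative on `[a, b]` of an element of `L²(a, b)` (only meaningful for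
classes that have one, such as the elements of `H^1(a, b)`). -/
def contRep {a b : ℝ} (g : L2 a b) : ℝ → ℝ :=
  if h : ∃ v : ℝ → ℝ, ContinuousOn v (Icc a b) ∧ g =ᵐ[volume.restrict (Ioo a b)] v
  then h.choose else 0

/-- The norm of `L²(a, b)` for a function. -/
def normL2 (a b : ℝ) (g : ℝ → ℝ) : ℝ := (eLpNorm g 2 (volume.restrict (Ioo a b))).toReal

/-! ### The initial-boundary value problem -/

/-- `u` solves `∂ₜu - ∂ₓₓu = f` in `(a, b) × (0, T]` with `∂ₓu = 0` at `x = a` and `x = b`. -/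
def IsNeumannHeatSolution (a b T : ℝ) {m : ℕ} (u f : ℝ → Sobolev a b m) : Prop :=
  ∀ t ∈ Ioc 0 T,
    wderiv (derivWithin u (Icc 0 T) t) 0 - wderiv (u t) 2 = wderiv (f t) 0 ∧
    contRep (wderiv (u t) 1) a = 0 ∧ contRep (wderiv (u t) 1) b = 0

/-! ### Gauss–Lobatto quadrature -/

/-- The Legendre polynomial of degree `r` up to the factor `2 ^ r * r!` (Rodrigues' formula). -/
def legendre (r : ℕ) : ℝ[X] := Polynomial.derivative^[r] ((Polynomial.X ^ 2 - 1) ^ r)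

/-- The points of the `(r+1)`-point Gauss–Lobatto quadrature on `[-1, 1]`: the endpoints and
the zeros of the derivative of the Legendre polynomial of degree `r`. -/
def glPoints (r : ℕ) : Finset ℝ :=
  ((Polynomial.X ^ 2 - 1) * Polynomial.derivative (legendre r)).roots.toFinset

section
open Polynomial

theorem legendre_ode (r : ℕ) (hr : 1 ≤ r) :
    (X ^ 2 - 1) * derivative (legendre r)
      = C ((r : ℝ) * (r + 1)) * derivative^[r - 1] ((X ^ 2 - 1) ^ r) := by
  obtain ⟨n, rfl⟩ : ∃ n, r = n + 1 := ⟨r - 1, by omega⟩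
  set w : ℝ[X] := (X ^ 2 - 1) ^ (n + 1) with hw
  have h0 : derivative w * X ^ 2 - derivative w = C (2 * ((n : ℝ) + 1)) * (w * X) := by
    rw [hw, derivative_pow]; simp [C_ofNat]; ring
  have h1 := congrArg (derivative) h0
  have h2 : derivative^[2] w * X ^ 2 - derivative^[2] w
      = C (2 * (n : ℝ)) * (derivative w * X) + C (2 * ((n : ℝ) + 1)) * w := by
    simp only [derivative_sub, derivative_mul, derivative_C, derivative_X, derivative_X_pow] at h1
    simp only [Function.iterate_succ, Function.iterate_zero, Function.comp, id]
    simp at h1 ⊢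
    linear_combination h1
  have h3 := congrArg (derivative^[n]) h2
  rw [iterate_derivative_sub, iterate_derivative_derivative_mul_X_sq, iterate_map_add,
    iterate_derivative_C_mul, iterate_derivative_C_mul, iterate_derivative_derivative_mul_X] at h3
  have h4 : derivative^[n] (derivative^[2] w) = derivative^[n+2] w := by
    rw [← Function.iterate_add_apply]
  have h5 : derivative (legendre (n+1)) = derivative^[n+2] w := by
    rw [legendre, ← Function.iterate_succ_apply' (⇑derivative) (n+1) w]
  rw [h4] at h3
  rw [h5]
  simp only [Nat.add_sub_cancel]
  have h6 : ((n * (n-1) : ℕ) : ℝ[X]) = (n:ℝ[X]) * (n:ℝ[X]) - n := by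
    cases n <;> simp; ring
  simp only [nsmul_eq_mul, h6] at h3
  push_cast at h3 ⊢
  simp only [C_mul, C_add, C_1] at h3 ⊢
  simp [C_ofNat] at h3 ⊢
  linear_combination h3

theorem iterate_derivative_ne_zero (r j : ℕ) (hj : j ≤ 2 * r) :
    derivative^[j] ((X ^ 2 - 1 : ℝ[X]) ^ r) ≠ 0 := by
  have hm : ((X ^ 2 - 1 : ℝ[X]) ^ r).natDegree = 2 * r := by
    have : (X ^ 2 - 1 : ℝ[X]).natDegree = 2 := by compute_degree!
    rw [natDegree_pow, this]; ring
  intro h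
  have := Polynomial.coeff_iterate_derivative (p := ((X ^ 2 - 1 : ℝ[X]) ^ r)) (k := j) (2 * r - j)
  rw [h, show 2 * r - j + j = 2 * r by omega, ← hm, coeff_natDegree] at this
  have hne : ((X ^ 2 - 1 : ℝ[X]) ^ r) ≠ 0 := pow_ne_zero _ (by
    intro h'; have := congrArg (eval 0) h'; simp at this)
  rw [coeff_zero, eq_comm, smul_eq_zero] at this
  rcases this with h1 | h1
  · rw [Nat.descFactorial_eq_zero_iff_lt] at h1
    omega
  · exact hne (leadingCoeff_eq_zero.1 h1)

theorem le_card_roots_iterate (r j : ℕ) (hj : j + 1 ≤ r) :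
    j + 2 ≤ (derivative^[j] ((X ^ 2 - 1 : ℝ[X]) ^ r)).roots.toFinset.card := by
  have hroot : ∀ i, i < r → ∀ x : ℝ, x ^ 2 = 1 →
      x ∈ (derivative^[i] ((X ^ 2 - 1 : ℝ[X]) ^ r)).roots.toFinset := by
    intro i hi x hx
    rw [Multiset.mem_toFinset, mem_roots (iterate_derivative_ne_zero r i (by omega))]
    apply isRoot_iterate_derivative_of_lt_rootMultiplicity
    refine lt_of_lt_of_le hi ?_
    rw [le_rootMultiplicity_iff (by simpa using iterate_derivative_ne_zero r 0 (by omega))]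
    apply pow_dvd_pow_of_dvd
    rw [dvd_iff_isRoot]
    simp [hx]
  induction j with
  | zero =>
    have : ({1, -1} : Finset ℝ) ⊆ (derivative^[0] ((X ^ 2 - 1 : ℝ[X]) ^ r)).roots.toFinset := by
      intro x hx
      apply hroot 0 (by omega)
      simp at hx; rcases hx with rfl | rfl <;> norm_num
    have h2 : ({1, -1} : Finset ℝ).card = 2 := by
      rw [Finset.card_pair]; norm_num
    simpa [h2] using Finset.card_le_card this
  | succ j ih =>
    have ih := ih (by omega)
    set p := derivative^[j] ((X ^ 2 - 1 : ℝ[X]) ^ r) with hp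
    have hR := card_roots_toFinset_le_card_roots_derivative_sdiff_roots_succ p
    have hpd : derivative^[j+1] ((X ^ 2 - 1 : ℝ[X]) ^ r) = derivative p := by
      rw [Function.iterate_succ_apply']
    have hsub : ({1, -1} : Finset ℝ) ⊆ p.derivative.roots.toFinset ∩ p.roots.toFinset := by
      intro x hx
      have hx2 : x ^ 2 = 1 := by simp at hx; rcases hx with rfl | rfl <;> norm_num
      have h1 := hroot (j+1) (by omega) x hx2
      rw [hpd] at h1
      exact Finset.mem_inter.2 ⟨h1, hroot j (by omega) x hx2⟩
    have h2 : ({1, -1} : Finset ℝ).card = 2 := by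
      rw [Finset.card_pair]; norm_num
    have h3 := Finset.card_le_card hsub
    have h4 := Finset.card_sdiff_add_card_inter p.derivative.roots.toFinset p.roots.toFinset
    rw [hpd]
    omega

theorem card_glPoints (r : ℕ) (hr : 1 ≤ r) : (glPoints r).card = r + 1 := by
  have hc : ((r : ℝ) * (r + 1)) ≠ 0 := by positivity
  rw [glPoints, legendre_ode r hr, roots_C_mul _ hc]
  apply le_antisymm
  · refine (Multiset.toFinset_card_le _).trans ((card_roots' _).trans ?_)
    refine (natDegree_iterate_derivative _ _).trans ?_
    have : (X ^ 2 - 1 : ℝ[X]).natDegree = 2 := by compute_degree!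
    rw [natDegree_pow, this]; omega
  · have := le_card_roots_iterate r (r - 1) (by omega)
    omega

end

/-- The points of the `(r+1)`-point Gauss–Lobatto quadrature on `[-1, 1]` in increasing order
(the case distinction is void for `r ≥ 1`, see `card_glPoints`). -/
def glNode (r : ℕ) (j : Fin (r + 1)) : ℝ :=
  if h : (glPoints r).card = r + 1 then (glPoints r).orderEmbOfFin h j else 0

/-- The Lagrange basis polynomials of degree `r` at the Gauss–Lobatto points of `[-1, 1]`. -/
def shape (r : ℕ) (j : Fin (r + 1)) : ℝ[X] := Lagrange.basis Finset.univ (glNode r) j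

/-- The weights of the `(r+1)`-point Gauss–Lobatto quadrature on `[-1, 1]`. -/
def glWeight (r : ℕ) (j : Fin (r + 1)) : ℝ := ∫ x in (-1 : ℝ)..1, (shape r j).eval x

/-! ### The finite element space on the uniform mesh of `M` elements -/

/-- The mesh size `h`. -/
def meshSize (a b : ℝ) (M : ℕ) : ℝ := (b - a) / M

/-- The nodes `x_m`, `0 ≤ m ≤ M r`: for `m = i r + j`, `0 ≤ j < r`, the `j`-th Gauss–Lobatto point
of the element `[a + i h, a + (i + 1) h]`. -/
def node (a b : ℝ) (M r m : ℕ) : ℝ :=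
  a + (m / r : ℕ) * meshSize a b M
    + meshSize a b M * ((glNode r (Fin.ofNat (r + 1) (m % r)) + 1) / 2)

/-- The finite element space `S_h^r`: continuous functions on `[a, b]` that are polynomials of
degree at most `r` on each element. -/
def feSpace (a b : ℝ) (M r : ℕ) : Set (ℝ → ℝ) :=
  {v | ContinuousOn v (Icc a b) ∧ ∀ i < M, ∃ p : ℝ[X], p.natDegree ≤ r ∧
    ∀ x ∈ Icc (a + i * meshSize a b M) (a + (i + 1) * meshSize a b M), v x = p.eval x}

/-- The vector of nodal values of a function. -/
def nodalVec (a b : ℝ) (M r : ℕ) (v : ℝ → ℝ) : Fin (M * r + 1) → ℝ :=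
  fun m => v (node a b M r m)

/-- The element of `S_h^r` with nodal vector `U` (as a function on `[a, b]`): on the `i`-th element
it is `∑_j U_{i r + j} ℓ_j`, with `ℓ_j` the Lagrange basis polynomials of that element. -/
def feFun (a b : ℝ) (M r : ℕ) (U : Fin (M * r + 1) → ℝ) (x : ℝ) : ℝ :=
  let h := meshSize a b M
  let i : ℕ := min ⌊(x - a) / h⌋₊ (M - 1)
  ∑ j : Fin (r + 1), U (Fin.ofNat (M * r + 1) (i * r + j)) *
    (shape r j).eval (2 * (x - (a + i * h)) / h - 1)

/-- The weights of the composite Gauss–Lobatto quadrature at the nodes, assembled from the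
elements. -/
def nodeWeight (a b : ℝ) (M r m : ℕ) : ℝ :=
  ∑ i ∈ Finset.range M, ∑ j : Fin (r + 1),
    if i * r + j = m then meshSize a b M / 2 * glWeight r j else 0

/-- The lumped mass matrix. -/
def massMatrix (a b : ℝ) (M r : ℕ) : Matrix (Fin (M * r + 1)) (Fin (M * r + 1)) ℝ :=
  Matrix.diagonal fun m => nodeWeight a b M r m

/-- The matrix `A` with entries `-(∂ₓφ_j, ∂ₓφ_i)`, where `φ_m` is the nodal basis of `S_h^r`. -/
def stiffMatrix (a b : ℝ) (M r : ℕ) : Matrix (Fin (M * r + 1)) (Fin (M * r + 1)) ℝ :=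
  Matrix.of fun i j => -∫ x in a..b,
    deriv (feFun a b M r (Pi.single j 1)) x * deriv (feFun a b M r (Pi.single i 1)) x

/-! ### The time stepping scheme -/

/-- The nodal vector of the extrapolation polynomial `∑_{j=1}^k L_j(s) f(t_{n-j})`, where
`t_m = m τ` and `L_j` are the Lagrange basis polynomials at `t_{n-1}, …, t_{n-k}`
(the index `j : Fin k` stands for `j + 1`). -/
def extrapolation (a b τ : ℝ) (M r k n : ℕ) {m : ℕ} (f : ℝ → Sobolev a b m) (s : ℝ) :
    Fin (M * r + 1) → ℝ :=
  ∑ j : Fin k,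
    (Lagrange.basis Finset.univ (fun i : Fin k => ((n : ℝ) - (i + 1)) * τ) j).eval s •
      nodalVec a b M r (contRep (wderiv (f (((n : ℝ) - (j + 1)) * τ)) 0))

/-- One step of the `k`-step exponential integrator, from the nodal vector `U` at `t_{n-1}` to the
nodal vector at `t_n`, before the cut-off. -/
def expStep (a b τ : ℝ) (M r k n : ℕ) {m : ℕ} (f : ℝ → Sobolev a b m)
    (U : Fin (M * r + 1) → ℝ) : Fin (M * r + 1) → ℝ :=
  let B := (massMatrix a b M r)⁻¹ * stiffMatrix a b M r
  NormedSpace.exp (τ • B) *ᵥ U +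
    ∫ s in (((n : ℝ) - 1) * τ)..(n * τ),
      NormedSpace.exp ((n * τ - s) • B) *ᵥ extrapolation a b τ M r k n f s

/-- `uh 0, …, uh N` are the finite element solutions of the cut-off scheme with step size `τ`:
the initial value `uh 0 ∈ S_h^r` is arbitrary, and for `1 ≤ n ≤ N` the function `uh n ∈ S_h^r` has
the nodal vector `max (û^n, u_min)`. -/
structure IsCutoffScheme (a b τ : ℝ) (M r k N : ℕ) {m : ℕ} (f : ℝ → Sobolev a b m) (umin : ℝ)
    (uh : ℕ → ℝ → ℝ) : Prop where
  mem_feSpace : ∀ n ≤ N, uh n ∈ feSpace a b M r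
  step : ∀ n, 1 ≤ n → n ≤ N → ∀ j : Fin (M * r + 1),
    nodalVec a b M r (uh n) j
      = max (expStep a b τ M r k n f (nodalVec a b M r (uh (n - 1))) j) umin

end ExpCutoff

end

open ExpCutoff MeasureTheory Set

/-!
The lower bound at the nodes is immediate from the cut-off. The error estimate is an energy argument
for the nodal error in the norm given by the composite Gauss–Lobatto quadrature (`lumpForm`), which
is equivalent to the `L²`-norm on the finite element space uniformly in the mesh size, by scaling to
the reference element (`RefBound`).

On `[t_{n-1}, t_n]` the scheme before the cut-off is Duhamel's formula for the linear system
`y' = M⁻¹ A y + Φ`, with `Φ` the extrapolated source (`hasDerivAt_duhamel`). Let `U(s)` be the nodal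
vector of `u(s)`, and test the equation for `e = U - y` with `e` in the lumped inner product. As
`M⁻¹ A` represents minus the stiffness form (`lumpForm_laplace`), this leaves the term `-|∂ₓe|²` and
two errors.

* The consistency error of the space discretization (`consistency_le`). Write `uₓₓ = uₜ - f`. The
  quadrature is exact in degree `2 r - 1` (`integral_eq_sum_glWeight`), so that on each element the
  product of `uₓₓ` with a polynomial of degree `r` is integrated up to the distance of `uₓₓ` from
  polynomials of degree `r - 1`, while interpolation replaces `∂ₓu` by the derivative of the
  interpolant. Both are `O(h^r)` in `L²` by Taylor expansion. The remaining terms cancel after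
  elementwise integration by parts, by the Neumann conditions. Young's inequality absorbs the
  gradient of `e`.
* The extrapolation error in time (`norm_wderiv_extrapError_le`). It is `O(τ^k)` in `L²` because
  Lagrange interpolation reproduces Taylor polynomials; its nodal values cost an additional `h^r`
  times its `H^r`-norm (`lumpForm_nodalVec_le`, `norm_extrapError_le`).

Gronwall's inequality bounds the growth of the squared error over one step by
`exp(A τ) (|e(t_{n-1})|² + D τ)` with `D = O(τ^{2 k} + h^{2 r})` (`error_step`). The cut-off does not
increase the nodal error (`lumpForm_cutoff_le`), because `u ≥ u_min` by the maximum principle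
(`le_contRep_of_heat`), and `discrete_gronwall` sums up the steps.

Functions in `H^m(a, b)` are handled through their absolutely continuous representatives
(`isPrimitive_contRep`), which exist by the lemma of du Bois-Reymond
(`ae_const_of_weakDeriv_zero`).
-/

namespace ExpCutoff

/-! ### Functions with a weak derivative on an interval -/

/-- `G` is a primitive of the integrable function `g` on `[a, b]`, i.e. `G` is absolutely
continuous there and `g` is its a.e. derivative. -/
def IsPrimitive (a b : ℝ) (G g : ℝ → ℝ) : Prop :=
  IntervalIntegrable g volume a b ∧ ∀ x ∈ Icc a b, G x = G a + ∫ t in a..x, g t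

namespace IsPrimitive

variable {a b c d : ℝ} {G g : ℝ → ℝ}

theorem intervalIntegrable (hG : IsPrimitive a b G g) {x y : ℝ}
    (hx : x ∈ Icc a b) (hy : y ∈ Icc a b) : IntervalIntegrable g volume x y := by
  refine hG.1.mono_set ?_
  rw [uIcc_of_le (hx.1.trans hx.2)]
  exact uIcc_subset_Icc hx hy

theorem sub_eq (hG : IsPrimitive a b G g) {x y : ℝ} (hx : x ∈ Icc a b) (hy : y ∈ Icc a b) :
    G y - G x = ∫ t in x..y, g t := by
  have ha : a ∈ Icc a b := ⟨le_rfl, hx.1.trans hx.2⟩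
  rw [hG.2 x hx, hG.2 y hy, ← intervalIntegral.integral_add_adjacent_intervals
    (hG.intervalIntegrable ha hx) (hG.intervalIntegrable hx hy)]
  ring

theorem mono (hG : IsPrimitive a b G g) (hc : a ≤ c) (hcd : c ≤ d) (hd : d ≤ b) :
    IsPrimitive c d G g := by
  refine ⟨hG.intervalIntegrable ⟨hc, hcd.trans hd⟩ ⟨hc.trans hcd, hd⟩, fun x hx => ?_⟩
  rw [← hG.sub_eq ⟨hc, hcd.trans hd⟩ ⟨hc.trans hx.1, hx.2.trans hd⟩]
  ring

theorem continuousOn (hab : a ≤ b) (hG : IsPrimitive a b G g) : ContinuousOn G (Icc a b) := by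
  have h : ContinuousOn (fun x => G a + ∫ t in a..x, g t) (Icc a b) := by
    refine continuousOn_const.add ?_
    have := intervalIntegral.continuousOn_primitive_interval' hG.1 left_mem_uIcc
    rwa [uIcc_of_le hab] at this
  exact h.congr hG.2

/-- Integration by parts for an absolutely continuous function against a smooth one. -/
theorem integral_mul_deriv (hab : a ≤ b) (hG : IsPrimitive a b G g) {φ : ℝ → ℝ}
    (hφ : ContDiff ℝ 1 φ) :
    ∫ x in a..b, G x * deriv φ x = G b * φ b - G a * φ a - ∫ x in a..b, g x * φ x := by
  set H : ℝ → ℝ := fun x => G a + ∫ t in a..x, g t with hH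
  have hHG : ∀ x ∈ Icc a b, H x = G x := fun x hx => (hG.2 x hx).symm
  have hac : AbsolutelyContinuousOnInterval H a b := by
    have h1 := hG.1.absolutelyContinuousOnInterval_intervalIntegral (c := a) left_mem_uIcc
    have h2 : AbsolutelyContinuousOnInterval (fun _ : ℝ => G a) a b :=
      (contDiff_const.contDiffOn (n := 1)).absolutelyContinuousOnInterval
    exact h2.add h1
  have hφa : AbsolutelyContinuousOnInterval φ a b :=
    hφ.contDiffOn.absolutelyContinuousOnInterval
  have key := hac.integral_mul_deriv_eq_deriv_mul hφa
  rw [hHG b (right_mem_Icc.2 hab), hHG a (left_mem_Icc.2 hab)] at key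
  have e1 : ∫ x in a..b, H x * deriv φ x = ∫ x in a..b, G x * deriv φ x := by
    refine intervalIntegral.integral_congr fun x hx => ?_
    rw [uIcc_of_le hab] at hx
    simp only [hHG x hx]
  have e2 : ∫ x in a..b, deriv H x * φ x = ∫ x in a..b, g x * φ x := by
    refine intervalIntegral.integral_congr_ae ?_
    filter_upwards [hG.1.ae_hasDerivAt_integral] with x hx hxab
    have hd := (hx (uIoc_subset_uIcc hxab) a left_mem_uIcc).const_add (G a)
    rw [hd.deriv]
  rw [e1, e2] at key
  exact key

/-- A primitive of a continuous function is differentiable in the interior. -/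
theorem hasDerivAt (hG : IsPrimitive a b G g) (hg : ContinuousOn g (Icc a b)) {x : ℝ}
    (hx : x ∈ Ioo a b) : HasDerivAt G (g x) x := by
  have hab : a ≤ b := hx.1.le.trans hx.2.le
  have hn : Icc a b ∈ nhds x := Icc_mem_nhds hx.1 hx.2
  have h1 : HasDerivAt (fun y => ∫ t in a..y, g t) (g x) x := by
    refine intervalIntegral.integral_hasDerivAt_right
      (hG.intervalIntegrable ⟨le_rfl, hab⟩ ⟨hx.1.le, hx.2.le⟩) ?_ (hg.continuousAt hn)
    exact ⟨Icc a b, hn, hg.aestronglyMeasurable measurableSet_Icc⟩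
  have h2 := h1.const_add (G a)
  refine h2.congr_of_eventuallyEq ?_
  filter_upwards [hn] with y hy using hG.2 y hy

end IsPrimitive

theorem L2.integrable {a b : ℝ} (g : L2 a b) : IntegrableOn g (Ioo a b) :=
  (Lp.memLp g).integrable (by norm_num)

theorem L2.intervalIntegrable {a b : ℝ} (hab : a ≤ b) (g : L2 a b) :
    IntervalIntegrable g volume a b := by
  rw [intervalIntegrable_iff_integrableOn_Ioo_of_le hab]
  exact L2.integrable g

theorem L2.norm_sq {a b : ℝ} (g : L2 a b) : ‖g‖ ^ 2 = ∫ x in Ioo a b, g x ^ 2 := by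
  rw [← real_inner_self_eq_norm_sq, MeasureTheory.L2.inner_def]
  refine integral_congr_ae (Filter.Eventually.of_forall fun x => ?_)
  simp [sq]

theorem L2.integrable_sq {a b : ℝ} (g : L2 a b) :
    IntegrableOn (fun x => g x ^ 2) (Ioo a b) :=
  (Lp.memLp g).integrable_sq

theorem L2.intervalIntegrable_sq {a b : ℝ} (hab : a ≤ b) (g : L2 a b) :
    IntervalIntegrable (fun x => g x ^ 2) volume a b := by
  rw [intervalIntegrable_iff_integrableOn_Ioo_of_le hab]
  exact L2.integrable_sq g

theorem setIntegral_Ioo_eq {a b : ℝ} (hab : a ≤ b) (f : ℝ → ℝ) :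
    ∫ x in Ioo a b, f x = ∫ x in a..b, f x := by
  rw [intervalIntegral.integral_of_le hab, integral_Ioc_eq_integral_Ioo]

/-- A smooth function of integral zero supported in `[α, β]` has a smooth primitive supported
there. -/
theorem exists_primitive_test {α β : ℝ} {θ : ℝ → ℝ} (hθ : ContDiff ℝ ∞ θ)
    (hs : Function.support θ ⊆ Icc α β) (h0 : ∫ x in α..β, θ x = 0) :
    ∃ φ : ℝ → ℝ, ContDiff ℝ ∞ φ ∧ tsupport φ ⊆ Icc α β ∧ deriv φ = θ := by
  have hc := hθ.continuous
  have hd : ∀ x, HasDerivAt (fun x => ∫ t in α..x, θ t) (θ x) x := fun x =>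
    intervalIntegral.integral_hasDerivAt_right (hc.intervalIntegrable _ _)
      (hc.stronglyMeasurableAtFilter _ _) hc.continuousAt
  have hde : deriv (fun x => ∫ t in α..x, θ t) = θ := funext fun x => (hd x).deriv
  have hz : ∀ x y, (∀ t ∈ uIoo x y, t ∉ Icc α β) → ∫ t in x..y, θ t = 0 := by
    intro x y h
    rw [intervalIntegral.integral_congr_uIoo (g := fun _ => 0)]
    · simp
    · intro t ht
      by_contra hne
      exact h t ht (hs hne)
  refine ⟨fun x => ∫ t in α..x, θ t, ?_, ?_, hde⟩
  · rw [contDiff_infty_iff_deriv, hde]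
    exact ⟨fun x => (hd x).differentiableAt, hθ⟩
  · refine closure_minimal (fun x hx => ?_) isClosed_Icc
    by_contra hxn
    apply hx
    simp only
    rw [mem_Icc, not_and_or, not_le, not_le] at hxn
    rcases hxn with h | h
    · apply hz
      intro t ht
      rw [uIoo_of_ge h.le] at ht
      exact fun h' => absurd h'.1 (not_le.2 ht.2)
    · rw [← intervalIntegral.integral_add_adjacent_intervals (hc.intervalIntegrable _ β)
        (hc.intervalIntegrable _ _), h0, zero_add]
      apply hz
      intro t ht
      rw [uIoo_of_le h.le] at ht
      exact fun h' => absurd h'.2 (not_le.2 ht.1)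

/-- The lemma of du Bois-Reymond: a function whose weak derivative vanishes is constant. -/
theorem ae_const_of_weakDeriv_zero {a b : ℝ} (hab : a < b) {d : ℝ → ℝ}
    (hd : IntegrableOn d (Ioo a b))
    (h : ∀ φ : ℝ → ℝ, ContDiff ℝ ∞ φ → HasCompactSupport φ → tsupport φ ⊆ Ioo a b →
      ∫ x in Ioo a b, d x * deriv φ x = 0) :
    ∃ c : ℝ, d =ᵐ[volume.restrict (Ioo a b)] fun _ => c := by
  let χ : ContDiffBump ((a + b) / 2 : ℝ) :=
    ⟨(b - a) / 8, (b - a) / 4, by linarith, by linarith⟩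
  set w : ℝ → ℝ := χ.normed volume with hw
  have hwc : ContDiff ℝ ∞ w := χ.contDiff_normed
  have hws : tsupport w ⊆ Icc (a + (b - a) / 4) (b - (b - a) / 4) := by
    rw [hw, χ.tsupport_normed_eq, Real.closedBall_eq_Icc]
    refine Icc_subset_Icc ?_ ?_ <;> simp only [χ] <;> linarith
  have hwi : ∫ x, w x = 1 := χ.integral_normed
  refine ⟨∫ x in Ioo a b, d x * w x, ?_⟩
  set c := ∫ x in Ioo a b, d x * w x with hcdef
  have hmul : ∀ ψ : ℝ → ℝ, Continuous ψ → IntegrableOn (fun x => d x * ψ x) (Ioo a b) := by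
    intro ψ hψ
    exact (((integrableOn_Icc_iff_integrableOn_Ioo (μ := volume)).2 hd).mul_continuousOn
      hψ.continuousOn isCompact_Icc).mono_set Ioo_subset_Icc_self
  have key : ∀ᵐ x ∂volume, x ∈ Ioo a b → d x - c = 0 := by
    refine isOpen_Ioo.ae_eq_zero_of_integral_contDiff_smul_eq_zero
      ((hd.sub (integrable_const c)).locallyIntegrableOn) ?_
    intro ψ hψ hψc hψs
    -- Subtracting `(∫ ψ) w` makes the integral of `ψ` vanish, so that the difference is the
    -- derivative of a test function.
    obtain ⟨α, β, haα, hβb, hK⟩ : ∃ α β, a < α ∧ β < b ∧ tsupport ψ ∪ tsupport w ⊆ Icc α β := by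
      have hwK : tsupport w ⊆ Ioo a b :=
        hws.trans (Icc_subset_Ioo (by linarith) (by linarith))
      have hne : (tsupport ψ ∪ tsupport w).Nonempty := by
        refine Set.Nonempty.inr ?_
        by_contra hemp
        rw [not_nonempty_iff_eq_empty, tsupport_eq_empty_iff] at hemp
        rw [hemp] at hwi
        simp at hwi
      have hcomp : IsCompact (tsupport ψ ∪ tsupport w) :=
        hψc.isCompact.union (χ.hasCompactSupport_normed).isCompact
      obtain ⟨α, hα⟩ := hcomp.exists_isLeast hne
      obtain ⟨β, hβ⟩ := hcomp.exists_isGreatest hne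
      have hsub := union_subset hψs hwK
      exact ⟨α, β, (hsub hα.1).1, (hsub hβ.1).2, fun x hx => ⟨hα.2 hx, hβ.2 hx⟩⟩
    have hint : ∀ v : ℝ → ℝ, Function.support v ⊆ Icc α β → ∫ x in α..β, v x = ∫ x, v x := by
      intro v hv
      by_cases hαβ : α ≤ β
      · rw [intervalIntegral.integral_of_le hαβ, ← integral_Icc_eq_integral_Ioc]
        exact setIntegral_eq_integral_of_forall_compl_eq_zero fun x hx => by
          by_contra hne; exact hx (hv hne)
      · have : v = 0 := by
          funext x
          by_contra hne
          have := hv hne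
          exact hαβ (this.1.trans this.2)
        simp [this]
    have hwα : Function.support w ⊆ Icc α β :=
      (subset_tsupport w).trans (subset_union_right.trans hK)
    have hψα : Function.support ψ ⊆ Icc α β :=
      (subset_tsupport ψ).trans (subset_union_left.trans hK)
    have hθα : Function.support (fun x => ψ x - (∫ y, ψ y) * w x) ⊆ Icc α β := by
      intro x hx
      by_contra hxn
      have h1 : ψ x = 0 := by by_contra hne; exact hxn (hψα hne)
      have h2 : w x = 0 := by by_contra hne; exact hxn (hwα hne)
      exact hx (by simp [h1, h2])
    have hwcs : HasCompactSupport w := χ.hasCompactSupport_normed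
    obtain ⟨φ, hφ, hφs, hφd⟩ := exists_primitive_test
      (θ := fun x => ψ x - (∫ y, ψ y) * w x) (hψ.sub (contDiff_const.mul hwc)) hθα (by
        rw [hint _ hθα, integral_sub (hψ.continuous.integrable_of_hasCompactSupport hψc)
          ((hwc.continuous.integrable_of_hasCompactSupport hwcs).const_mul _),
          integral_const_mul, hwi]
        ring)
    have hφ0 := h φ hφ (HasCompactSupport.of_support_subset_isCompact isCompact_Icc
      ((subset_tsupport φ).trans hφs)) (hφs.trans (Icc_subset_Ioo haα hβb))
    rw [hφd] at hφ0
    have hψI : ∫ x in Ioo a b, ψ x = ∫ x, ψ x :=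
      setIntegral_eq_integral_of_forall_compl_eq_zero fun x hx => by
        by_contra hne; exact hx (hψs (subset_tsupport ψ hne))
    have e1 : ∫ x, ψ x • (d x - c) = ∫ x in Ioo a b, ψ x • (d x - c) :=
      (setIntegral_eq_integral_of_forall_compl_eq_zero fun x hx => by
        have : ψ x = 0 := by by_contra hne; exact hx (hψs (subset_tsupport ψ hne))
        simp [this]).symm
    have hψi : IntegrableOn ψ (Ioo a b) :=
      (hψ.continuous.integrable_of_hasCompactSupport hψc).integrableOn
    have e2 : ∫ x in Ioo a b, ψ x • (d x - c) = (∫ x in Ioo a b, d x * ψ x) - c * ∫ x, ψ x := by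
      rw [← hψI, ← integral_const_mul, ← integral_sub (hmul ψ hψ.continuous) (hψi.const_mul c)]
      refine integral_congr_ae (Filter.Eventually.of_forall fun x => ?_)
      simp only [smul_eq_mul]; ring
    have e3 : ∫ x in Ioo a b, d x * (ψ x - (∫ y, ψ y) * w x)
        = (∫ x in Ioo a b, d x * ψ x) - (∫ y, ψ y) * c := by
      rw [hcdef, ← integral_const_mul, ← integral_sub (hmul ψ hψ.continuous)
        ((hmul w hwc.continuous).const_mul _)]
      refine integral_congr_ae (Filter.Eventually.of_forall fun x => ?_)
      simp only; ring
    rw [e1, e2]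
    rw [e3] at hφ0
    linarith
  refine (ae_restrict_iff' measurableSet_Ioo).2 ?_
  filter_upwards [key] with x hx hxab
  linarith [hx hxab]

/-- A function with a weak derivative in `L²` has an absolutely continuous representative. -/
theorem IsWeakDeriv.exists_primitive {a b : ℝ} (hab : a < b) {g g' : L2 a b}
    (h : IsWeakDeriv a b g g') :
    ∃ G : ℝ → ℝ, IsPrimitive a b G g' ∧ g =ᵐ[volume.restrict (Ioo a b)] G := by
  set G : ℝ → ℝ := fun x => ∫ t in a..x, g' t with hGdef
  have hG : IsPrimitive a b G g' := by
    refine ⟨L2.intervalIntegrable hab.le g', fun x _ => ?_⟩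
    simp [hGdef]
  have hGi : IntegrableOn G (Ioo a b) :=
    ((hG.continuousOn hab.le).integrableOn_Icc).mono_set Ioo_subset_Icc_self
  obtain ⟨c, hc⟩ := ae_const_of_weakDeriv_zero hab (d := fun x => g x - G x)
    ((L2.integrable g).sub hGi) (by
      intro φ hφ hφc hφs
      have hφ1 : ContDiff ℝ 1 φ := hφ.of_le (by simp)
      have hφ0 : ∀ x, x ∉ Ioo a b → φ x = 0 := fun x hx => by
        by_contra hne; exact hx (hφs (subset_tsupport φ hne))
      have h1 := hG.integral_mul_deriv hab.le hφ1
      rw [hφ0 a (by simp), hφ0 b (by simp)] at h1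
      have hdc : Continuous (deriv φ) := hφ1.continuous_deriv le_rfl
      have h2 := h φ hφ hφc hφs
      simp only [sub_mul]
      rw [integral_sub (integrable_mul_test g hdc hφc.deriv), h2, setIntegral_Ioo_eq hab.le,
        setIntegral_Ioo_eq hab.le, h1]
      · ring
      · exact (((hG.continuousOn hab.le).mul hdc.continuousOn).integrableOn_Icc).mono_set
          Ioo_subset_Icc_self)
  refine ⟨fun x => c + G x, ⟨hG.1, fun x hx => ?_⟩, ?_⟩
  · simp only; rw [hG.2 x hx]; ring
  · filter_upwards [hc] with x hx
    linarith

theorem eqOn_Icc_of_ae_eq {a b : ℝ} (hab : a < b) {v w : ℝ → ℝ} (hv : ContinuousOn v (Icc a b))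
    (hw : ContinuousOn w (Icc a b)) (h : v =ᵐ[volume.restrict (Ioo a b)] w) :
    EqOn v w (Icc a b) := by
  have h1 : EqOn v w (Ioo a b) :=
    Measure.eqOn_open_of_ae_eq h isOpen_Ioo (hv.mono Ioo_subset_Icc_self)
      (hw.mono Ioo_subset_Icc_self)
  have := h1.of_subset_closure hv hw Ioo_subset_Icc_self (by rw [closure_Ioo hab.ne])
  exact this

/-- `contRep g` is the continuous representative of `g` whenever there is one. -/
theorem contRep_eqOn {a b : ℝ} (hab : a < b) {g : L2 a b} {v : ℝ → ℝ}
    (hv : ContinuousOn v (Icc a b)) (h : g =ᵐ[volume.restrict (Ioo a b)] v) :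
    EqOn (contRep g) v (Icc a b) := by
  have hex : ∃ v : ℝ → ℝ, ContinuousOn v (Icc a b) ∧ g =ᵐ[volume.restrict (Ioo a b)] v :=
    ⟨v, hv, h⟩
  rw [contRep, dif_pos hex]
  exact eqOn_Icc_of_ae_eq hab hex.choose_spec.1 hv (hex.choose_spec.2.symm.trans h)

theorem IsPrimitive.congr_left {a b : ℝ} (hab : a ≤ b) {G H g : ℝ → ℝ} (hG : IsPrimitive a b G g)
    (h : EqOn H G (Icc a b)) : IsPrimitive a b H g :=
  ⟨hG.1, fun x hx => by rw [h hx, h (left_mem_Icc.2 hab)]; exact hG.2 x hx⟩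

theorem IsPrimitive.congr_right {a b : ℝ} (hab : a ≤ b) {G g k : ℝ → ℝ} (hG : IsPrimitive a b G g)
    (h : g =ᵐ[volume.restrict (Ioo a b)] k) : IsPrimitive a b G k := by
  have hae : ∀ᵐ x ∂volume, x ∈ Ioo a b → g x = k x := (ae_restrict_iff' measurableSet_Ioo).1 h
  have hae' : ∀ᵐ x ∂volume, x ∈ Ioc a b → g x = k x := by
    have hb : ∀ᵐ x : ℝ ∂volume, x ≠ b := by simp [ae_iff]
    filter_upwards [hae, hb] with x hx hxb hxI
    exact hx ⟨hxI.1, lt_of_le_of_ne hxI.2 hxb⟩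
  refine ⟨hG.1.congr_ae (by rw [uIoc_of_le hab]; exact (ae_restrict_iff' measurableSet_Ioc).2 hae'),
    fun x hx => ?_⟩
  rw [hG.2 x hx]
  congr 1
  refine intervalIntegral.integral_congr_ae ?_
  filter_upwards [hae'] with y hy hyI
  rw [uIoc_of_le hx.1] at hyI
  exact hy ⟨hyI.1, hyI.2.trans hx.2⟩

section Sobolev

variable {a b : ℝ} {m : ℕ}

theorem wderiv_eq (g : Sobolev a b m) {j : ℕ} (h : j < m + 1) :
    wderiv g j = (g : PiLp 2 (fun _ : Fin (m + 1) => L2 a b)) ⟨j, h⟩ := by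
  rw [wderiv, dif_pos h]

theorem isWeakDeriv_wderiv (g : Sobolev a b m) {j : ℕ} (h : j < m) :
    IsWeakDeriv a b (wderiv g j) (wderiv g (j + 1)) := by
  rw [wderiv_eq g (h.trans (Nat.lt_succ_self m)), wderiv_eq g (Nat.succ_lt_succ h)]
  exact g.2 ⟨j, h⟩

theorem wderiv_add (g k : Sobolev a b m) (j : ℕ) : wderiv (g + k) j = wderiv g j + wderiv k j := by
  unfold wderiv; split <;> simp

theorem wderiv_smul (c : ℝ) (g : Sobolev a b m) (j : ℕ) : wderiv (c • g) j = c • wderiv g j := by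
  unfold wderiv; split <;> simp

theorem norm_wderiv_le (g : Sobolev a b m) (j : ℕ) : ‖wderiv g j‖ ≤ ‖g‖ := by
  unfold wderiv
  split
  · exact PiLp.norm_apply_le (p := 2) (g : PiLp 2 (fun _ : Fin (m + 1) => L2 a b)) _
  · simp

theorem wderiv_ae_eq_contRep (hab : a < b) (g : Sobolev a b m) {j : ℕ} (h : j < m) :
    wderiv g j =ᵐ[volume.restrict (Ioo a b)] contRep (wderiv g j) := by
  obtain ⟨G, hG, hGg⟩ := (isWeakDeriv_wderiv g h).exists_primitive hab
  filter_upwards [hGg, ae_restrict_mem measurableSet_Ioo] with x hx hxI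
  rw [hx, contRep_eqOn hab (hG.continuousOn hab.le) hGg (Ioo_subset_Icc_self hxI)]

/-- The continuous representative of `g^{(j)}` is a primitive of `g^{(j+1)}` when `j < m`. -/
theorem isPrimitive_contRep (hab : a < b) (g : Sobolev a b m) {j : ℕ} (h : j < m) :
    IsPrimitive a b (contRep (wderiv g j)) (wderiv g (j + 1)) := by
  obtain ⟨G, hG, hGg⟩ := (isWeakDeriv_wderiv g h).exists_primitive hab
  exact hG.congr_left hab.le (contRep_eqOn hab (hG.continuousOn hab.le) hGg)

theorem isPrimitive_contRep_contRep (hab : a < b) (g : Sobolev a b m) {j : ℕ} (h : j + 1 < m) :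
    IsPrimitive a b (contRep (wderiv g j)) (contRep (wderiv g (j + 1))) :=
  (isPrimitive_contRep hab g (Nat.lt_of_succ_lt h)).congr_right hab.le
    (wderiv_ae_eq_contRep hab g h)

theorem continuousOn_contRep (hab : a < b) (g : Sobolev a b m) {j : ℕ} (h : j < m) :
    ContinuousOn (contRep (wderiv g j)) (Icc a b) :=
  (isPrimitive_contRep hab g h).continuousOn hab.le

theorem contRep_add (hab : a < b) (g k : Sobolev a b m) {j : ℕ} (h : j < m) {x : ℝ}
    (hx : x ∈ Icc a b) :
    contRep (wderiv (g + k) j) x = contRep (wderiv g j) x + contRep (wderiv k j) x := by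
  refine contRep_eqOn hab (v := fun x => contRep (wderiv g j) x + contRep (wderiv k j) x)
    ((continuousOn_contRep hab g h).add (continuousOn_contRep hab k h)) ?_ hx
  rw [wderiv_add]
  filter_upwards [wderiv_ae_eq_contRep hab g h, wderiv_ae_eq_contRep hab k h,
    Lp.coeFn_add (wderiv g j) (wderiv k j)] with y h1 h2 h3
  rw [h3, Pi.add_apply, h1, h2]

theorem contRep_smul (hab : a < b) (c : ℝ) (g : Sobolev a b m) {j : ℕ} (h : j < m) {x : ℝ}
    (hx : x ∈ Icc a b) :
    contRep (wderiv (c • g) j) x = c * contRep (wderiv g j) x := by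
  refine contRep_eqOn hab (v := fun x => c * contRep (wderiv g j) x)
    (continuousOn_const.mul (continuousOn_contRep hab g h)) ?_ hx
  rw [wderiv_smul]
  filter_upwards [wderiv_ae_eq_contRep hab g h, Lp.coeFn_smul c (wderiv g j)] with y h1 h3
  rw [h3, Pi.smul_apply, h1, smul_eq_mul]

end Sobolev

/-- The Cauchy–Schwarz inequality `(∫ |g|)² ≤ (d - c) ∫ g²`. -/
theorem sq_integral_abs_le {c d : ℝ} (hcd : c ≤ d) {g : ℝ → ℝ}
    (hg : IntervalIntegrable g volume c d)
    (hg2 : IntervalIntegrable (fun x => g x ^ 2) volume c d) :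
    (∫ x in c..d, |g x|) ^ 2 ≤ (d - c) * ∫ x in c..d, g x ^ 2 := by
  set I := ∫ x in c..d, |g x| with hI
  rcases eq_or_lt_of_le hcd with rfl | hlt
  · simp [hI]
  have h0 : 0 ≤ ∫ x in c..d, (|g x| - I / (d - c)) ^ 2 :=
    intervalIntegral.integral_nonneg hcd fun x _ => sq_nonneg _
  have h1 : ∫ x in c..d, (|g x| - I / (d - c)) ^ 2
      = (∫ x in c..d, g x ^ 2) - 2 * (I / (d - c)) * I + (I / (d - c)) ^ 2 * (d - c) := by
    have : ∀ x, (|g x| - I / (d - c)) ^ 2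
        = g x ^ 2 - 2 * (I / (d - c)) * |g x| + (I / (d - c)) ^ 2 := by
      intro x; rw [sub_sq, sq_abs]; ring
    simp only [this]
    rw [intervalIntegral.integral_add (hg2.sub (hg.abs.const_mul _)) (by simp),
      intervalIntegral.integral_sub hg2 (hg.abs.const_mul _),
      intervalIntegral.integral_const_mul, intervalIntegral.integral_const]
    simp only [smul_eq_mul]; ring
  rw [h1] at h0
  have hpos : 0 < d - c := by linarith
  have h2 : (∫ x in c..d, g x ^ 2) - 2 * (I / (d - c)) * I + (I / (d - c)) ^ 2 * (d - c)
      = ((d - c) * (∫ x in c..d, g x ^ 2) - I ^ 2) / (d - c) := by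
    field_simp; ring
  rw [h2] at h0
  have := (div_nonneg_iff.1 h0)
  rcases this with h | h
  · linarith [h.1]
  · linarith [h.2]

/-! ### Sobolev embedding, polynomial approximation, and the comparison principle -/

section Sobolev

variable {a b : ℝ} {m : ℕ}

/-- The Sobolev embedding `H¹ ⊂ C`. -/
theorem abs_contRep_le (hab : a < b) (g : Sobolev a b m) {j : ℕ} (h : j < m) {x : ℝ}
    (hx : x ∈ Icc a b) :
    |contRep (wderiv g j) x| ≤ (1 / √(b - a) + √(b - a)) * ‖g‖ := by
  set G := contRep (wderiv g j)
  set l := b - a with hl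
  have hl0 : 0 < l := by linarith
  have hG := isPrimitive_contRep hab g h
  have hL1 : ∀ i, ∫ t in a..b, |wderiv g i t| ≤ √l * ‖g‖ := by
    intro i
    have h1 := sq_integral_abs_le hab.le (L2.intervalIntegrable hab.le (wderiv g i))
      (L2.intervalIntegrable_sq hab.le (wderiv g i))
    rw [← setIntegral_Ioo_eq hab.le (fun x => wderiv g i x ^ 2), ← L2.norm_sq] at h1
    refine abs_le_of_sq_le_sq' ?_ (by positivity) |>.2
    rw [mul_pow, Real.sq_sqrt hl0.le]
    refine h1.trans ?_
    gcongr
    exact norm_wderiv_le g i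
  have hpt : ∀ y ∈ Icc a b, |G x| ≤ |G y| + √l * ‖g‖ := by
    intro y hy
    have h1 : |G x - G y| ≤ √l * ‖g‖ := by
      rw [hG.sub_eq hy hx]
      rw [← Real.norm_eq_abs]
      refine (intervalIntegral.norm_integral_le_integral_norm_uIoc).trans ?_
      simp only [Real.norm_eq_abs]
      refine le_trans ?_ (hL1 (j + 1))
      rw [intervalIntegral.integral_of_le hab.le]
      refine setIntegral_mono_set ?_ ?_ ?_
      · exact (L2.intervalIntegrable hab.le _).abs.1
      · exact Filter.Eventually.of_forall fun _ => abs_nonneg _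
      · refine LE.le.eventuallyLE fun z hz => ?_
        rcases mem_uIoc.1 hz with hz | hz
        · exact ⟨hy.1.trans_lt hz.1, hz.2.trans hx.2⟩
        · exact ⟨hx.1.trans_lt hz.1, hz.2.trans hy.2⟩
    have h2 := abs_sub_abs_le_abs_sub (G x) (G y)
    linarith
  have hGi : IntervalIntegrable (fun y => |G y|) volume a b := by
    apply ContinuousOn.intervalIntegrable
    rw [uIcc_of_le hab.le]
    exact (continuousOn_contRep hab g h).abs
  have hint : l * |G x| ≤ √l * ‖g‖ + l * (√l * ‖g‖) := by
    have h1 := intervalIntegral.integral_mono_on hab.le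
      (by simp : IntervalIntegrable (fun _ => |G x|) volume a b)
      (hGi.add (by simp : IntervalIntegrable (fun _ => √l * ‖g‖) volume a b)) hpt
    rw [intervalIntegral.integral_add hGi (by simp)] at h1
    simp only [intervalIntegral.integral_const, smul_eq_mul] at h1
    have h2 : ∫ t in a..b, |G t| = ∫ t in a..b, |wderiv g j t| := by
      rw [← setIntegral_Ioo_eq hab.le, ← setIntegral_Ioo_eq hab.le]
      refine integral_congr_ae ?_
      filter_upwards [wderiv_ae_eq_contRep hab g h] with t ht
      simp only [ht]; rfl
    have h3 := hL1 j
    rw [← hl] at h1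
    linarith
  have hs : √l * √l = l := Real.mul_self_sqrt hl0.le
  have hs0 : 0 < √l := Real.sqrt_pos.2 hl0
  have h4 : l * ((1 / √l + √l) * ‖g‖) = √l * ‖g‖ + l * (√l * ‖g‖) := by
    field_simp
    rw [Real.sq_sqrt hl0.le]
    ring
  rw [← h4] at hint
  exact le_of_mul_le_mul_left hint hl0

/-- Evaluation at `x ∈ [a, b]` of the continuous representative of the `j`-th derivative, as a
continuous linear functional on `H^m(a, b)`, `j < m`. -/
noncomputable def evalCLM (hab : a < b) {j : ℕ} (h : j < m) {x : ℝ} (hx : x ∈ Icc a b) :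
    Sobolev a b m →L[ℝ] ℝ :=
  LinearMap.mkContinuous
    { toFun := fun g => contRep (wderiv g j) x
      map_add' := fun g k => contRep_add hab g k h hx
      map_smul' := fun c g => contRep_smul hab c g h hx }
    (1 / √(b - a) + √(b - a)) (fun g => abs_contRep_le hab g h hx)

theorem evalCLM_apply (hab : a < b) {j : ℕ} (h : j < m) {x : ℝ} (hx : x ∈ Icc a b)
    (g : Sobolev a b m) : evalCLM hab h hx g = contRep (wderiv g j) x := rfl

/-- The `j`-th weak derivative as a linear map. -/
noncomputable def wderivₗ (a b : ℝ) (m j : ℕ) : Sobolev a b m →ₗ[ℝ] L2 a b where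
  toFun g := wderiv g j
  map_add' g k := wderiv_add g k j
  map_smul' c g := wderiv_smul c g j

theorem contRep_sub (hab : a < b) (g k : Sobolev a b m) {j : ℕ} (h : j < m) {x : ℝ}
    (hx : x ∈ Icc a b) :
    contRep (wderiv (g - k) j) x = contRep (wderiv g j) x - contRep (wderiv k j) x :=
  (evalCLM hab h hx).map_sub g k

end Sobolev

theorem exists_poly_derivative_eq (q : ℝ[X]) {n : ℕ} (hq : q.natDegree ≤ n) (c x : ℝ) :
    ∃ p : ℝ[X], p.natDegree ≤ n + 1 ∧ Polynomial.derivative p = q ∧ p.eval x = c := by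
  set P : ℝ[X] := ∑ i ∈ Finset.range (n + 1), Polynomial.monomial (i + 1) (q.coeff i / (i + 1))
    with hP
  have hdeg : P.natDegree ≤ n + 1 := by
    refine Polynomial.natDegree_sum_le_of_forall_le _ _ fun i hi => ?_
    refine (Polynomial.natDegree_monomial_le _).trans ?_
    have := Finset.mem_range.1 hi
    omega
  have hder : Polynomial.derivative P = q := by
    conv_rhs => rw [Polynomial.as_sum_range' q (n + 1) (by omega)]
    rw [hP, Polynomial.derivative_sum]
    refine Finset.sum_congr rfl fun i _ => ?_
    rw [Polynomial.derivative_monomial]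
    congr 1
    push_cast
    field_simp
  refine ⟨P + Polynomial.C (c - P.eval x), ?_, by simp [hder], by simp⟩
  refine (Polynomial.natDegree_add_le _ _).trans ?_
  simp [hdeg]

/-- An approximation of `G'` by a polynomial integrates to one of `G`, gaining a factor
`β - α`. -/
theorem IsPrimitive.exists_poly_approx {α β B : ℝ} (hαβ : α ≤ β) {G g : ℝ → ℝ}
    (hG : IsPrimitive α β G g) {q : ℝ[X]} {n : ℕ} (hq : q.natDegree ≤ n)
    (hB : ∀ x ∈ Icc α β, |g x - q.eval x| ≤ B) :
    ∃ p : ℝ[X], p.natDegree ≤ n + 1 ∧ Polynomial.derivative p = q ∧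
      ∀ x ∈ Icc α β, |G x - p.eval x| ≤ (β - α) * B := by
  obtain ⟨p, hp, hpd, hpe⟩ := exists_poly_derivative_eq q hq (G α) α
  refine ⟨p, hp, hpd, fun x hx => ?_⟩
  have hα : α ∈ Icc α β := left_mem_Icc.2 hαβ
  have h1 : G x - p.eval x = ∫ t in α..x, (g t - q.eval t) := by
    rw [intervalIntegral.integral_sub (hG.intervalIntegrable hα hx)
      (q.continuous.intervalIntegrable _ _), ← hG.sub_eq hα hx,
      intervalIntegral.integral_eq_sub_of_hasDerivAt (f := fun t => p.eval t)
        (fun t _ => by rw [← hpd]; exact p.hasDerivAt t) (q.continuous.intervalIntegrable _ _), hpe]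
    ring
  have hB0 : 0 ≤ B := (abs_nonneg _).trans (hB α hα)
  rw [h1]
  have h2 := intervalIntegral.norm_integral_le_of_norm_le_const (a := α) (b := x) (C := B)
    (f := fun t => g t - q.eval t) (fun t ht => by
      rw [uIoc_of_le hx.1] at ht
      exact hB t ⟨ht.1.le, ht.2.trans hx.2⟩)
  rw [Real.norm_eq_abs, abs_of_nonneg (sub_nonneg.2 hx.1)] at h2
  refine h2.trans ?_
  rw [mul_comm]
  exact mul_le_mul_of_nonneg_right (by linarith [hx.2]) hB0

/-- Taylor approximation for a chain `G 0, G 1, …, G (n + 1)` of successive derivatives. -/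
theorem exists_poly_approx {α β : ℝ} (hαβ : α ≤ β) (n : ℕ) :
    ∀ G : ℕ → ℝ → ℝ, (∀ i < n + 1, IsPrimitive α β (G i) (G (i + 1))) →
    ∃ p : ℝ[X], p.natDegree ≤ n ∧
      ∀ x ∈ Icc α β, |G 0 x - p.eval x| ≤ (β - α) ^ n * ∫ t in α..β, |G (n + 1) t| := by
  induction n with
  | zero =>
    intro G hG
    have h0 := hG 0 (by omega)
    refine ⟨Polynomial.C (G 0 α), by simp, fun x hx => ?_⟩
    rw [Polynomial.eval_C, h0.sub_eq (left_mem_Icc.2 hαβ) hx, pow_zero, one_mul]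
    refine (intervalIntegral.abs_integral_le_integral_abs hx.1).trans ?_
    refine intervalIntegral.integral_mono_interval le_rfl hx.1 hx.2
      (Filter.Eventually.of_forall fun _ => abs_nonneg _) h0.1.abs
  | succ n ih =>
    intro G hG
    obtain ⟨q, hq, hqB⟩ := ih (fun i => G (i + 1)) (fun i hi => hG (i + 1) (by omega))
    obtain ⟨p, hp, -, hpB⟩ := (hG 0 (by omega)).exists_poly_approx hαβ hq hqB
    refine ⟨p, hp, fun x hx => (hpB x hx).trans (le_of_eq ?_)⟩
    ring

/-- Taylor approximation of a function together with its derivative. -/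
theorem exists_poly_approx_deriv {α β : ℝ} (hαβ : α ≤ β) (n : ℕ) (G : ℕ → ℝ → ℝ)
    (hG : ∀ i < n + 2, IsPrimitive α β (G i) (G (i + 1))) :
    ∃ p : ℝ[X], p.natDegree ≤ n + 1 ∧
      (∀ x ∈ Icc α β, |G 0 x - p.eval x|
        ≤ (β - α) * ((β - α) ^ n * ∫ t in α..β, |G (n + 2) t|)) ∧
      ∀ x ∈ Icc α β, |G 1 x - (Polynomial.derivative p).eval x|
        ≤ (β - α) ^ n * ∫ t in α..β, |G (n + 2) t| := by
  obtain ⟨q, hq, hqB⟩ := exists_poly_approx hαβ n (fun i => G (i + 1))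
    (fun i hi => hG (i + 1) (by omega))
  obtain ⟨p, hp, hpq, hpB⟩ := (hG 0 (by omega)).exists_poly_approx hαβ hq hqB
  refine ⟨p, hp, hpB, fun x hx => ?_⟩
  rw [hpq]
  exact hqB x hx

section Time

variable {E : Type*} [NormedAddCommGroup E] [NormedSpace ℝ E]

/-- Taylor's theorem with base point in the interior of the interval of regularity. -/
theorem taylor_remainder_bound_of_base {f : ℝ → E} {A B C x₀ x : ℝ} {n : ℕ} (hAB : A < B)
    (hf : ContDiffOn ℝ (n + 1) f (Icc A B)) (hA : A ≤ x₀) (hx : x₀ ≤ x) (hB : x ≤ B)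
    (hC : ∀ y ∈ Icc A B, ‖iteratedDerivWithin (n + 1) f (Icc A B) y‖ ≤ C) :
    ‖f x - taylorWithinEval f n (Icc A B) x₀ x‖ ≤ C * (x - x₀) ^ (n + 1) := by
  have hf' : DifferentiableOn ℝ (iteratedDerivWithin n f (Icc A B)) (Icc A B) :=
    hf.differentiableOn_iteratedDerivWithin (mod_cast n.lt_succ_self) (uniqueDiffOn_Icc hAB)
  have I : Icc x₀ x ⊆ Icc A B := Icc_subset_Icc hA hB
  have hC0 : 0 ≤ C := (norm_nonneg _).trans (hC x₀ (I ⟨le_rfl, hx⟩))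
  have h' : ∀ y ∈ Ico x₀ x,
      ‖(((n.factorial : ℝ))⁻¹ * (x - y) ^ n) • iteratedDerivWithin (n + 1) f (Icc A B) y‖ ≤
        (x - x₀) ^ n * C := by
    rintro y ⟨hay, hyx⟩
    rw [norm_smul, Real.norm_eq_abs, abs_mul, abs_pow, abs_inv, Nat.abs_cast,
      abs_of_nonneg (by linarith : 0 ≤ x - y)]
    have h1 : ((n.factorial : ℝ))⁻¹ ≤ 1 := inv_le_one_of_one_le₀ (by
      exact_mod_cast Nat.one_le_iff_ne_zero.2 n.factorial_ne_zero)
    have h2 : (x - y) ^ n ≤ (x - x₀) ^ n := pow_le_pow_left₀ (by linarith) (by linarith) n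
    have h3 : ((n.factorial : ℝ))⁻¹ * (x - y) ^ n ≤ (x - x₀) ^ n := by
      refine le_trans (mul_le_of_le_one_left (pow_nonneg (by linarith) n) h1) h2
    exact mul_le_mul h3 (hC y (I ⟨hay, hyx.le⟩)) (norm_nonneg _) (pow_nonneg (by linarith) n)
  have hd : ∀ t ∈ Icc x₀ x, HasDerivWithinAt (fun y => taylorWithinEval f n (Icc A B) y x)
      (((n.factorial : ℝ)⁻¹ * (x - t) ^ n) • iteratedDerivWithin (n + 1) f (Icc A B) t)
      (Icc x₀ x) t := fun t ht =>
    (hasDerivWithinAt_taylorWithinEval_at_Icc x hAB (I ht) hf.of_succ hf').mono I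
  have := norm_image_sub_le_of_norm_deriv_le_segment' hd h' x (right_mem_Icc.2 hx)
  simp only [taylorWithinEval_self] at this
  refine this.trans_eq ?_
  ring

/-- Lagrange interpolation reproduces polynomials. -/
theorem sum_basis_mul_eval {k : ℕ} {v : Fin k → ℝ} (hv : Function.Injective v) {q : ℝ[X]}
    (hq : q.degree < k) (s : ℝ) :
    ∑ j, (Lagrange.basis Finset.univ v j).eval s * q.eval (v j) = q.eval s := by
  have h := Lagrange.eq_interpolate (s := Finset.univ) (v := v) (f := q) hv.injOn
    (by simpa using hq)
  conv_rhs => rw [h, Lagrange.interpolate_apply, Polynomial.eval_finsetSum]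
  refine Finset.sum_congr rfl fun j _ => ?_
  simp [mul_comm]

/-- The error of vector-valued Lagrange extrapolation: the Taylor polynomial at `x₀` is reproduced,
so only the Taylor remainders at `s` and at the points `v j`, all in `[x₀, x₀ + D]`, contribute. -/
theorem norm_sub_lagrange_le {g : ℝ → E} {A B C D Λ x₀ s : ℝ} {k : ℕ} (hk : 1 ≤ k) (hAB : A < B)
    (hg : ContDiffOn ℝ k g (Icc A B))
    (hC : ∀ y ∈ Icc A B, ‖iteratedDerivWithin k g (Icc A B) y‖ ≤ C)
    {v : Fin k → ℝ} (hv : Function.Injective v) (hA : A ≤ x₀)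
    (hvD : ∀ j, v j ∈ Icc x₀ (x₀ + D)) (hvB : ∀ j, v j ≤ B) (hs : s ∈ Icc x₀ (x₀ + D))
    (hsB : s ≤ B) (hΛ : ∀ j, |(Lagrange.basis Finset.univ v j).eval s| ≤ Λ) :
    ‖g s - ∑ j, (Lagrange.basis Finset.univ v j).eval s • g (v j)‖ ≤ (1 + k * Λ) * (C * D ^ k) := by
  obtain ⟨n, rfl⟩ : ∃ n, k = n + 1 := ⟨k - 1, by omega⟩
  have hC0 : 0 ≤ C := (norm_nonneg _).trans (hC s ⟨hA.trans hs.1, hsB⟩)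
  have hrem : ∀ x ∈ Icc x₀ (x₀ + D), x ≤ B →
      ‖g x - taylorWithinEval g n (Icc A B) x₀ x‖ ≤ C * D ^ (n + 1) := by
    intro x hx hxB
    refine (taylor_remainder_bound_of_base hAB (by exact_mod_cast hg) hA hx.1 hxB hC).trans ?_
    refine mul_le_mul_of_nonneg_left (pow_le_pow_left₀ (by linarith [hx.1]) ?_ _) hC0
    linarith [hx.2]
  set P := fun x => taylorWithinEval g n (Icc A B) x₀ x with hP
  have hrep : ∑ j, (Lagrange.basis Finset.univ v j).eval s • P (v j) = P s := by
    simp only [hP, taylor_within_apply, Finset.smul_sum]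
    rw [Finset.sum_comm]
    refine Finset.sum_congr rfl fun i hi => ?_
    simp only [← mul_smul]
    rw [← Finset.sum_smul]
    congr 1
    have h1 := sum_basis_mul_eval hv (q := (Polynomial.X - Polynomial.C x₀) ^ i) (by
      rw [Polynomial.degree_pow, Polynomial.degree_X_sub_C]
      have := Finset.mem_range.1 hi
      simp only [nsmul_eq_mul, mul_one]
      exact_mod_cast this) s
    simp only [Polynomial.eval_pow, Polynomial.eval_sub, Polynomial.eval_X,
      Polynomial.eval_C] at h1
    rw [← h1, Finset.mul_sum]
    exact Finset.sum_congr rfl fun j _ => by ring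
  have hsplit : g s - ∑ j, (Lagrange.basis Finset.univ v j).eval s • g (v j)
      = (g s - P s) - ∑ j, (Lagrange.basis Finset.univ v j).eval s • (g (v j) - P (v j)) := by
    simp only [smul_sub, Finset.sum_sub_distrib, hrep]
    abel
  rw [hsplit]
  refine (norm_sub_le _ _).trans ?_
  have h2 : ‖∑ j, (Lagrange.basis Finset.univ v j).eval s • (g (v j) - P (v j))‖
      ≤ ∑ _j : Fin (n + 1), Λ * (C * D ^ (n + 1)) := by
    refine norm_sum_le_of_le _ fun j _ => ?_
    rw [norm_smul, Real.norm_eq_abs]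
    exact mul_le_mul (hΛ j) (hrem _ (hvD j) (hvB j)) (norm_nonneg _)
      ((abs_nonneg _).trans (hΛ j))
  rw [Finset.sum_const, Finset.card_univ, Fintype.card_fin, nsmul_eq_mul] at h2
  have h3 := hrem s hs hsB
  calc _ ≤ C * D ^ (n + 1) + ((n + 1 : ℕ) : ℝ) * (Λ * (C * D ^ (n + 1))) := add_le_add h3 h2
    _ = _ := by ring

end Time

/-- The maximum principle (lower bound) for classical supersolutions of the heat equation with
homogeneous Neumann boundary conditions. At a minimum `(t₀, x₀)`, `t₀ > 0`, of a strict
supersolution one has `uₓ = 0`, also when `x₀` is an end point, and `uₓₓ < 0`; hence `u(t₀, ·)`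
decreases when `x` moves away from `x₀` into the interval, a contradiction. -/
theorem le_of_heat_supersolution {a b T μ : ℝ} (hab : a < b)
    {U Ux Uxx Ut : ℝ → ℝ → ℝ}
    (hcont : ContinuousOn (fun p : ℝ × ℝ => U p.1 p.2) (Icc 0 T ×ˢ Icc a b))
    (ht : ∀ t ∈ Ioc 0 T, ∀ x ∈ Icc a b,
      HasDerivWithinAt (fun s => U s x) (Ut t x) (Icc 0 T) t)
    (hx : ∀ t ∈ Ioc 0 T, IsPrimitive a b (U t) (Ux t))
    (hxx : ∀ t ∈ Ioc 0 T, IsPrimitive a b (Ux t) (Uxx t))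
    (hxxc : ∀ t ∈ Ioc 0 T, ContinuousOn (Uxx t) (Icc a b))
    (ha : ∀ t ∈ Ioc 0 T, Ux t a = 0) (hb : ∀ t ∈ Ioc 0 T, Ux t b = 0)
    (hsup : ∀ t ∈ Ioc 0 T, ∀ x ∈ Icc a b, Uxx t x ≤ Ut t x)
    (hinit : ∀ x ∈ Icc a b, μ ≤ U 0 x) :
    ∀ t ∈ Icc 0 T, ∀ x ∈ Icc a b, μ ≤ U t x := by
  intro t₁ ht₁ x₁ hx₁
  by_contra! hlt
  have ht₁0 : 0 < t₁ := by
    rcases eq_or_lt_of_le ht₁.1 with h | h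
    · rw [← h] at hlt; exact absurd (hinit x₁ hx₁) (not_le.2 hlt)
    · exact h
  -- The perturbation `ε t` makes the supersolution strict and keeps the value at `(t₁, x₁)`
  -- below `μ`.
  set ε := (μ - U t₁ x₁) / (2 * t₁) with hε
  have hε0 : 0 < ε := div_pos (by linarith) (by linarith)
  have hεt : ε * t₁ = (μ - U t₁ x₁) / 2 := by rw [hε]; field_simp
  obtain ⟨⟨t₀, x₀⟩, ⟨ht₀, hx₀⟩, hmin⟩ := (isCompact_Icc.prod isCompact_Icc).exists_isMinOn
    (⟨(t₁, x₁), ht₁, hx₁⟩ : (Icc 0 T ×ˢ Icc a b : Set (ℝ × ℝ)).Nonempty)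
    (hcont.add (continuousOn_const.mul continuousOn_fst :
      ContinuousOn (fun p : ℝ × ℝ => ε * p.1) _))
  have hmin' : ∀ t ∈ Icc 0 T, ∀ x ∈ Icc a b, U t₀ x₀ + ε * t₀ ≤ U t x + ε * t :=
    fun t ht x hx => hmin (show (t, x) ∈ Icc 0 T ×ˢ Icc a b from ⟨ht, hx⟩)
  simp only at ht₀ hx₀
  have ht₀0 : 0 < t₀ := by
    rcases eq_or_lt_of_le ht₀.1 with h | h
    · have h1 := hmin' t₁ ht₁ x₁ hx₁
      rw [← h] at h1
      have := hinit x₀ hx₀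
      linarith
    · exact h
  have ht₀' : t₀ ∈ Ioc 0 T := ⟨ht₀0, ht₀.2⟩
  have htime : Ut t₀ x₀ + ε ≤ 0 := by
    have hd : HasDerivWithinAt (fun s => U s x₀ + ε * s) (Ut t₀ x₀ + ε) (Icc 0 T) t₀ := by
      have h1 : HasDerivAt (fun s => ε * s) ε t₀ := by
        simpa using (hasDerivAt_id t₀).const_mul ε
      exact (ht t₀ ht₀' x₀ hx₀).add h1.hasDerivWithinAt
    have hloc : IsLocalMinOn (fun s => U s x₀ + ε * s) (Icc 0 T) t₀ :=
      IsMinOn.localize fun s hs => hmin' s hs x₀ hx₀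
    have hcone : (0 : ℝ) - t₀ ∈ posTangentConeAt (Icc 0 T) t₀ :=
      sub_mem_posTangentConeAt_of_segment_subset (by
        rw [segment_symm, segment_eq_Icc ht₀0.le]
        exact Icc_subset_Icc le_rfl ht₀.2)
    have := hloc.hasFDerivWithinAt_nonneg hd.hasFDerivWithinAt hcone
    simp at this
    nlinarith
  have hUxx0 : Uxx t₀ x₀ < 0 := by linarith [hsup t₀ ht₀' x₀ hx₀]
  have hUx0 : Ux t₀ x₀ = 0 := by
    rcases eq_or_lt_of_le hx₀.1 with h | h
    · rw [← h]; exact ha t₀ ht₀'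
    rcases eq_or_lt_of_le hx₀.2 with h' | h'
    · rw [h']; exact hb t₀ ht₀'
    have hd := (hx t₀ ht₀').hasDerivAt ((hxx t₀ ht₀').continuousOn hab.le) ⟨h, h'⟩
    refine IsLocalMin.hasDerivAt_eq_zero ?_ hd
    filter_upwards [Icc_mem_nhds h h'] with y hy
    linarith [hmin' t₀ ht₀ y hy]
  have hnear := (hxxc t₀ ht₀' x₀ hx₀).eventually_lt continuousWithinAt_const hUxx0
  obtain ⟨δ, hδ0, hδ⟩ := Metric.mem_nhdsWithin_iff.1 hnear
  have hδ' : ∀ y ∈ Icc a b, |y - x₀| < δ → Uxx t₀ y < 0 := fun y hy hyd =>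
    hδ ⟨by simpa [Real.dist_eq] using hyd, hy⟩
  have hxc := (hxx t₀ ht₀').continuousOn hab.le
  have hxxi : ∀ {y z}, y ∈ Icc a b → z ∈ Icc a b →
    IntervalIntegrable (Uxx t₀) volume y z := fun hy hz => (hxx t₀ ht₀').intervalIntegrable hy hz
  rcases lt_or_ge x₀ b with hlt' | hge
  · obtain ⟨y, hy1, hy2⟩ : ∃ y, x₀ < y ∧ y < min b (x₀ + δ) :=
      exists_between (lt_min hlt' (by linarith))
    have hyb := (lt_min_iff.1 hy2).1
    have hyδ := (lt_min_iff.1 hy2).2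
    have hyI : y ∈ Icc a b := ⟨hx₀.1.trans hy1.le, hyb.le⟩
    have hneg : ∀ z ∈ Ioo x₀ y, 0 < -Ux t₀ z := by
      intro z hz
      have hzI : z ∈ Icc a b := ⟨hx₀.1.trans hz.1.le, hz.2.le.trans hyb.le⟩
      have h1 := (hxx t₀ ht₀').sub_eq hx₀ hzI
      have h2 : 0 < ∫ w in x₀..z, -Uxx t₀ w :=
        intervalIntegral.intervalIntegral_pos_of_pos_on (hxxi hx₀ hzI).neg (fun w hw => by
          have := hδ' w ⟨hx₀.1.trans hw.1.le, hw.2.le.trans hzI.2⟩ (by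
            rw [abs_of_pos (by linarith [hw.1])]; linarith [hw.2, hz.2])
          linarith) hz.1
      rw [intervalIntegral.integral_neg] at h2
      linarith
    have h3 : 0 < ∫ w in x₀..y, -Ux t₀ w :=
      intervalIntegral.intervalIntegral_pos_of_pos_on
        ((hx t₀ ht₀').intervalIntegrable hx₀ hyI).neg hneg hy1
    rw [intervalIntegral.integral_neg, ← (hx t₀ ht₀').sub_eq hx₀ hyI] at h3
    linarith [hmin' t₀ ht₀ y hyI]
  · have hxb : x₀ = b := le_antisymm hx₀.2 hge
    obtain ⟨y, hy1, hy2⟩ : ∃ y, max a (x₀ - δ) < y ∧ y < x₀ :=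
      exists_between (max_lt (by linarith) (by linarith))
    have hya := (max_lt_iff.1 hy1).1
    have hyδ := (max_lt_iff.1 hy1).2
    have hyI : y ∈ Icc a b := ⟨hya.le, hy2.le.trans hx₀.2⟩
    have hpos : ∀ z ∈ Ioo y x₀, 0 < Ux t₀ z := by
      intro z hz
      have hzI : z ∈ Icc a b := ⟨hya.le.trans hz.1.le, hz.2.le.trans hx₀.2⟩
      have h1 := (hxx t₀ ht₀').sub_eq hzI hx₀
      have h2 : 0 < ∫ w in z..x₀, -Uxx t₀ w :=
        intervalIntegral.intervalIntegral_pos_of_pos_on (hxxi hzI hx₀).neg (fun w hw => by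
          have := hδ' w ⟨hzI.1.trans hw.1.le, hw.2.le.trans hx₀.2⟩ (by
            rw [abs_of_neg (by linarith [hw.2])]; linarith [hw.1, hz.1])
          linarith) hz.2
      rw [intervalIntegral.integral_neg] at h2
      linarith
    have h3 : 0 < ∫ w in y..x₀, Ux t₀ w :=
      intervalIntegral.intervalIntegral_pos_of_pos_on
        ((hx t₀ ht₀').intervalIntegrable hyI hx₀) hpos hy2
    rw [← (hx t₀ ht₀').sub_eq hyI hx₀] at h3
    linarith [hmin' t₀ ht₀ y hyI]

/-! ### Gauss–Lobatto quadrature -/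

open Polynomial in
theorem mem_glPoints_iff {r : ℕ} (hr : 1 ≤ r) {x : ℝ} :
    x ∈ glPoints r ↔ (derivative^[r - 1] ((X ^ 2 - 1 : ℝ[X]) ^ r)).eval x = 0 := by
  have hc : ((r : ℝ) * (r + 1)) ≠ 0 := by positivity
  rw [glPoints, legendre_ode r hr, roots_C_mul _ hc, Multiset.mem_toFinset,
    mem_roots (iterate_derivative_ne_zero r _ (by omega)), IsRoot.def]

open Polynomial in
theorem eval_iterate_derivative_eq_zero {r i : ℕ} (hi : i < r) {x : ℝ} (hx : x ^ 2 = 1) :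
    (derivative^[i] ((X ^ 2 - 1 : ℝ[X]) ^ r)).eval x = 0 := by
  rw [← IsRoot.def]
  apply isRoot_iterate_derivative_of_lt_rootMultiplicity
  refine lt_of_lt_of_le hi ?_
  rw [le_rootMultiplicity_iff (by simpa using iterate_derivative_ne_zero r 0 (by omega))]
  apply pow_dvd_pow_of_dvd
  rw [dvd_iff_isRoot]
  simp [hx]

open Polynomial in
/-- By the Gauss–Lucas theorem, the zeros of the derivatives of `(X² - 1)^r` lie in `[-1, 1]`. -/
theorem mem_Icc_of_eval_iterate_derivative_eq_zero {r j : ℕ} (hj : j ≤ 2 * r) {x : ℝ}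
    (hx : (derivative^[j] ((X ^ 2 - 1 : ℝ[X]) ^ r)).eval x = 0) : x ∈ Icc (-1 : ℝ) 1 := by
  have key : ∀ i, (derivative^[i] ((X ^ 2 - 1 : ℂ[X]) ^ r)).rootSet ℂ
      ⊆ convexHull ℝ ({1, -1} : Set ℂ) := by
    intro i
    induction i with
    | zero =>
      intro z hz
      apply subset_convexHull
      have := (mem_rootSet.1 hz).2
      simp only [Function.iterate_zero, id, map_pow, map_sub, aeval_X, map_one] at this
      have h1 := eq_zero_of_pow_eq_zero this
      have h2 : (z - 1) * (z + 1) = 0 := by linear_combination h1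
      rcases mul_eq_zero.1 h2 with h | h
      · left; linear_combination h
      · right; rw [mem_singleton_iff]; linear_combination h
    | succ i ih =>
      rw [Function.iterate_succ_apply']
      by_cases hd : 0 < (derivative^[i] ((X ^ 2 - 1 : ℂ[X]) ^ r)).degree
      · exact (rootSet_derivative_subset_convexHull_rootSet hd).trans
          (convexHull_min ih (convex_convexHull ℝ _))
      · rw [eq_C_of_degree_le_zero (not_lt.1 hd), derivative_C, rootSet_zero]
        exact empty_subset _
  have hmap : (derivative^[j] ((X ^ 2 - 1 : ℝ[X]) ^ r)).map (algebraMap ℝ ℂ)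
      = derivative^[j] ((X ^ 2 - 1 : ℂ[X]) ^ r) := by
    rw [← iterate_derivative_map]
    simp
  have hmem : (x : ℂ) ∈ (derivative^[j] ((X ^ 2 - 1 : ℂ[X]) ^ r)).rootSet ℂ := by
    rw [mem_rootSet, ← hmap]
    refine ⟨?_, ?_⟩
    · exact (Polynomial.map_ne_zero_iff (algebraMap ℝ ℂ).injective).2
        (iterate_derivative_ne_zero r j hj)
    · rw [aeval_map_algebraMap]
      have h1 := aeval_algebraMap_apply ℂ x (derivative^[j] ((X ^ 2 - 1 : ℝ[X]) ^ r))
      rw [Complex.coe_algebraMap] at h1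
      rw [h1]
      simp [aeval_def, hx]
  have h1 := key j hmem
  have hc1 : convexHull ℝ ({1, -1} : Set ℂ) ⊆ {z | z.re ≤ 1} :=
    convexHull_min (by rintro z (rfl | rfl) <;> simp) (convex_halfSpace_re_le 1)
  have hc2 : convexHull ℝ ({1, -1} : Set ℂ) ⊆ {z | -1 ≤ z.re} :=
    convexHull_min (by rintro z (rfl | rfl) <;> simp) (convex_halfSpace_re_ge (-1))
  exact ⟨by simpa using hc2 h1, by simpa using hc1 h1⟩

section Nodes

variable {r : ℕ} (hr : 1 ≤ r)
include hr

theorem glNode_eq (j : Fin (r + 1)) :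
    glNode r j = (glPoints r).orderEmbOfFin (card_glPoints r hr) j := by
  rw [glNode, dif_pos (card_glPoints r hr)]

theorem glNode_strictMono : StrictMono (glNode r) := by
  intro i j hij
  rw [glNode_eq hr, glNode_eq hr]
  exact ((glPoints r).orderEmbOfFin (card_glPoints r hr)).strictMono hij

theorem glNode_mem (j : Fin (r + 1)) : glNode r j ∈ glPoints r := by
  rw [glNode_eq hr]; exact Finset.orderEmbOfFin_mem _ _ _

theorem exists_glNode_eq {x : ℝ} (hx : x ∈ glPoints r) : ∃ j, glNode r j = x := by
  have : x ∈ Set.range ((glPoints r).orderEmbOfFin (card_glPoints r hr)) := by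
    rw [Finset.range_orderEmbOfFin]; exact hx
  obtain ⟨j, hj⟩ := this
  exact ⟨j, by rw [glNode_eq hr, hj]⟩

theorem glNode_mem_Icc (j : Fin (r + 1)) : glNode r j ∈ Icc (-1 : ℝ) 1 :=
  mem_Icc_of_eval_iterate_derivative_eq_zero (by omega)
    ((mem_glPoints_iff hr).1 (glNode_mem hr j))

theorem glNode_zero : glNode r 0 = -1 := by
  obtain ⟨j, hj⟩ := exists_glNode_eq hr ((mem_glPoints_iff hr).2
    (eval_iterate_derivative_eq_zero (by omega) (by norm_num : (-1 : ℝ) ^ 2 = 1)))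
  refine le_antisymm ?_ (glNode_mem_Icc hr 0).1
  rw [← hj]
  exact (glNode_strictMono hr).monotone (Fin.zero_le j)

theorem glNode_last : glNode r (Fin.last r) = 1 := by
  obtain ⟨j, hj⟩ := exists_glNode_eq hr ((mem_glPoints_iff hr).2
    (eval_iterate_derivative_eq_zero (by omega) (by norm_num : (1 : ℝ) ^ 2 = 1)))
  refine le_antisymm (glNode_mem_Icc hr _).2 ?_
  rw [← hj]
  exact (glNode_strictMono hr).monotone (Fin.le_last j)

theorem shape_eval_glNode (i j : Fin (r + 1)) :
    (shape r j).eval (glNode r i) = if i = j then 1 else 0 := by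
  split_ifs with h
  · subst h
    exact Lagrange.eval_basis_self (glNode_strictMono hr).injective.injOn (Finset.mem_univ _)
  · exact Lagrange.eval_basis_of_ne (Ne.symm h) (Finset.mem_univ _)

theorem natDegree_shape_le (j : Fin (r + 1)) : (shape r j).natDegree ≤ r := by
  rw [shape, Lagrange.natDegree_basis (glNode_strictMono hr).injective.injOn (Finset.mem_univ _)]
  simp

theorem sum_shape_mul_eval {p : ℝ[X]} (hp : p.natDegree ≤ r) (x : ℝ) :
    ∑ j, p.eval (glNode r j) * (shape r j).eval x = p.eval x := by
  rw [← sum_basis_mul_eval (glNode_strictMono hr).injective (q := p)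
    (lt_of_le_of_lt Polynomial.degree_le_natDegree (by exact_mod_cast Nat.lt_succ_of_le hp)) x]
  exact Finset.sum_congr rfl fun j _ => mul_comm _ _

end Nodes

open Polynomial in
/-- The `j`-th derivative of `(X² - 1)^r` is orthogonal to polynomials of degree `< j`. -/
theorem integral_iterate_derivative_mul_eq_zero {r : ℕ} (j : ℕ) (hj : j ≤ r) :
    ∀ q : ℝ[X], q.degree < j →
      ∫ x in (-1 : ℝ)..1, (derivative^[j] ((X ^ 2 - 1 : ℝ[X]) ^ r)).eval x * q.eval x = 0 := by
  induction j with
  | zero =>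
    intro q hq
    have : q = 0 := by
      rw [← degree_eq_bot]
      simpa [Nat.WithBot.lt_zero_iff] using hq
    simp [this]
  | succ j ih =>
    intro q hq
    set w := derivative^[j] ((X ^ 2 - 1 : ℝ[X]) ^ r) with hw
    rw [Function.iterate_succ_apply', ← hw]
    have h1 := intervalIntegral.integral_mul_deriv_eq_deriv_mul (a := (-1 : ℝ)) (b := 1)
      (fun x _ => q.hasDerivAt x) (fun x _ => w.hasDerivAt x)
      (q.derivative.continuous.intervalIntegrable _ _)
      (w.derivative.continuous.intervalIntegrable _ _)
    have h2 := ih (by omega) (derivative q) (by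
      rw [degree_lt_iff_coeff_zero] at hq ⊢
      intro m hm
      rw [coeff_derivative, hq (m + 1) (by omega), zero_mul])
    have e1 : w.eval 1 = 0 := eval_iterate_derivative_eq_zero (by omega) (by norm_num)
    have e2 : w.eval (-1) = 0 := eval_iterate_derivative_eq_zero (by omega) (by norm_num)
    rw [e1, e2] at h1
    simp only [mul_comm (eval _ (derivative w))]
    simp only [mul_comm (eval _ w)] at h2
    rw [h1, h2]
    ring

section Quadrature

variable {r : ℕ} (hr : 1 ≤ r)
include hr

theorem integral_eq_sum_of_natDegree_le {p : ℝ[X]} (hp : p.natDegree ≤ r) :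
    ∫ x in (-1 : ℝ)..1, p.eval x = ∑ j, glWeight r j * p.eval (glNode r j) := by
  rw [intervalIntegral.integral_congr fun x _ => (sum_shape_mul_eval hr hp x).symm,
    intervalIntegral.integral_finsetSum
      (fun j _ => ((shape r j).continuous.const_mul _).intervalIntegrable _ _)]
  refine Finset.sum_congr rfl fun j _ => ?_
  rw [intervalIntegral.integral_const_mul, glWeight]
  ring

open Polynomial in
/-- The `(r + 1)`-point Gauss–Lobatto quadrature is exact for polynomials of degree
`≤ 2 r - 1`. -/
theorem integral_eq_sum_glWeight {p : ℝ[X]} (hp : p.natDegree ≤ 2 * r - 1) :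
    ∫ x in (-1 : ℝ)..1, p.eval x = ∑ j, glWeight r j * p.eval (glNode r j) := by
  set w := derivative^[r - 1] ((X ^ 2 - 1 : ℝ[X]) ^ r) with hw
  have hw0 : w ≠ 0 := iterate_derivative_ne_zero r _ (by omega)
  have hWdeg : ((X ^ 2 - 1 : ℝ[X]) ^ r).natDegree = 2 * r := by
    have : (X ^ 2 - 1 : ℝ[X]).natDegree = 2 := by compute_degree!
    rw [natDegree_pow, this]; ring
  have hdeg : w.natDegree = r + 1 := by
    apply le_antisymm
    · refine (natDegree_iterate_derivative _ _).trans ?_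
      omega
    · have h1 := le_card_roots_iterate r (r - 1) (by omega)
      rw [← hw] at h1
      have h2 := (Multiset.toFinset_card_le w.roots).trans (card_roots' w)
      omega
  have hdegw : w.degree = ((r + 1 : ℕ) : WithBot ℕ) := by rw [degree_eq_natDegree hw0, hdeg]
  have hmod : (p % w).natDegree ≤ r := by
    have h1 := natDegree_mod_lt p (q := w) (by omega)
    omega
  have hdiv : (p / w).degree < ((r - 1 : ℕ) : WithBot ℕ) := by
    by_cases hlt : p.degree < w.degree
    · rw [(Polynomial.div_eq_zero_iff hw0).2 hlt, degree_zero]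
      exact WithBot.bot_lt_coe _
    · have h1 := degree_add_div hw0 (not_lt.1 hlt)
      have hq0 : p / w ≠ 0 := fun h => hlt ((Polynomial.div_eq_zero_iff hw0).1 h)
      have hp0 : p ≠ 0 := by
        rintro rfl
        exact hlt (by rw [degree_zero]; exact bot_lt_iff_ne_bot.2 (degree_ne_bot.2 hw0))
      rw [degree_eq_natDegree hq0, degree_eq_natDegree hp0, hdegw] at h1
      rw [degree_eq_natDegree hq0]
      have h2 : r + 1 + (p / w).natDegree = p.natDegree := by exact_mod_cast h1
      have h3 : (p / w).natDegree < r - 1 := by omega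
      exact_mod_cast h3
  have hsplit : ∀ x, p.eval x = w.eval x * (p / w).eval x + (p % w).eval x := by
    intro x
    rw [← eval_mul, ← eval_add, EuclideanDomain.div_add_mod]
  have horth := integral_iterate_derivative_mul_eq_zero (r := r) (r - 1) (by omega) _ hdiv
  rw [← hw] at horth
  have hnode : ∀ j, p.eval (glNode r j) = (p % w).eval (glNode r j) := by
    intro j
    rw [hsplit, (mem_glPoints_iff hr).1 (glNode_mem hr j), zero_mul, zero_add]
  simp only [hnode]
  rw [← integral_eq_sum_of_natDegree_le hr hmod]
  rw [intervalIntegral.integral_congr fun x _ => hsplit x, intervalIntegral.integral_add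
    (f := fun x => w.eval x * (p / w).eval x)
    ((w.continuous.mul (p / w).continuous).intervalIntegrable _ _)
    ((p % w).continuous.intervalIntegrable _ _), horth, zero_add]

open Polynomial in
/-- The Gauss–Lobatto weights are positive: apply the quadrature to a polynomial of degree
`≤ 2 r - 1` that is nonnegative on `[-1, 1]` and vanishes at all nodes but one. -/
theorem glWeight_pos (j : Fin (r + 1)) : 0 < glWeight r j := by
  have h0l : (0 : Fin (r + 1)) ≠ Fin.last r := by
    intro h
    have := congrArg Fin.val h
    simp at this
    omega
  -- Interior nodes are double zeros, the end points simple ones.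
  set φ : Fin (r + 1) → ℝ[X] := fun i =>
    if i = 0 then 1 + X else if i = Fin.last r then 1 - X else (X - C (glNode r i)) ^ 2 with hφ
  set d : Fin (r + 1) → ℕ := fun i => if i = 0 then 1 else if i = Fin.last r then 1 else 2 with hd
  have hφd : ∀ i, (φ i).natDegree ≤ d i := by
    intro i
    simp only [hφ, hd]
    split_ifs
    · compute_degree
    · compute_degree
    · rw [natDegree_pow, natDegree_X_sub_C]
  have hd1 : ∀ i, 1 ≤ d i := by intro i; simp only [hd]; split_ifs <;> omega
  have hdsum : ∑ i, d i = 2 * r := by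
    have h1 : ∀ i, d i + ((if i = 0 then 1 else 0) + (if i = Fin.last r then 1 else 0)) = 2 := by
      intro i
      simp only [hd]
      by_cases hi0 : i = 0
      · subst hi0; simp [h0l]
      · by_cases hil : i = Fin.last r
        · subst hil; simp [h0l.symm]
        · simp [hi0, hil]
    have h2 : ∑ i, (d i + ((if i = 0 then 1 else 0) + (if i = Fin.last r then 1 else 0)))
        = 2 * (r + 1) := by
      simp only [h1]; simp; ring
    rw [Finset.sum_add_distrib, Finset.sum_add_distrib] at h2
    simp only [Finset.sum_ite_eq', Finset.mem_univ, if_true] at h2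
    omega
  have hφnn : ∀ i, ∀ x ∈ Icc (-1 : ℝ) 1, 0 ≤ (φ i).eval x := by
    intro i x hx
    simp only [hφ]
    split_ifs
    · simp; linarith [hx.1]
    · simp [hx.2]
    · simp only [eval_pow]; positivity
  have hφself : ∀ i, (φ i).eval (glNode r i) = 0 := by
    intro i
    simp only [hφ]
    split_ifs with h1 h2
    · subst h1; simp [glNode_zero hr]
    · subst h2; simp [glNode_last hr]
    · simp
  have hφpos : ∀ i, i ≠ j → 0 < (φ i).eval (glNode r j) := by
    intro i hij
    have hinj := (glNode_strictMono hr).injective.ne hij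
    refine lt_of_le_of_ne (hφnn i _ (glNode_mem_Icc hr j)) (Ne.symm ?_)
    simp only [hφ]
    split_ifs with h1 h2
    · subst h1
      rw [glNode_zero hr] at hinj
      simp only [eval_add, eval_one, eval_X]
      intro h; apply hinj; linarith
    · subst h2
      rw [glNode_last hr] at hinj
      simp only [eval_sub, eval_one, eval_X]
      intro h; apply hinj; linarith
    · simp only [eval_pow, eval_sub, eval_X, eval_C]
      exact pow_ne_zero _ (sub_ne_zero.2 hinj.symm)
  set p := ∏ i ∈ Finset.univ.erase j, φ i with hp
  have hpd : p.natDegree ≤ 2 * r - 1 := by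
    refine (natDegree_prod_le _ _).trans ((Finset.sum_le_sum fun i _ => hφd i).trans ?_)
    have h1 := Finset.add_sum_erase Finset.univ d (Finset.mem_univ j)
    have h2 := hd1 j
    omega
  have hpj : 0 < p.eval (glNode r j) := by
    rw [hp, eval_prod]
    exact Finset.prod_pos fun i hi => hφpos i (Finset.ne_of_mem_erase hi)
  have hpi : ∀ i, i ≠ j → p.eval (glNode r i) = 0 := by
    intro i hi
    rw [hp, eval_prod]
    exact Finset.prod_eq_zero (Finset.mem_erase.2 ⟨hi, Finset.mem_univ _⟩) (hφself i)
  have hint : 0 < ∫ x in (-1 : ℝ)..1, p.eval x := by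
    refine intervalIntegral.integral_pos (by norm_num) p.continuousOn (fun x hx => ?_)
      ⟨glNode r j, glNode_mem_Icc hr j, hpj⟩
    rw [hp, eval_prod]
    exact Finset.prod_nonneg fun i _ => hφnn i x ⟨hx.1.le, hx.2⟩
  rw [integral_eq_sum_glWeight hr hpd,
    Finset.sum_eq_single j (fun i _ hi => by rw [hpi i hi, mul_zero])
    (fun h => absurd (Finset.mem_univ j) h)] at hint
  exact pos_of_mul_pos_left hint hpj.le

/-- On polynomials of degree `≤ r` the nodal `ℓ²`-norm is bounded by the `L²(-1, 1)`-norm: the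
latter is positive on the compact unit sphere of nodal vectors, and both are homogeneous. -/
theorem exists_sum_sq_le_integral : ∃ K : ℝ, 0 < K ∧ ∀ V : Fin (r + 1) → ℝ,
    ∑ j, V j ^ 2 ≤ K * ∫ x in (-1 : ℝ)..1, (∑ j, V j * (shape r j).eval x) ^ 2 := by
  set Q : (Fin (r + 1) → ℝ) → ℝ :=
    fun V => ∫ x in (-1 : ℝ)..1, (∑ j, V j * (shape r j).eval x) ^ 2 with hQ
  have hQe : ∀ V, Q V = ∑ i, ∑ j, V i * V j *
      ∫ x in (-1 : ℝ)..1, (shape r i).eval x * (shape r j).eval x := by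
    intro V
    simp only [hQ, sq, Finset.sum_mul_sum]
    have hc : ∀ i j, Continuous fun x => V i * (shape r i).eval x * (V j * (shape r j).eval x) :=
      fun i j => ((shape r i).continuous.const_mul _).mul ((shape r j).continuous.const_mul _)
    rw [intervalIntegral.integral_finsetSum fun i _ =>
      (continuous_finsetSum _ fun j _ => hc i j).intervalIntegrable _ _]
    refine Finset.sum_congr rfl fun i _ => ?_
    rw [intervalIntegral.integral_finsetSum fun j _ => (hc i j).intervalIntegrable _ _]
    refine Finset.sum_congr rfl fun j _ => ?_
    rw [← intervalIntegral.integral_const_mul]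
    congr 1
    funext x
    ring
  have hQc : Continuous Q := by
    rw [show Q = _ from funext hQe]
    fun_prop
  have hQpos : ∀ V, V ≠ 0 → 0 < Q V := by
    intro V hV
    obtain ⟨j, hj⟩ := Function.ne_iff.1 hV
    refine intervalIntegral.integral_pos (by norm_num) (by fun_prop) (fun x _ => sq_nonneg _)
      ⟨glNode r j, glNode_mem_Icc hr j, ?_⟩
    have : ∑ i, V i * (shape r i).eval (glNode r j) = V j := by
      simp [shape_eval_glNode hr]
    rw [this]
    have hj' : V j ≠ 0 := hj
    positivity
  have hQh : ∀ (c : ℝ) V, Q (c • V) = c ^ 2 * Q V := by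
    intro c V
    rw [hQe, hQe, Finset.mul_sum]
    refine Finset.sum_congr rfl fun i _ => ?_
    rw [Finset.mul_sum]
    refine Finset.sum_congr rfl fun j _ => ?_
    simp only [Pi.smul_apply, smul_eq_mul]; ring
  obtain ⟨V₀, hV₀, hmin⟩ := (isCompact_sphere (0 : Fin (r + 1) → ℝ) 1).exists_isMinOn
    (NormedSpace.sphere_nonempty.2 zero_le_one) hQc.continuousOn
  have hV₀0 : V₀ ≠ 0 := by
    rintro rfl
    simp at hV₀
  have hm := hQpos V₀ hV₀0
  refine ⟨(r + 1) / Q V₀, by positivity, fun V => ?_⟩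
  have hle : ∀ j, V j ^ 2 ≤ ‖V‖ ^ 2 := fun j => by
    rw [← sq_abs]
    exact pow_le_pow_left₀ (abs_nonneg _) (norm_le_pi_norm V j) 2
  have h1 : ∑ j, V j ^ 2 ≤ (r + 1) * ‖V‖ ^ 2 := by
    refine (Finset.sum_le_sum fun j _ => hle j).trans ?_
    simp
  have h2 : ‖V‖ ^ 2 * Q V₀ ≤ Q V := by
    by_cases hV : V = 0
    · subst hV
      have := hQh 0 0
      simp at this
      simp [this]
    have hn : 0 < ‖V‖ := norm_pos_iff.2 hV
    have h3 : Q V₀ ≤ Q (‖V‖⁻¹ • V) := hmin (by simp [norm_smul, hn.ne'])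
    rw [hQh] at h3
    calc ‖V‖ ^ 2 * Q V₀ ≤ ‖V‖ ^ 2 * (‖V‖⁻¹ ^ 2 * Q V) := by gcongr
      _ = Q V := by field_simp
  calc ∑ j, V j ^ 2 ≤ (r + 1) * ‖V‖ ^ 2 := h1
    _ = (r + 1) / Q V₀ * (‖V‖ ^ 2 * Q V₀) := by field_simp
    _ ≤ (r + 1) / Q V₀ * Q V := by gcongr

omit hr in
theorem exists_abs_eval_le (p : Fin (r + 1) → ℝ[X]) :
    ∃ K : ℝ, 0 ≤ K ∧ ∀ j, ∀ x ∈ Icc (-1 : ℝ) 1, |(p j).eval x| ≤ K := by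
  have h : ∀ j, ∃ K : ℝ, ∀ x ∈ Icc (-1 : ℝ) 1, ‖(p j).eval x‖ ≤ K := fun j =>
    isCompact_Icc.exists_bound_of_continuousOn (p j).continuousOn
  choose K hK using h
  have hK0 : ∀ j, 0 ≤ K j := fun j => (norm_nonneg _).trans (hK j 0 (by norm_num))
  exact ⟨∑ j, K j, Finset.sum_nonneg fun j _ => hK0 j, fun j x hx =>
    (hK j x hx).trans (Finset.single_le_sum (f := K) (fun i _ => hK0 i) (Finset.mem_univ j))⟩

end Quadrature

/-- `K` bounds all the quantities on the reference element `[-1, 1]` on which the estimates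
depend. -/
structure RefBound (r : ℕ) (K : ℝ) : Prop where
  one_le : 1 ≤ K
  shape_le : ∀ j, ∀ x ∈ Icc (-1 : ℝ) 1, |(shape r j).eval x| ≤ K
  deriv_le : ∀ j, ∀ x ∈ Icc (-1 : ℝ) 1, |(Polynomial.derivative (shape r j)).eval x| ≤ K
  weight_le : ∀ j, glWeight r j ≤ K
  le_weight : ∀ j, 1 ≤ K * glWeight r j
  sum_sq_le : ∀ V : Fin (r + 1) → ℝ,
    ∑ j, V j ^ 2 ≤ K * ∫ x in (-1 : ℝ)..1, (∑ j, V j * (shape r j).eval x) ^ 2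

theorem exists_refBound {r : ℕ} (hr : 1 ≤ r) : ∃ K, RefBound r K := by
  obtain ⟨K₁, h₁, h₁'⟩ := exists_abs_eval_le (shape r)
  obtain ⟨K₂, h₂, h₂'⟩ := exists_abs_eval_le (fun j => Polynomial.derivative (shape r j))
  obtain ⟨K₃, h₃, h₃'⟩ := exists_sum_sq_le_integral hr
  have hw := glWeight_pos hr
  have h₄ : 0 ≤ ∑ j, glWeight r j := Finset.sum_nonneg fun j _ => (hw j).le
  have h₅ : 0 ≤ ∑ j, (glWeight r j)⁻¹ := Finset.sum_nonneg fun j _ => (inv_pos.2 (hw j)).le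
  refine ⟨1 + K₁ + K₂ + K₃ + (∑ j, glWeight r j) + ∑ j, (glWeight r j)⁻¹, ?_, ?_, ?_, ?_, ?_, ?_⟩
  · linarith
  · intro j x hx; linarith [h₁' j x hx]
  · intro j x hx; linarith [h₂' j x hx]
  · intro j
    have := Finset.single_le_sum (f := glWeight r) (fun i _ => (hw i).le) (Finset.mem_univ j)
    linarith
  · intro j
    have := Finset.single_le_sum (f := fun i => (glWeight r i)⁻¹)
      (fun i _ => (inv_pos.2 (hw i)).le) (Finset.mem_univ j)
    refine (inv_mul_cancel₀ (hw j).ne').symm.le.trans (mul_le_mul_of_nonneg_right ?_ (hw j).le)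
    linarith
  · intro V
    refine (h₃' V).trans (mul_le_mul_of_nonneg_right ?_ ?_)
    · linarith
    · exact intervalIntegral.integral_nonneg (by norm_num) fun x _ => sq_nonneg _

/-! ### Interpolation and integration by parts on one element -/

/-- The affine map from the element `[α, α + h]` to `[-1, 1]`, as a polynomial. -/
noncomputable def toRef (α h : ℝ) : ℝ[X] :=
  Polynomial.C (2 / h) * Polynomial.X + Polynomial.C (-(2 * α / h) - 1)

/-- The `j`-th Gauss–Lobatto point of the element `[α, α + h]`. -/
noncomputable def elemNode (α h : ℝ) (r : ℕ) (j : Fin (r + 1)) : ℝ :=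
  α + h * ((glNode r j + 1) / 2)

/-- The polynomial of degree `≤ r` with the values `W` at the Gauss–Lobatto points of the element
`[α, α + h]`. -/
noncomputable def elemInterp (α h : ℝ) (r : ℕ) (W : Fin (r + 1) → ℝ) : ℝ[X] :=
  ∑ j, Polynomial.C (W j) * (shape r j).comp (toRef α h)

theorem eval_toRef (α h x : ℝ) : (toRef α h).eval x = 2 * (x - α) / h - 1 := by
  simp [toRef]; ring

theorem eval_elemInterp (α h : ℝ) (r : ℕ) (W : Fin (r + 1) → ℝ) (x : ℝ) :
    (elemInterp α h r W).eval x = ∑ j, W j * (shape r j).eval (2 * (x - α) / h - 1) := by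
  simp [elemInterp, Polynomial.eval_finsetSum, Polynomial.eval_comp, eval_toRef]

theorem eval_derivative_elemInterp (α h : ℝ) (r : ℕ) (W : Fin (r + 1) → ℝ) (x : ℝ) :
    (Polynomial.derivative (elemInterp α h r W)).eval x
      = 2 / h * ∑ j, W j * (Polynomial.derivative (shape r j)).eval (2 * (x - α) / h - 1) := by
  have hd : Polynomial.derivative (toRef α h) = Polynomial.C (2 / h) := by
    simp [toRef]
  simp only [elemInterp, Polynomial.derivative_sum, Polynomial.eval_finsetSum,
    Polynomial.derivative_C_mul, Polynomial.derivative_comp, Polynomial.eval_mul,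
    Polynomial.eval_C, Polynomial.eval_comp, eval_toRef, hd, Finset.mul_sum]
  exact Finset.sum_congr rfl fun j _ => by ring

theorem elemInterp_sub (α h : ℝ) (r : ℕ) (W W' : Fin (r + 1) → ℝ) :
    elemInterp α h r (fun j => W j - W' j) = elemInterp α h r W - elemInterp α h r W' := by
  simp [elemInterp, sub_mul]

theorem toRef_mem {α h : ℝ} (hh : 0 < h) {x : ℝ} (hx : x ∈ Icc α (α + h)) :
    2 * (x - α) / h - 1 ∈ Icc (-1 : ℝ) 1 := by
  have h1 : 0 ≤ 2 * (x - α) / h := div_nonneg (by linarith [hx.1]) hh.le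
  have h2 : 2 * (x - α) / h ≤ 2 := by rw [div_le_iff₀ hh]; linarith [hx.2]
  constructor <;> linarith

theorem integral_elem {α h : ℝ} (hh : 0 < h) (g : ℝ → ℝ) :
    ∫ x in α..(α + h), g (2 * (x - α) / h - 1) = h / 2 * ∫ x in (-1 : ℝ)..1, g x := by
  have h1 : ∀ x, 2 * (x - α) / h - 1 = 2 / h * x + (-(2 * α / h) - 1) := fun x => by ring
  simp only [h1]
  rw [intervalIntegral.integral_comp_mul_add _ (by positivity)]
  have h2 : 2 / h * α + (-(2 * α / h) - 1) = -1 := by ring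
  have h3 : 2 / h * (α + h) + (-(2 * α / h) - 1) = 1 := by field_simp; ring
  rw [h2, h3, smul_eq_mul, inv_div]

section

variable {r : ℕ} (hr : 1 ≤ r) {α h : ℝ} (hh : 0 < h)
include hr hh

theorem elemNode_mem (j : Fin (r + 1)) : elemNode α h r j ∈ Icc α (α + h) := by
  have h1 := glNode_mem_Icc hr j
  have h2 : 0 ≤ h * ((glNode r j + 1) / 2) := mul_nonneg hh.le (by linarith [h1.1])
  have h3 : h * ((glNode r j + 1) / 2) ≤ h * 1 :=
    mul_le_mul_of_nonneg_left (by linarith [h1.2]) hh.le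
  constructor <;> simp only [elemNode] <;> linarith

omit hr in
theorem toRef_elemNode (j : Fin (r + 1)) : 2 * (elemNode α h r j - α) / h - 1 = glNode r j := by
  rw [elemNode]; field_simp; ring

theorem eval_elemInterp_elemNode (W : Fin (r + 1) → ℝ) (j : Fin (r + 1)) :
    (elemInterp α h r W).eval (elemNode α h r j) = W j := by
  rw [eval_elemInterp, toRef_elemNode hh]
  simp [shape_eval_glNode hr]

theorem elemInterp_eval {p : ℝ[X]} (hp : p.natDegree ≤ r) :
    elemInterp α h r (fun j => p.eval (elemNode α h r j)) = p := by
  refine Polynomial.funext fun x => ?_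
  rw [eval_elemInterp]
  set q : ℝ[X] := p.comp (Polynomial.C (h / 2) * Polynomial.X + Polynomial.C (α + h / 2)) with hq
  have hqd : q.natDegree ≤ r := by
    rw [hq, Polynomial.natDegree_comp]
    have : (Polynomial.C (h / 2) * Polynomial.X + Polynomial.C (α + h / 2) : ℝ[X]).natDegree ≤ 1 :=
      by compute_degree
    calc _ ≤ r * 1 := Nat.mul_le_mul hp this
      _ = r := by ring
  have hqe : ∀ y, q.eval y = p.eval (α + h * ((y + 1) / 2)) := by
    intro y
    rw [hq, Polynomial.eval_comp]
    congr 1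
    simp
    ring
  have h1 := sum_shape_mul_eval hr hqd (2 * (x - α) / h - 1)
  simp only [hqe] at h1
  rw [show α + h * ((2 * (x - α) / h - 1 + 1) / 2) = x by field_simp; ring] at h1
  exact h1

omit hr in
theorem abs_eval_elemInterp_le {K : ℝ} (hK : RefBound r K) (W : Fin (r + 1) → ℝ) {x : ℝ}
    (hx : x ∈ Icc α (α + h)) : |(elemInterp α h r W).eval x| ≤ K * ∑ j, |W j| := by
  rw [eval_elemInterp, Finset.mul_sum]
  refine (Finset.abs_sum_le_sum_abs _ _).trans (Finset.sum_le_sum fun j _ => ?_)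
  rw [abs_mul, mul_comm]
  exact mul_le_mul_of_nonneg_right (hK.shape_le j _ (toRef_mem hh hx)) (abs_nonneg _)

omit hr in
theorem abs_eval_derivative_elemInterp_le {K : ℝ} (hK : RefBound r K) (W : Fin (r + 1) → ℝ) {x : ℝ}
    (hx : x ∈ Icc α (α + h)) :
    |(Polynomial.derivative (elemInterp α h r W)).eval x| ≤ 2 / h * (K * ∑ j, |W j|) := by
  rw [eval_derivative_elemInterp, abs_mul, abs_of_pos (by positivity : 0 < 2 / h), Finset.mul_sum]
  refine mul_le_mul_of_nonneg_left ?_ (by positivity)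
  refine (Finset.abs_sum_le_sum_abs _ _).trans (Finset.sum_le_sum fun j _ => ?_)
  rw [abs_mul, mul_comm]
  exact mul_le_mul_of_nonneg_right (hK.deriv_le j _ (toRef_mem hh hx)) (abs_nonneg _)

omit hr hh in
theorem sq_sum_abs_le (W : Fin (r + 1) → ℝ) : (∑ j, |W j|) ^ 2 ≤ (r + 1) * ∑ j, W j ^ 2 := by
  have := sq_sum_le_card_mul_sum_sq (s := (Finset.univ : Finset (Fin (r + 1))))
    (f := fun j => |W j|)
  simpa using this

omit hr in
theorem integral_sq_elemInterp_le {K : ℝ} (hK : RefBound r K) (W : Fin (r + 1) → ℝ) :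
    ∫ x in α..(α + h), (elemInterp α h r W).eval x ^ 2
      ≤ h * (K ^ 2 * ((r + 1) * ∑ j, W j ^ 2)) := by
  have h1 : ∀ x ∈ Icc α (α + h), (elemInterp α h r W).eval x ^ 2
      ≤ K ^ 2 * ((r + 1) * ∑ j, W j ^ 2) := by
    intro x hx
    have h2 := abs_eval_elemInterp_le hh hK W hx
    calc (elemInterp α h r W).eval x ^ 2 = |(elemInterp α h r W).eval x| ^ 2 := (sq_abs _).symm
      _ ≤ (K * ∑ j, |W j|) ^ 2 := pow_le_pow_left₀ (abs_nonneg _) h2 2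
      _ = K ^ 2 * (∑ j, |W j|) ^ 2 := by ring
      _ ≤ _ := mul_le_mul_of_nonneg_left (sq_sum_abs_le W) (sq_nonneg _)
  have h3 := intervalIntegral.integral_mono_on (by linarith : α ≤ α + h)
    (((elemInterp α h r W).continuous.pow 2).intervalIntegrable _ _)
    (by simp : IntervalIntegrable (fun _ => K ^ 2 * ((r + 1) * ∑ j, W j ^ 2)) volume α (α + h)) h1
  rw [intervalIntegral.integral_const, add_sub_cancel_left, smul_eq_mul] at h3
  exact h3

omit hr in
theorem sum_sq_le_integral_elemInterp {K : ℝ} (hK : RefBound r K) (W : Fin (r + 1) → ℝ) :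
    h * ∑ j, W j ^ 2 ≤ 2 * K * ∫ x in α..(α + h), (elemInterp α h r W).eval x ^ 2 := by
  simp only [eval_elemInterp]
  rw [integral_elem hh fun y => (∑ j, W j * (shape r j).eval y) ^ 2]
  calc h * ∑ j, W j ^ 2 ≤ h * (K * ∫ x in (-1 : ℝ)..1, (∑ j, W j * (shape r j).eval x) ^ 2) :=
        mul_le_mul_of_nonneg_left (hK.sum_sq_le W) hh.le
    _ = _ := by ring

/-- The interpolation error is controlled by any polynomial approximation of degree `≤ r`. -/
theorem abs_sub_elemInterp_le {K : ℝ} (hK : RefBound r K) {G : ℝ → ℝ} {p : ℝ[X]}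
    (hp : p.natDegree ≤ r) {δ : ℝ} (hδ : ∀ x ∈ Icc α (α + h), |G x - p.eval x| ≤ δ) {x : ℝ}
    (hx : x ∈ Icc α (α + h)) :
    |G x - (elemInterp α h r (fun j => G (elemNode α h r j))).eval x|
      ≤ (1 + K * (r + 1)) * δ := by
  have h1 := abs_eval_elemInterp_le hh hK
    (fun j => G (elemNode α h r j) - p.eval (elemNode α h r j)) hx
  rw [elemInterp_sub, elemInterp_eval hr hh hp, Polynomial.eval_sub] at h1
  have h2 : ∑ j, |G (elemNode α h r j) - p.eval (elemNode α h r j)| ≤ (r + 1) * δ := by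
    refine (Finset.sum_le_sum fun j _ => hδ _ (elemNode_mem hr hh j)).trans ?_
    simp
  have h3 : K * ∑ j, |G (elemNode α h r j) - p.eval (elemNode α h r j)| ≤ K * ((r + 1) * δ) :=
    mul_le_mul_of_nonneg_left h2 (by linarith [hK.one_le])
  have h4 := abs_sub (G x - p.eval x)
    ((elemInterp α h r (fun j => G (elemNode α h r j))).eval x - p.eval x)
  rw [sub_sub_sub_cancel_right] at h4
  have h5 := hδ x hx
  linarith

/-- The error in the derivative of the interpolant. -/
theorem abs_sub_derivative_elemInterp_le {K : ℝ} (hK : RefBound r K) {G g : ℝ → ℝ} {p : ℝ[X]}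
    (hp : p.natDegree ≤ r) {δ : ℝ} (hδ : ∀ x ∈ Icc α (α + h), |G x - p.eval x| ≤ h * δ)
    (hδ' : ∀ x ∈ Icc α (α + h), |g x - (Polynomial.derivative p).eval x| ≤ δ) {x : ℝ}
    (hx : x ∈ Icc α (α + h)) :
    |(Polynomial.derivative (elemInterp α h r (fun j => G (elemNode α h r j)))).eval x - g x|
      ≤ (1 + 2 * K * (r + 1)) * δ := by
  have h1 := abs_eval_derivative_elemInterp_le hh hK
    (fun j => G (elemNode α h r j) - p.eval (elemNode α h r j)) hx
  rw [elemInterp_sub, elemInterp_eval hr hh hp, Polynomial.derivative_sub,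
    Polynomial.eval_sub] at h1
  have h2 : ∑ j, |G (elemNode α h r j) - p.eval (elemNode α h r j)| ≤ (r + 1) * (h * δ) := by
    refine (Finset.sum_le_sum fun j _ => hδ _ (elemNode_mem hr hh j)).trans ?_
    simp
  have h3 : 2 / h * (K * ∑ j, |G (elemNode α h r j) - p.eval (elemNode α h r j)|)
      ≤ 2 / h * (K * ((r + 1) * (h * δ))) := by
    have := hK.one_le
    gcongr
  have h3' : 2 / h * (K * ((r + 1) * (h * δ))) = 2 * K * (r + 1) * δ := by field_simp
  have h4 := abs_sub ((Polynomial.derivative (elemInterp α h r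
    (fun j => G (elemNode α h r j)))).eval x - (Polynomial.derivative p).eval x)
    (g x - (Polynomial.derivative p).eval x)
  rw [sub_sub_sub_cancel_right] at h4
  have h5 := hδ' x hx
  linarith

/-- The quadrature error on one element for the product of a function `G` with a polynomial of
degree `≤ r`. -/
theorem abs_quadrature_error_le {K : ℝ} (hK : RefBound r K) {G : ℝ → ℝ}
    (hG : ContinuousOn G (Icc α (α + h))) {p : ℝ[X]}
    (hp : p.natDegree ≤ r - 1) {δ : ℝ} (hδ : ∀ x ∈ Icc α (α + h), |G x - p.eval x| ≤ δ)
    (W : Fin (r + 1) → ℝ) :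
    |(∑ j, h / 2 * glWeight r j * G (elemNode α h r j) * W j)
      - ∫ x in α..(α + h), G x * (elemInterp α h r W).eval x|
      ≤ 2 * h * K * δ * ∑ j, |W j| := by
  have hK1 := hK.one_le
  have hα : α ≤ α + h := by linarith
  have hδ0 : 0 ≤ δ := (abs_nonneg _).trans (hδ α (left_mem_Icc.2 hα))
  set v := elemInterp α h r W with hv
  -- The quadrature is exact for `p v`.
  have hexact : ∫ x in α..(α + h), p.eval x * v.eval x
      = ∑ j, h / 2 * glWeight r j * p.eval (elemNode α h r j) * W j := by
    set q : ℝ[X] := p.comp (Polynomial.C (h / 2) * Polynomial.X + Polynomial.C (α + h / 2)) with hq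
    have hqd : q.natDegree ≤ r - 1 := by
      rw [hq, Polynomial.natDegree_comp]
      have : (Polynomial.C (h / 2) * Polynomial.X
          + Polynomial.C (α + h / 2) : ℝ[X]).natDegree ≤ 1 := by compute_degree
      calc _ ≤ (r - 1) * 1 := Nat.mul_le_mul hp this
        _ = r - 1 := by ring
    have hqe : ∀ y, q.eval y = p.eval (α + h * ((y + 1) / 2)) := by
      intro y
      rw [hq, Polynomial.eval_comp]
      congr 1
      simp
      ring
    set V : ℝ[X] := ∑ j, Polynomial.C (W j) * shape r j with hV
    have hVd : V.natDegree ≤ r :=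
      Polynomial.natDegree_sum_le_of_forall_le _ _ fun j _ =>
        (Polynomial.natDegree_C_mul_le _ _).trans (natDegree_shape_le hr j)
    have hVe : ∀ y, V.eval y = ∑ j, W j * (shape r j).eval y := by
      intro y; simp [hV, Polynomial.eval_finsetSum]
    have h1 := integral_eq_sum_glWeight hr (p := q * V)
      (Polynomial.natDegree_mul_le.trans (by omega))
    have h2 := integral_elem (α := α) hh fun y => (q * V).eval y
    rw [h1] at h2
    have h3 : ∀ x, (q * V).eval (2 * (x - α) / h - 1) = p.eval x * v.eval x := by
      intro x
      rw [Polynomial.eval_mul, hqe, hVe, hv, eval_elemInterp]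
      congr 2
      field_simp; ring
    simp only [h3] at h2
    rw [h2, Finset.mul_sum]
    refine Finset.sum_congr rfl fun j _ => ?_
    have h4 : V.eval (glNode r j) = W j := by rw [hVe]; simp [shape_eval_glNode hr]
    rw [Polynomial.eval_mul, h4, hqe, elemNode]
    ring
  have hGi : IntervalIntegrable (fun x => G x * v.eval x) volume α (α + h) := by
    apply ContinuousOn.intervalIntegrable
    rw [uIcc_of_le hα]
    exact hG.mul v.continuousOn
  have hsplit : (∑ j, h / 2 * glWeight r j * G (elemNode α h r j) * W j)
      - ∫ x in α..(α + h), G x * v.eval x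
      = (∑ j, h / 2 * glWeight r j * (G (elemNode α h r j) - p.eval (elemNode α h r j)) * W j)
        - ∫ x in α..(α + h), (G x - p.eval x) * v.eval x := by
    simp only [sub_mul, mul_sub, Finset.sum_sub_distrib]
    rw [intervalIntegral.integral_sub (g := fun x => p.eval x * v.eval x) hGi
      ((p.continuous.mul v.continuous).intervalIntegrable _ _),
      hexact]
    ring
  rw [hsplit]
  refine (abs_sub _ _).trans ?_
  have e1 : |∑ j, h / 2 * glWeight r j * (G (elemNode α h r j) - p.eval (elemNode α h r j)) * W j|
      ≤ h * K * δ * ∑ j, |W j| := by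
    rw [Finset.mul_sum]
    refine (Finset.abs_sum_le_sum_abs _ _).trans (Finset.sum_le_sum fun j _ => ?_)
    have hw := glWeight_pos hr j
    rw [abs_mul, abs_mul, abs_mul, abs_of_pos (by positivity : 0 < h / 2), abs_of_pos hw]
    have := hK.weight_le j
    have := hδ _ (elemNode_mem hr hh j)
    gcongr
    linarith
  have e2 : |∫ x in α..(α + h), (G x - p.eval x) * v.eval x| ≤ h * K * δ * ∑ j, |W j| := by
    have := intervalIntegral.norm_integral_le_of_norm_le_const (a := α) (b := α + h)
      (C := δ * (K * ∑ j, |W j|)) (f := fun x => (G x - p.eval x) * v.eval x) (fun x hx => by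
        rw [uIoc_of_le hα] at hx
        have hx' : x ∈ Icc α (α + h) := ⟨hx.1.le, hx.2⟩
        rw [Real.norm_eq_abs, abs_mul]
        exact mul_le_mul (hδ x hx') (abs_eval_elemInterp_le hh hK W hx') (abs_nonneg _) hδ0)
    rw [Real.norm_eq_abs, add_sub_cancel_left, abs_of_pos hh] at this
    refine this.trans (le_of_eq (by ring))
  refine (add_le_add e1 e2).trans (le_of_eq (by ring))

end

/-! ### Assembly over the mesh -/

/-- The local nodal values on the `e`-th element of a global nodal vector; elements are numbered
from `0`, and only `e < M` is meaningful. -/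
def loc {M r : ℕ} (U : Fin (M * r + 1) → ℝ) (e : ℕ) (j : Fin (r + 1)) : ℝ :=
  U (Fin.ofNat (M * r + 1) (e * r + j))

/-- The polynomial that the finite element function with nodal vector `U` is on the `e`-th
element. -/
noncomputable def elemPoly (a b : ℝ) {M r : ℕ} (U : Fin (M * r + 1) → ℝ) (e : ℕ) : ℝ[X] :=
  elemInterp (a + e * meshSize a b M) (meshSize a b M) r (loc U e)

/-- The bilinear form `(∂ₓ u, ∂ₓ v)` on nodal vectors, assembled from the elements. -/
noncomputable def stiffForm (a b : ℝ) {M r : ℕ} (U V : Fin (M * r + 1) → ℝ) : ℝ :=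
  ∑ e ∈ Finset.range M,
    ∫ x in (a + e * meshSize a b M)..(a + e * meshSize a b M + meshSize a b M),
      (Polynomial.derivative (elemPoly a b U e)).eval x *
        (Polynomial.derivative (elemPoly a b V e)).eval x

/-- The inner product given by the composite Gauss–Lobatto quadrature. -/
noncomputable def lumpForm (a b : ℝ) {M r : ℕ} (U V : Fin (M * r + 1) → ℝ) : ℝ :=
  ∑ m : Fin (M * r + 1), nodeWeight a b M r m * U m * V m

section Mesh

variable {a b : ℝ} {M : ℕ} (hab : a < b) (hM : 1 ≤ M)
include hab hM

theorem meshSize_pos : 0 < meshSize a b M :=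
  div_pos (by linarith) (by exact_mod_cast hM)

omit hab in
theorem add_mul_meshSize : a + M * meshSize a b M = b := by
  have : (M : ℝ) ≠ 0 := by exact_mod_cast (by omega : M ≠ 0)
  rw [meshSize]; field_simp; ring

theorem le_elem (e : ℕ) : a ≤ a + e * meshSize a b M := by
  have := meshSize_pos hab hM
  have : 0 ≤ (e : ℝ) * meshSize a b M := by positivity
  linarith

theorem elem_le {e : ℕ} (he : e < M) : a + e * meshSize a b M + meshSize a b M ≤ b := by
  have h0 := meshSize_pos hab hM
  have h1 : ((e : ℝ) + 1) ≤ M := by exact_mod_cast he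
  have h2 := add_mul_meshSize (a := a) (b := b) hM
  nlinarith

theorem elem_subset {e : ℕ} (he : e < M) :
    Icc (a + e * meshSize a b M) (a + e * meshSize a b M + meshSize a b M) ⊆ Icc a b :=
  Icc_subset_Icc (le_elem hab hM e) (elem_le hab hM he)

omit hab in
theorem integral_eq_sum_elem {f : ℝ → ℝ} (hf : ∀ e < M, IntervalIntegrable f volume
      (a + e * meshSize a b M) (a + e * meshSize a b M + meshSize a b M)) :
    ∫ x in a..b, f x = ∑ e ∈ Finset.range M,
      ∫ x in (a + e * meshSize a b M)..(a + e * meshSize a b M + meshSize a b M), f x := by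
  have hs : ∀ e : ℕ, a + e * meshSize a b M + meshSize a b M
      = a + ((e + 1 : ℕ) : ℝ) * meshSize a b M := by
    intro e; push_cast; ring
  simp only [hs] at hf ⊢
  rw [intervalIntegral.sum_integral_adjacent_intervals
    (a := fun e : ℕ => a + (e : ℝ) * meshSize a b M) hf, add_mul_meshSize hM]
  simp

theorem integral_eq_sum_elem' {f : ℝ → ℝ} (hf : IntervalIntegrable f volume a b) :
    ∫ x in a..b, f x = ∑ e ∈ Finset.range M,
      ∫ x in (a + e * meshSize a b M)..(a + e * meshSize a b M + meshSize a b M), f x := by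
  refine integral_eq_sum_elem hM fun e he => hf.mono_set ?_
  have h0 := meshSize_pos hab hM
  rw [uIcc_of_le hab.le, uIcc_of_le (by linarith)]
  exact elem_subset hab hM he

theorem IsPrimitive.elem {G g : ℝ → ℝ} (hG : IsPrimitive a b G g) {e : ℕ} (he : e < M) :
    IsPrimitive (a + e * meshSize a b M) (a + e * meshSize a b M + meshSize a b M) G g :=
  hG.mono (le_elem hab hM e) (by linarith [meshSize_pos hab hM]) (elem_le hab hM he)

omit hab in
/-- Every node lies in some element. -/
theorem exists_elem_of_le {r : ℕ} (hr : 1 ≤ r) {m : ℕ} (hm : m ≤ M * r) :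
    ∃ e < M, ∃ j : Fin (r + 1), e * r + j = m := by
  rcases Nat.lt_or_ge m (M * r) with h | h
  · refine ⟨m / r, Nat.div_lt_of_lt_mul (by rwa [mul_comm]),
      ⟨m % r, (Nat.mod_lt _ (by omega)).trans (Nat.lt_succ_self r)⟩, ?_⟩
    simpa [mul_comm] using Nat.div_add_mod m r
  · refine ⟨M - 1, by omega, Fin.last r, ?_⟩
    obtain ⟨n, rfl⟩ : ∃ n, M = n + 1 := ⟨M - 1, by omega⟩
    simp only [Nat.add_sub_cancel, Fin.val_last]
    have : m = (n + 1) * r := le_antisymm hm h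
    rw [this]; ring

omit hab hM in
theorem elem_index_le {r e : ℕ} (he : e < M) (j : Fin (r + 1)) : e * r + j ≤ M * r := by
  have h1 : (e + 1) * r ≤ M * r := Nat.mul_le_mul_right r he
  have h2 := j.is_lt
  have h3 : (e + 1) * r = e * r + r := by ring
  omega

omit hab hM in
theorem val_elem_index {r e : ℕ} (he : e < M) (j : Fin (r + 1)) :
    (Fin.ofNat (M * r + 1) (e * r + j)).val = e * r + j := by
  rw [Fin.val_ofNat]
  exact Nat.mod_eq_of_lt (Nat.lt_succ_of_le (elem_index_le he j))

omit hab hM in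
theorem node_elem {r : ℕ} (hr : 1 ≤ r) (e : ℕ) (j : Fin (r + 1)) :
    node a b M r (e * r + j) = elemNode (a + e * meshSize a b M) (meshSize a b M) r j := by
  have hj := j.is_lt
  rcases Nat.lt_or_ge j.val r with h | h
  · have h1 : (e * r + j.val) / r = e := by
      rw [mul_comm, Nat.mul_add_div (by omega), Nat.div_eq_of_lt h, add_zero]
    have h2 : (e * r + j.val) % r = j.val := by
      rw [mul_comm, Nat.mul_add_mod, Nat.mod_eq_of_lt h]
    have h3 : Fin.ofNat (r + 1) j.val = j := by
      apply Fin.ext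
      rw [Fin.val_ofNat]
      exact Nat.mod_eq_of_lt hj
    rw [node, elemNode, h1, h2, h3]
  · have hjr : j = Fin.last r := by apply Fin.ext; simp; omega
    subst hjr
    have h0 : e * r + (Fin.last r).val = (e + 1) * r := by simp; ring
    have h1 : (e + 1) * r / r = e + 1 := Nat.mul_div_cancel _ (by omega)
    have h2 : (e + 1) * r % r = 0 := Nat.mul_mod_left _ _
    have h3 : Fin.ofNat (r + 1) 0 = 0 := rfl
    rw [h0, node, elemNode, h1, h2, h3, glNode_zero hr, glNode_last hr]
    push_cast
    ring

theorem node_mem {r : ℕ} (hr : 1 ≤ r) {m : ℕ} (hm : m ≤ M * r) : node a b M r m ∈ Icc a b := by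
  obtain ⟨e, he, j, rfl⟩ := exists_elem_of_le hM hr hm
  rw [node_elem hr]
  exact elem_subset hab hM he (elemNode_mem hr (meshSize_pos hab hM) j)

omit hab hM in
theorem loc_nodalVec {r : ℕ} (hr : 1 ≤ r) (v : ℝ → ℝ) {e : ℕ} (he : e < M) (j : Fin (r + 1)) :
    loc (nodalVec a b M r v) e j
      = v (elemNode (a + e * meshSize a b M) (meshSize a b M) r j) := by
  rw [loc, nodalVec, val_elem_index he, node_elem hr]

omit hab hM in
theorem elemPoly_nodalVec {r : ℕ} (hr : 1 ≤ r) (v : ℝ → ℝ) {e : ℕ} (he : e < M) :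
    elemPoly a b (nodalVec a b M r v) e
      = elemInterp (a + e * meshSize a b M) (meshSize a b M) r
          (fun j => v (elemNode (a + e * meshSize a b M) (meshSize a b M) r j)) := by
  rw [elemPoly]
  congr 1
  funext j
  exact loc_nodalVec hr v he j

/-- A function of the finite element space is determined by its nodal values. -/
theorem feSpace_eq_elemPoly {r : ℕ} (hr : 1 ≤ r) {v : ℝ → ℝ} (hv : v ∈ feSpace a b M r)
    {e : ℕ} (he : e < M) {x : ℝ}
    (hx : x ∈ Icc (a + e * meshSize a b M) (a + e * meshSize a b M + meshSize a b M)) :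
    v x = (elemPoly a b (nodalVec a b M r v) e).eval x := by
  obtain ⟨p, hp, hpv⟩ := hv.2 e he
  have hh := meshSize_pos hab hM
  rw [show a + ((e : ℝ) + 1) * meshSize a b M
    = a + e * meshSize a b M + meshSize a b M by ring] at hpv
  rw [elemPoly_nodalVec hr v he, hpv x hx]
  have : (fun j => v (elemNode (a + e * meshSize a b M) (meshSize a b M) r j))
      = fun j => p.eval (elemNode (a + e * meshSize a b M) (meshSize a b M) r j) := by
    funext j
    exact hpv _ (elemNode_mem hr hh j)
  rw [this, elemInterp_eval hr hh hp]

theorem feFun_eq_elemPoly {r : ℕ} (U : Fin (M * r + 1) → ℝ) {e : ℕ} (he : e < M)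
    {x : ℝ} (hx : x ∈ Ico (a + e * meshSize a b M) (a + e * meshSize a b M + meshSize a b M)) :
    feFun a b M r U x = (elemPoly a b U e).eval x := by
  have hh := meshSize_pos hab hM
  have hfl : ⌊(x - a) / meshSize a b M⌋₊ = e := by
    rw [Nat.floor_eq_iff (div_nonneg (by linarith [hx.1, le_elem hab hM e]) hh.le),
      le_div_iff₀ hh, div_lt_iff₀ hh]
    constructor <;> [linarith [hx.1]; linarith [hx.2]]
  have hmin : min e (M - 1) = e := min_eq_left (by omega)
  rw [elemPoly, eval_elemInterp, feFun]
  simp only [hfl, hmin, loc]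

theorem deriv_feFun {r : ℕ} (U : Fin (M * r + 1) → ℝ) {e : ℕ} (he : e < M)
    {x : ℝ} (hx : x ∈ Ioo (a + e * meshSize a b M) (a + e * meshSize a b M + meshSize a b M)) :
    deriv (feFun a b M r U) x = (Polynomial.derivative (elemPoly a b U e)).eval x := by
  have : feFun a b M r U =ᶠ[nhds x] fun y => (elemPoly a b U e).eval y := by
    filter_upwards [Ioo_mem_nhds hx.1 hx.2] with y hy
    exact feFun_eq_elemPoly hab hM U he ⟨hy.1.le, hy.2⟩
  rw [this.deriv_eq, Polynomial.deriv]

theorem stiffMatrix_apply {r : ℕ} (i j : Fin (M * r + 1)) :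
    stiffMatrix a b M r i j = -stiffForm a b (Pi.single j 1) (Pi.single i 1) := by
  have hh := meshSize_pos hab hM
  have heq : ∀ e < M, EqOn
      (fun x => (Polynomial.derivative (elemPoly a b (Pi.single j 1) e)).eval x *
        (Polynomial.derivative (elemPoly a b (Pi.single i 1) e)).eval x)
      (fun x => deriv (feFun a b M r (Pi.single j 1)) x * deriv (feFun a b M r (Pi.single i 1)) x)
      (uIoo (a + e * meshSize a b M) (a + e * meshSize a b M + meshSize a b M)) := by
    intro e he x hx
    rw [uIoo_of_le (by linarith)] at hx
    simp only [deriv_feFun hab hM _ he hx]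
  rw [stiffMatrix, Matrix.of_apply, stiffForm, integral_eq_sum_elem hM]
  · congr 1
    refine Finset.sum_congr rfl fun e he => ?_
    exact (intervalIntegral.integral_congr_uIoo (heq e (Finset.mem_range.1 he))).symm
  · intro e he
    refine IntervalIntegrable.congr_uIoo ?_ (heq e he)
    exact ((Polynomial.continuous _).mul (Polynomial.continuous _)).intervalIntegrable _ _

omit hab hM in
theorem eval_derivative_elemPoly {r : ℕ} (U : Fin (M * r + 1) → ℝ) (e : ℕ) (x : ℝ) :
    (Polynomial.derivative (elemPoly a b U e)).eval x
      = ∑ i, U i * (Polynomial.derivative (elemPoly a b (Pi.single i 1) e)).eval x := by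
  simp only [elemPoly, eval_derivative_elemInterp]
  have h1 : ∀ j, loc U e j = ∑ i, U i * loc (Pi.single i (1 : ℝ)) e j := by
    intro j
    simp [loc, Pi.single_apply]
  simp only [h1, Finset.sum_mul, Finset.mul_sum]
  rw [Finset.sum_comm]
  exact Finset.sum_congr rfl fun i _ => Finset.sum_congr rfl fun j _ => by ring

theorem dotProduct_stiffMatrix_mulVec {r : ℕ} (U V : Fin (M * r + 1) → ℝ) :
    V ⬝ᵥ (stiffMatrix a b M r *ᵥ U) = -stiffForm a b U V := by
  simp only [dotProduct, Matrix.mulVec, stiffMatrix_apply hab hM]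
  simp only [stiffForm, eval_derivative_elemPoly U, eval_derivative_elemPoly V,
    Finset.sum_mul_sum]
  have hc : ∀ (e : ℕ) (j i : Fin (M * r + 1)), Continuous fun x =>
      U j * (Polynomial.derivative (elemPoly a b (Pi.single j 1) e)).eval x *
      (V i * (Polynomial.derivative (elemPoly a b (Pi.single i 1) e)).eval x) := by
    intro e j i; fun_prop
  have hI : ∀ e : ℕ, ∫ x in (a + e * meshSize a b M)..(a + e * meshSize a b M + meshSize a b M),
      ∑ j, ∑ i, U j * (Polynomial.derivative (elemPoly a b (Pi.single j 1) e)).eval x *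
      (V i * (Polynomial.derivative (elemPoly a b (Pi.single i 1) e)).eval x)
      = ∑ j, ∑ i, U j * V i *
      ∫ x in (a + e * meshSize a b M)..(a + e * meshSize a b M + meshSize a b M),
       (Polynomial.derivative (elemPoly a b (Pi.single j 1) e)).eval x *
      (Polynomial.derivative (elemPoly a b (Pi.single i 1) e)).eval x := by
    intro e
    rw [intervalIntegral.integral_finsetSum fun j _ =>
      (continuous_finsetSum _ fun i _ => hc e j i).intervalIntegrable _ _]
    refine Finset.sum_congr rfl fun j _ => ?_
    rw [intervalIntegral.integral_finsetSum fun i _ => (hc e j i).intervalIntegrable _ _]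
    refine Finset.sum_congr rfl fun i _ => ?_
    rw [← intervalIntegral.integral_const_mul]
    congr 1
    funext x
    ring
  simp only [hI, Finset.mul_sum, neg_mul, Finset.sum_mul, mul_neg, Finset.sum_neg_distrib]
  congr 1
  rw [Finset.sum_comm (s := Finset.range M), Finset.sum_comm]
  refine Finset.sum_congr rfl fun j _ => ?_
  rw [Finset.sum_comm (s := Finset.range M)]
  refine Finset.sum_congr rfl fun i _ => Finset.sum_congr rfl fun e _ => ?_
  ring

omit hab hM in
theorem sum_nodeWeight_mul {r : ℕ} (φ : Fin (M * r + 1) → ℝ) :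
    ∑ m : Fin (M * r + 1), nodeWeight a b M r m * φ m = ∑ e ∈ Finset.range M, ∑ j : Fin (r + 1),
      meshSize a b M / 2 * glWeight r j * loc φ e j := by
  simp only [nodeWeight, Finset.sum_mul]
  rw [Finset.sum_comm]
  refine Finset.sum_congr rfl fun e he => ?_
  rw [Finset.sum_comm]
  refine Finset.sum_congr rfl fun j _ => ?_
  rw [Finset.sum_eq_single (Fin.ofNat (M * r + 1) (e * r + j))]
  · rw [val_elem_index (Finset.mem_range.1 he), if_pos rfl, loc]
  · intro m _ hm
    rw [if_neg, zero_mul]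
    intro h
    apply hm
    apply Fin.ext
    rw [val_elem_index (Finset.mem_range.1 he), h]
  · intro h; exact absurd (Finset.mem_univ _) h

theorem nodeWeight_pos {r : ℕ} (hr : 1 ≤ r) (m : Fin (M * r + 1)) :
    0 < nodeWeight a b M r m := by
  have hh := meshSize_pos hab hM
  obtain ⟨e, he, j, hej⟩ := exists_elem_of_le hM hr (Nat.le_of_lt_succ m.is_lt)
  have hnn : ∀ (i : ℕ) (k : Fin (r + 1)), 0 ≤ if i * r + k = (m : ℕ)
      then meshSize a b M / 2 * glWeight r k else 0 := by
    intro i k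
    have := glWeight_pos hr k
    split_ifs <;> positivity
  refine Finset.sum_pos' (fun i _ => Finset.sum_nonneg fun k _ => hnn i k)
    ⟨e, Finset.mem_range.2 he, Finset.sum_pos' (fun k _ => hnn e k) ⟨j, Finset.mem_univ _, ?_⟩⟩
  rw [if_pos hej]
  have := glWeight_pos hr j
  positivity

omit hab hM in
theorem lumpForm_eq_sum {r : ℕ} (U V : Fin (M * r + 1) → ℝ) :
    lumpForm a b U V = ∑ e ∈ Finset.range M, ∑ j : Fin (r + 1),
      meshSize a b M / 2 * glWeight r j * loc U e j * loc V e j := by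
  rw [lumpForm]
  simp only [mul_assoc (nodeWeight _ _ _ _ _)]
  rw [sum_nodeWeight_mul]
  refine Finset.sum_congr rfl fun e _ => Finset.sum_congr rfl fun j _ => ?_
  simp only [loc]; ring

/-- The lumped inner product with the discrete Laplacian is minus the stiffness form. -/
theorem lumpForm_laplace {r : ℕ} (hr : 1 ≤ r) (U V : Fin (M * r + 1) → ℝ) :
    lumpForm a b (((massMatrix a b M r)⁻¹ * stiffMatrix a b M r) *ᵥ U) V
      = -stiffForm a b U V := by
  have hdet : IsUnit (massMatrix a b M r).det := by
    rw [massMatrix, Matrix.det_diagonal, isUnit_iff_ne_zero]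
    exact Finset.prod_ne_zero_iff.2 fun m _ => (nodeWeight_pos hab hM hr m).ne'
  rw [← dotProduct_stiffMatrix_mulVec hab hM]
  have h1 : stiffMatrix a b M r *ᵥ U = massMatrix a b M r *ᵥ
      (((massMatrix a b M r)⁻¹ * stiffMatrix a b M r) *ᵥ U) := by
    rw [Matrix.mulVec_mulVec, ← mul_assoc, Matrix.mul_nonsing_inv _ hdet, one_mul]
  rw [h1, lumpForm, dotProduct]
  refine Finset.sum_congr rfl fun m _ => ?_
  rw [massMatrix, Matrix.mulVec_diagonal]
  ring

end Mesh

/-! ### Global consistency and interpolation estimates -/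

section Global

variable {a b : ℝ} {M r : ℕ} (hab : a < b) (hM : 1 ≤ M) (hr : 1 ≤ r)
include hab hM hr

omit hr in
/-- `h Σ_e |V|_e²` is bounded by the lumped norm. -/
theorem sum_loc_sq_le {K : ℝ} (hK : RefBound r K) (V : Fin (M * r + 1) → ℝ) :
    ∑ e ∈ Finset.range M, meshSize a b M * ∑ j, loc V e j ^ 2 ≤ 2 * K * lumpForm a b V V := by
  have hh := meshSize_pos hab hM
  rw [lumpForm_eq_sum, Finset.mul_sum]
  refine Finset.sum_le_sum fun e _ => ?_
  rw [Finset.mul_sum, Finset.mul_sum]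
  refine Finset.sum_le_sum fun j _ => ?_
  have h1 := hK.le_weight j
  have h2 : 0 ≤ meshSize a b M * loc V e j ^ 2 := by positivity
  nlinarith

omit hr in
theorem lumpForm_self_le {K : ℝ} (hK : RefBound r K) (V : Fin (M * r + 1) → ℝ) :
    lumpForm a b V V ≤ K * ∑ e ∈ Finset.range M, meshSize a b M * ∑ j, loc V e j ^ 2 := by
  have hh := meshSize_pos hab hM
  have hK1 := hK.one_le
  rw [lumpForm_eq_sum, Finset.mul_sum]
  refine Finset.sum_le_sum fun e _ => ?_
  rw [Finset.mul_sum, Finset.mul_sum]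
  refine Finset.sum_le_sum fun j _ => ?_
  have h1 := hK.weight_le j
  have h2 : 0 ≤ meshSize a b M * loc V e j ^ 2 := by positivity
  nlinarith

theorem lumpForm_self_nonneg (V : Fin (M * r + 1) → ℝ) : 0 ≤ lumpForm a b V V := by
  refine Finset.sum_nonneg fun m _ => ?_
  have := nodeWeight_pos hab hM hr m
  rw [mul_assoc]
  exact mul_nonneg this.le (mul_self_nonneg _)

omit hr in
/-- The sum over the elements of the squared Taylor remainders of order `n + 1`. -/
theorem sum_remainder_sq_le (n : ℕ) {g : ℝ → ℝ} (hg : IntervalIntegrable g volume a b)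
    (hg2 : IntervalIntegrable (fun x => g x ^ 2) volume a b) :
    ∑ e ∈ Finset.range M, meshSize a b M * (meshSize a b M ^ n *
      ∫ x in (a + e * meshSize a b M)..(a + e * meshSize a b M + meshSize a b M), |g x|) ^ 2
      ≤ meshSize a b M ^ (2 * (n + 1)) * ∫ x in a..b, g x ^ 2 := by
  have hh := meshSize_pos hab hM
  set h := meshSize a b M with hhdef
  have hi : ∀ {k : ℝ → ℝ}, IntervalIntegrable k volume a b → ∀ e < M,
      IntervalIntegrable k volume (a + e * h) (a + e * h + h) := by
    intro k hk e he
    refine hk.mono_set ?_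
    rw [uIcc_of_le hab.le, uIcc_of_le (by linarith)]
    exact elem_subset hab hM he
  rw [integral_eq_sum_elem hM (fun e he => hi hg2 e he), Finset.mul_sum]
  refine Finset.sum_le_sum fun e he => ?_
  have he' := Finset.mem_range.1 he
  have h1 := sq_integral_abs_le (by linarith : a + e * h ≤ a + e * h + h) (hi hg e he')
    (hi hg2 e he')
  rw [add_sub_cancel_left] at h1
  calc h * (h ^ n * ∫ x in (a + e * h)..(a + e * h + h), |g x|) ^ 2
      = h * h ^ (2 * n) * (∫ x in (a + e * h)..(a + e * h + h), |g x|) ^ 2 := by ring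
    _ ≤ h * h ^ (2 * n) * (h * ∫ x in (a + e * h)..(a + e * h + h), g x ^ 2) := by gcongr
    _ = _ := by ring

/-- The interpolation error of a function in `H^r`. -/
theorem integral_sq_sub_interp_le {K : ℝ} (hK : RefBound r K) {H : ℕ → ℝ → ℝ}
    (hH : ∀ i < r, IsPrimitive a b (H i) (H (i + 1)))
    (hH2 : IntervalIntegrable (fun x => H r x ^ 2) volume a b) :
    ∑ e ∈ Finset.range M,
      ∫ x in (a + e * meshSize a b M)..(a + e * meshSize a b M + meshSize a b M),
        (H 0 x - (elemPoly a b (nodalVec a b M r (H 0)) e).eval x) ^ 2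
      ≤ (1 + K * (r + 1)) ^ 2 * (meshSize a b M ^ (2 * r) * ∫ x in a..b, H r x ^ 2) := by
  obtain ⟨n, rfl⟩ : ∃ n, r = n + 1 := ⟨r - 1, by omega⟩
  have hh := meshSize_pos hab hM
  refine le_trans ?_ (mul_le_mul_of_nonneg_left
    (sum_remainder_sq_le hab hM n (hH n (by omega)).1 hH2) (sq_nonneg _))
  rw [Finset.mul_sum]
  refine Finset.sum_le_sum fun e he => ?_
  have he' := Finset.mem_range.1 he
  set h := meshSize a b M
  set α := a + e * h with hα
  have hle : α ≤ α + h := by linarith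
  obtain ⟨p, hp, hpB⟩ := exists_poly_approx hle n H
    (fun i hi => (hH i (by omega)).elem hab hM he')
  rw [add_sub_cancel_left] at hpB
  set δ := h ^ n * ∫ t in α..(α + h), |H (n + 1) t|
  rw [elemPoly_nodalVec hr _ he']
  set q := elemInterp α h (n + 1) (fun j => H 0 (elemNode α h (n + 1) j)) with hq
  have hb : ∀ x ∈ Icc α (α + h), (H 0 x - q.eval x) ^ 2
      ≤ ((1 + K * (((n + 1 : ℕ) : ℝ) + 1)) * δ) ^ 2 := by
    intro x hx
    rw [← sq_abs]
    exact pow_le_pow_left₀ (abs_nonneg _)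
      (abs_sub_elemInterp_le hr hh hK (hp.trans (by omega)) hpB hx) 2
  have hc : ContinuousOn (H 0) (Icc α (α + h)) :=
    ((hH 0 (by omega)).elem hab hM he').continuousOn hle
  have h3 := intervalIntegral.integral_mono_on hle
    (ContinuousOn.intervalIntegrable (by
      rw [uIcc_of_le hle]; exact (hc.sub q.continuousOn).pow 2))
    (by simp : IntervalIntegrable
      (fun _ => ((1 + K * (((n + 1 : ℕ) : ℝ) + 1)) * δ) ^ 2) volume α (α + h)) hb
  rw [intervalIntegral.integral_const, add_sub_cancel_left, smul_eq_mul] at h3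
  refine h3.trans (le_of_eq (by ring))

omit hr in
/-- The lumped norm of the nodal vector of `v` in terms of the `L²`-norm of a function `w` and its
distance `B` from the interpolant of `v`. -/
theorem lumpForm_nodalVec_le {K : ℝ} (hK : RefBound r K) {v w : ℝ → ℝ}
    (hw : ContinuousOn w (Icc a b)) {B : ℝ}
    (hB : ∑ e ∈ Finset.range M,
      ∫ x in (a + e * meshSize a b M)..(a + e * meshSize a b M + meshSize a b M),
        (w x - (elemPoly a b (nodalVec a b M r v) e).eval x) ^ 2 ≤ B) :
    lumpForm a b (nodalVec a b M r v) (nodalVec a b M r v)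
      ≤ 4 * K ^ 2 * ((∫ x in a..b, w x ^ 2) + B) := by
  have hh := meshSize_pos hab hM
  have hK1 := hK.one_le
  set h := meshSize a b M
  have h1 := lumpForm_self_le hab hM hK (nodalVec a b M r v)
  have hwe : ∀ e < M, ContinuousOn w (Icc (a + e * h) (a + e * h + h)) := fun e he =>
    hw.mono (elem_subset hab hM he)
  have hwi : IntervalIntegrable (fun x => w x ^ 2) volume a b := by
    apply ContinuousOn.intervalIntegrable; rw [uIcc_of_le hab.le]; exact hw.pow 2
  have h2 : ∀ e ∈ Finset.range M, h * ∑ j, loc (nodalVec a b M r v) e j ^ 2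
      ≤ 4 * K * ((∫ x in (a + e * h)..(a + e * h + h), w x ^ 2) +
        ∫ x in (a + e * h)..(a + e * h + h),
          (w x - (elemPoly a b (nodalVec a b M r v) e).eval x) ^ 2) := by
    intro e he
    have he' := Finset.mem_range.1 he
    have hle : a + e * h ≤ a + e * h + h := by linarith
    refine (sum_sq_le_integral_elemInterp (α := a + e * h) hh hK _).trans ?_
    set q := elemPoly a b (nodalVec a b M r v) e with hq
    have hi : ∀ {k : ℝ → ℝ}, ContinuousOn k (Icc (a + e * h) (a + e * h + h)) →
        IntervalIntegrable k volume (a + e * h) (a + e * h + h) := fun hk => by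
      apply ContinuousOn.intervalIntegrable; rwa [uIcc_of_le hle]
    have hi1 : IntervalIntegrable (fun x => w x ^ 2) volume _ _ := hi ((hwe e he').pow 2)
    have hi2 : IntervalIntegrable (fun x => (w x - q.eval x) ^ 2) volume _ _ :=
      hi (((hwe e he').sub q.continuousOn).pow 2)
    have h3 : ∫ x in (a + e * h)..(a + e * h + h), q.eval x ^ 2
        ≤ ∫ x in (a + e * h)..(a + e * h + h), 2 * (w x ^ 2 + (w x - q.eval x) ^ 2) := by
      refine intervalIntegral.integral_mono_on hle (hi (q.continuousOn.pow 2))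
        ((hi1.add hi2).const_mul 2) fun x _ => ?_
      nlinarith [sq_nonneg (2 * w x - q.eval x)]
    rw [intervalIntegral.integral_const_mul, intervalIntegral.integral_add hi1 hi2] at h3
    have h4 : 2 * K * ∫ x in (a + e * h)..(a + e * h + h), q.eval x ^ 2 ≤ 2 * K * (2 * _) :=
      mul_le_mul_of_nonneg_left h3 (by linarith)
    refine h4.trans (le_of_eq (by ring))
  have h3 := (Finset.sum_le_sum h2).trans_eq (Finset.mul_sum ..).symm
  rw [Finset.sum_add_distrib, ← integral_eq_sum_elem' hab hM hwi] at h3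
  calc _ ≤ K * _ := h1
    _ ≤ K * (4 * K * ((∫ x in a..b, w x ^ 2) + B)) := by
        refine mul_le_mul_of_nonneg_left (h3.trans ?_) (by linarith)
        gcongr
    _ = _ := by ring

/-- The `L²`-norm of a finite element function is bounded by its lumped norm. -/
theorem sum_integral_sq_elemPoly_le {K : ℝ} (hK : RefBound r K) (V : Fin (M * r + 1) → ℝ) :
    ∑ e ∈ Finset.range M,
      ∫ x in (a + e * meshSize a b M)..(a + e * meshSize a b M + meshSize a b M),
        (elemPoly a b V e).eval x ^ 2
      ≤ 2 * K ^ 3 * (r + 1) * lumpForm a b V V := by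
  have hh := meshSize_pos hab hM
  have hK1 := hK.one_le
  have h1 : ∀ e ∈ Finset.range M,
      ∫ x in (a + e * meshSize a b M)..(a + e * meshSize a b M + meshSize a b M),
        (elemPoly a b V e).eval x ^ 2
      ≤ K ^ 2 * (r + 1) * (meshSize a b M * ∑ j, loc V e j ^ 2) := fun e _ =>
    (integral_sq_elemInterp_le hh hK (loc V e)).trans (le_of_eq (by ring))
  refine (Finset.sum_le_sum h1).trans ?_
  rw [← Finset.mul_sum]
  refine (mul_le_mul_of_nonneg_left (sum_loc_sq_le hab hM hK V) (by positivity)).trans ?_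
  refine le_of_eq (by ring)

/-- Elementwise integration by parts: the contributions of the element boundaries telescope, and
the ones at `a` and `b` vanish by the Neumann condition. -/
theorem sum_integral_parts_eq_zero {G g : ℝ → ℝ} (hG : IsPrimitive a b G g) (ha : G a = 0)
    (hb : G b = 0) (V : Fin (M * r + 1) → ℝ) :
    ∑ e ∈ Finset.range M,
      ((∫ x in (a + e * meshSize a b M)..(a + e * meshSize a b M + meshSize a b M),
          g x * (elemPoly a b V e).eval x) +
        ∫ x in (a + e * meshSize a b M)..(a + e * meshSize a b M + meshSize a b M),
          G x * (Polynomial.derivative (elemPoly a b V e)).eval x) = 0 := by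
  have hh := meshSize_pos hab hM
  set h := meshSize a b M
  set B : ℕ → ℝ := fun e => G (a + e * h) * V (Fin.ofNat (M * r + 1) (e * r)) with hBdef
  have hterm : ∀ e ∈ Finset.range M,
      ((∫ x in (a + e * h)..(a + e * h + h), g x * (elemPoly a b V e).eval x) +
        ∫ x in (a + e * h)..(a + e * h + h),
          G x * (Polynomial.derivative (elemPoly a b V e)).eval x) = B (e + 1) - B e := by
    intro e he
    have he' := Finset.mem_range.1 he
    set p := elemPoly a b V e with hp
    have hle : a + e * h ≤ a + e * h + h := by linarith
    have h1 := (hG.elem hab hM he').integral_mul_deriv hle (φ := fun x => p.eval x)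
      (by simpa using Polynomial.contDiff_aeval (𝕜 := ℝ) p 1)
    simp only [Polynomial.deriv] at h1
    have hl : p.eval (a + e * h) = V (Fin.ofNat (M * r + 1) (e * r)) := by
      have h2 := eval_elemInterp_elemNode hr hh (α := a + e * h) (loc V e) 0
      rw [elemNode, glNode_zero hr] at h2
      rw [loc, Fin.val_zero, add_zero,
        show a + e * h + h * ((-1 + 1) / 2) = a + e * h by ring] at h2
      exact h2
    have hr' : p.eval (a + e * h + h) = V (Fin.ofNat (M * r + 1) ((e + 1) * r)) := by
      have h2 := eval_elemInterp_elemNode hr hh (α := a + e * h) (loc V e) (Fin.last r)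
      rw [elemNode, glNode_last hr, loc] at h2
      have h3 : e * r + (Fin.last r).val = (e + 1) * r := by simp; ring
      rw [h3, show a + e * h + h * ((1 + 1) / 2) = a + e * h + h by ring] at h2
      exact h2
    have hx : a + ((e + 1 : ℕ) : ℝ) * h = a + e * h + h := by push_cast; ring
    rw [hl, hr'] at h1
    rw [h1]
    simp only [hBdef, hx]
    ring
  rw [Finset.sum_congr rfl hterm, Finset.sum_range_sub]
  simp only [hBdef]
  rw [show a + (M : ℝ) * h = b from add_mul_meshSize hM, hb]
  simp [ha]

/-- The consistency error of the lumped finite element method, tested with a nodal vector `V`: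
`G 0` is a function with derivatives `G 1`, …, `G (r + 1)`, and `H 0` with derivatives
`H 1`, …, `H r` is its second derivative. -/
theorem consistency_le {K : ℝ} (hK : RefBound r K) {G H : ℕ → ℝ → ℝ}
    (hG : ∀ i < r + 1, IsPrimitive a b (G i) (G (i + 1)))
    (hG2 : IntervalIntegrable (fun x => G (r + 1) x ^ 2) volume a b)
    (hH : ∀ i < r, IsPrimitive a b (H i) (H (i + 1)))
    (hH2 : IntervalIntegrable (fun x => H r x ^ 2) volume a b)
    (hGH : IsPrimitive a b (G 1) (H 0)) (ha : G 1 a = 0) (hb : G 1 b = 0)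
    (V : Fin (M * r + 1) → ℝ) :
    lumpForm a b (nodalVec a b M r (H 0)) V + stiffForm a b (nodalVec a b M r (G 0)) V
      ≤ meshSize a b M ^ (2 * r) * (K ^ 2 * (∫ x in a..b, H r x ^ 2)
          + (1 + 2 * K * (r + 1)) ^ 2 / 2 * ∫ x in a..b, G (r + 1) x ^ 2)
        + 2 * K * (r + 1) * lumpForm a b V V + stiffForm a b V V / 2 := by
  obtain ⟨n, rfl⟩ : ∃ n, r = n + 1 := ⟨r - 1, by omega⟩
  have hh := meshSize_pos hab hM
  have hK1 := hK.one_le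
  set h := meshSize a b M with hhdef
  set c := 1 + 2 * K * (((n + 1 : ℕ) : ℝ) + 1) with hc
  have hparts := sum_integral_parts_eq_zero hab hM hr hGH ha hb V
  have hremH := sum_remainder_sq_le hab hM n (hH n (by omega)).1 hH2
  have hremG := sum_remainder_sq_le hab hM n (hG (n + 1) (by omega)).1 hG2
  have hloc := sum_loc_sq_le hab hM hK V
  rw [← hhdef] at hremH hremG hparts hloc
  -- The bound for the contribution of one element.
  have hterm : ∀ e ∈ Finset.range M,
      (∑ j, h / 2 * glWeight (n + 1) j * loc (nodalVec a b M (n + 1) (H 0)) e j * loc V e j)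
      + (∫ x in (a + e * h)..(a + e * h + h),
          (Polynomial.derivative (elemPoly a b (nodalVec a b M (n + 1) (G 0)) e)).eval x *
          (Polynomial.derivative (elemPoly a b V e)).eval x)
      ≤ ((∫ x in (a + e * h)..(a + e * h + h), H 0 x * (elemPoly a b V e).eval x) +
        ∫ x in (a + e * h)..(a + e * h + h),
          G 1 x * (Polynomial.derivative (elemPoly a b V e)).eval x)
      + K ^ 2 * (h * (h ^ n * ∫ x in (a + e * h)..(a + e * h + h), |H (n + 1) x|) ^ 2)
      + c ^ 2 / 2 * (h * (h ^ n * ∫ x in (a + e * h)..(a + e * h + h), |G (n + 2) x|) ^ 2)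
      + (((n + 1 : ℕ) : ℝ) + 1) * (h * ∑ j, loc V e j ^ 2)
      + (∫ x in (a + e * h)..(a + e * h + h),
          (Polynomial.derivative (elemPoly a b V e)).eval x *
          (Polynomial.derivative (elemPoly a b V e)).eval x) / 2 := by
    intro e he
    have he' := Finset.mem_range.1 he
    set α := a + e * h with hα
    have hle : α ≤ α + h := by linarith
    -- The quadrature error.
    obtain ⟨p, hp, hpB⟩ := exists_poly_approx hle n H
      (fun i hi => (hH i (by omega)).elem hab hM he')
    rw [add_sub_cancel_left] at hpB
    set δ := h ^ n * ∫ t in α..(α + h), |H (n + 1) t| with hδ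
    have hq := abs_quadrature_error_le hr hh hK
      (((hH 0 (by omega)).elem hab hM he').continuousOn hle) (by omega) hpB (loc V e)
    have hS := sq_sum_abs_le (loc V e)
    set S := ∑ j, |loc V e j|
    have hyoung : 2 * h * K * δ * S
        ≤ K ^ 2 * (h * δ ^ 2) + (((n + 1 : ℕ) : ℝ) + 1) * (h * ∑ j, loc V e j ^ 2) := by
      have h1 : 0 ≤ h * (K * δ - S) ^ 2 := by positivity
      have h2 := mul_le_mul_of_nonneg_left hS hh.le
      nlinarith
    -- The error of the interpolant in the energy form.
    obtain ⟨p', hp', hpB', hpD'⟩ := exists_poly_approx_deriv hle n G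
      (fun i hi => (hG i (by omega)).elem hab hM he')
    rw [add_sub_cancel_left] at hpB' hpD'
    set ε := h ^ n * ∫ t in α..(α + h), |G (n + 2) t| with hε
    have hI := fun x (hx : x ∈ Icc α (α + h)) =>
      abs_sub_derivative_elemInterp_le hr hh hK hp' hpB' hpD' hx
    rw [← hc] at hI
    rw [elemPoly_nodalVec hr _ he']
    simp only [loc_nodalVec hr _ he']
    rw [← hhdef, ← hα]
    set q := Polynomial.derivative (elemInterp α h (n + 1)
      (fun j => G 0 (elemNode α h (n + 1) j))) with hqdef
    set v' := Polynomial.derivative (elemPoly a b V e) with hv'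
    have hG1c : ContinuousOn (G 1) (Icc α (α + h)) :=
      (hGH.elem hab hM he').continuousOn hle
    have hi : ∀ {k : ℝ → ℝ}, ContinuousOn k (Icc α (α + h)) →
        IntervalIntegrable k volume α (α + h) := fun hk => by
      apply ContinuousOn.intervalIntegrable; rwa [uIcc_of_le hle]
    have hgrad : (∫ x in α..(α + h), q.eval x * v'.eval x)
        - ∫ x in α..(α + h), G 1 x * v'.eval x
        ≤ c ^ 2 / 2 * (h * ε ^ 2) + (∫ x in α..(α + h), v'.eval x * v'.eval x) / 2 := by
      have i1 : IntervalIntegrable (fun x => q.eval x * v'.eval x) volume α (α + h) :=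
        hi (q.continuousOn.mul v'.continuousOn)
      have i2 : IntervalIntegrable (fun x => G 1 x * v'.eval x) volume α (α + h) :=
        hi (hG1c.mul v'.continuousOn)
      have i3 : IntervalIntegrable (fun x => v'.eval x * v'.eval x / 2) volume α (α + h) :=
        hi ((v'.continuousOn.mul v'.continuousOn).div_const 2)
      rw [← intervalIntegral.integral_sub i1 i2]
      have h1 := intervalIntegral.integral_mono_on hle (i1.sub i2)
        ((by simp : IntervalIntegrable (fun _ => c ^ 2 / 2 * ε ^ 2) volume α (α + h)).add i3)
        (fun x hx => by
            have h2 := pow_le_pow_left₀ (abs_nonneg _) (hI x hx) 2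
            rw [sq_abs] at h2
            show q.eval x * v'.eval x - G 1 x * v'.eval x
              ≤ c ^ 2 / 2 * ε ^ 2 + v'.eval x * v'.eval x / 2
            nlinarith [sq_nonneg (q.eval x - G 1 x - v'.eval x)])
      rw [intervalIntegral.integral_add (by simp) i3, intervalIntegral.integral_div] at h1
      simp only [intervalIntegral.integral_const, add_sub_cancel_left, smul_eq_mul] at h1
      refine h1.trans (le_of_eq (by ring))
    have hq' : (∑ j, h / 2 * glWeight (n + 1) j * H 0 (elemNode α h (n + 1) j) * loc V e j)
        - ∫ x in α..(α + h), H 0 x * (elemPoly a b V e).eval x ≤ 2 * h * K * δ * S :=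
      (le_abs_self _).trans hq
    linarith
  have hsum := Finset.sum_le_sum hterm
  simp only [Finset.sum_add_distrib, ← Finset.mul_sum, ← Finset.sum_div] at hsum hparts
  rw [lumpForm_eq_sum, stiffForm, stiffForm]
  simp only [← hhdef]
  have h1 := mul_le_mul_of_nonneg_left hremH (sq_nonneg K)
  have h2 := mul_le_mul_of_nonneg_left hremG (by positivity : 0 ≤ c ^ 2 / 2)
  have h3 := mul_le_mul_of_nonneg_left hloc
    (by positivity : (0 : ℝ) ≤ ((n + 1 : ℕ) : ℝ) + 1)
  simp only [← Finset.mul_sum] at h1 h2 h3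
  have e1 : h ^ (2 * (n + 1)) * (K ^ 2 * (∫ x in a..b, H (n + 1) x ^ 2)
      + c ^ 2 / 2 * ∫ x in a..b, G (n + 1 + 1) x ^ 2)
      = K ^ 2 * (h ^ (2 * (n + 1)) * ∫ x in a..b, H (n + 1) x ^ 2)
      + c ^ 2 / 2 * (h ^ (2 * (n + 1)) * ∫ x in a..b, G (n + 1 + 1) x ^ 2) := by ring
  have e2 : 2 * K * (((n + 1 : ℕ) : ℝ) + 1) * lumpForm a b V V
      = (((n + 1 : ℕ) : ℝ) + 1) * (2 * K * lumpForm a b V V) := by ring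
  rw [e1, e2]
  linarith

end Global

/-! ### Variation of constants, Gronwall's inequality, and representatives of derivatives -/

section Duhamel

variable {ι : Type*} [Fintype ι] [DecidableEq ι]

theorem hasDerivAt_exp_smul_matrix (B : Matrix ι ι ℝ) (c s : ℝ) (i j : ι) :
    HasDerivAt (fun t : ℝ => NormedSpace.exp ((t - c) • B) i j)
      ((B * NormedSpace.exp ((s - c) • B)) i j) s := by
  let _ : NormedRing (Matrix ι ι ℝ) := Matrix.linftyOpNormedRing
  let _ : NormedAlgebra ℝ (Matrix ι ι ℝ) := Matrix.linftyOpNormedAlgebra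
  have h1 : HasDerivAt (fun t : ℝ => NormedSpace.exp (t • B))
      (B * NormedSpace.exp ((s - c) • B)) (s - c) := hasDerivAt_exp_smul_const' B (s - c)
  have h2 := h1.scomp s ((hasDerivAt_id s).sub_const c)
  rw [one_smul] at h2
  exact (LinearMap.toContinuousLinearMap
    (Matrix.entryLinearMap ℝ ℝ i j)).hasFDerivAt.comp_hasDerivAt s h2

omit [DecidableEq ι] in
theorem hasDerivAt_mulVec {A : ℝ → Matrix ι ι ℝ} {A' : Matrix ι ι ℝ} {w : ℝ → ι → ℝ} {w' : ι → ℝ}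
    {s : ℝ} (hA : ∀ i j, HasDerivAt (fun t => A t i j) (A' i j) s) (hw : HasDerivAt w w' s) :
    HasDerivAt (fun t => A t *ᵥ w t) (A' *ᵥ w s + A s *ᵥ w') s := by
  refine hasDerivAt_pi.2 fun i => ?_
  have h := HasDerivAt.fun_sum (u := Finset.univ) (fun j _ => (hA i j).mul (hasDerivAt_pi.1 hw j))
  simp only [Pi.add_apply, Matrix.mulVec, dotProduct, ← Finset.sum_add_distrib]
  exact h

theorem continuous_exp_mulVec (B : Matrix ι ι ℝ) (c : ℝ) {Φ : ℝ → ι → ℝ} (hΦ : Continuous Φ) :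
    Continuous fun σ => NormedSpace.exp ((c - σ) • B) *ᵥ Φ σ := by
  refine continuous_pi fun i => ?_
  simp only [Matrix.mulVec, dotProduct]
  refine continuous_finsetSum _ fun j _ => Continuous.mul ?_ ((continuous_apply j).comp hΦ)
  have h : Continuous fun t : ℝ => NormedSpace.exp ((t - 0) • B) i j :=
    continuous_iff_continuousAt.2 fun t => (hasDerivAt_exp_smul_matrix B 0 t i j).continuousAt
  simp only [sub_zero] at h
  exact h.comp (continuous_const.sub continuous_id : Continuous fun σ : ℝ => c - σ)

theorem exp_smul_mul_exp_smul (B : Matrix ι ι ℝ) (p q : ℝ) :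
    NormedSpace.exp (p • B) * NormedSpace.exp (q • B) = NormedSpace.exp ((p + q) • B) := by
  rw [add_smul, Matrix.exp_add_of_commute]
  exact ((Commute.refl B).smul_left p).smul_right q

/-- The solution of `y' = B y + Φ`, `y(c) = z`, by Duhamel's formula. -/
noncomputable def duhamel (B : Matrix ι ι ℝ) (c : ℝ) (z : ι → ℝ) (Φ : ℝ → ι → ℝ) (s : ℝ) : ι → ℝ :=
  NormedSpace.exp ((s - c) • B) *ᵥ z + ∫ σ in c..s, NormedSpace.exp ((s - σ) • B) *ᵥ Φ σ

theorem duhamel_self (B : Matrix ι ι ℝ) (c : ℝ) (z : ι → ℝ) (Φ : ℝ → ι → ℝ) :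
    duhamel B c z Φ c = z := by
  simp [duhamel]

theorem hasDerivAt_duhamel (B : Matrix ι ι ℝ) (c : ℝ) (z : ι → ℝ) {Φ : ℝ → ι → ℝ}
    (hΦ : Continuous Φ) (s : ℝ) :
    HasDerivAt (duhamel B c z Φ) (B *ᵥ duhamel B c z Φ s + Φ s) s := by
  set w : ℝ → ι → ℝ := fun s => z + ∫ σ in c..s, NormedSpace.exp ((c - σ) • B) *ᵥ Φ σ with hw
  have hcont := continuous_exp_mulVec B c hΦ
  have hrep : ∀ s, duhamel B c z Φ s = NormedSpace.exp ((s - c) • B) *ᵥ w s := by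
    intro s
    rw [hw, Matrix.mulVec_add, duhamel]
    congr 1
    have h1 := (LinearMap.toContinuousLinearMap
      (Matrix.mulVecLin (NormedSpace.exp ((s - c) • B)))).intervalIntegral_comp_comm
      (hcont.intervalIntegrable (μ := volume) c s)
    simp only [LinearMap.coe_toContinuousLinearMap', Matrix.mulVecLin_apply] at h1
    rw [← h1]
    congr 1
    funext σ
    rw [Matrix.mulVec_mulVec, exp_smul_mul_exp_smul]
    congr 3
    ring
  have hwd : HasDerivAt w (NormedSpace.exp ((c - s) • B) *ᵥ Φ s) s :=
    (intervalIntegral.integral_hasDerivAt_right (hcont.intervalIntegrable _ _)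
      (hcont.stronglyMeasurableAtFilter _ _) hcont.continuousAt).const_add z
  have h := hasDerivAt_mulVec (A := fun t => NormedSpace.exp ((t - c) • B))
    (hasDerivAt_exp_smul_matrix B c s) hwd
  rw [Matrix.mulVec_mulVec, exp_smul_mul_exp_smul, show s - c + (c - s) = 0 by ring, zero_smul,
    NormedSpace.exp_zero, Matrix.one_mulVec, ← Matrix.mulVec_mulVec, ← hrep] at h
  rw [show duhamel B c z Φ = _ from funext hrep]
  rw [hrep] at h
  exact h

end Duhamel

/-- Gronwall's inequality on one time step. -/
theorem gronwall_step {E E' : ℝ → ℝ} {s₀ s₁ A D : ℝ} (h01 : s₀ ≤ s₁) (hA : 0 ≤ A) (hD : 0 ≤ D)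
    (hc : ContinuousOn E (Icc s₀ s₁)) (hd : ∀ s ∈ Ioo s₀ s₁, HasDerivAt E (E' s) s)
    (hE : ∀ s ∈ Ioo s₀ s₁, E' s ≤ A * E s + D) :
    E s₁ ≤ Real.exp (A * (s₁ - s₀)) * (E s₀ + D * (s₁ - s₀)) := by
  set Z : ℝ → ℝ := fun s => Real.exp (-(A * (s - s₀))) * E s - D * (s - s₀) with hZ
  have hder : ∀ s ∈ Ioo s₀ s₁, HasDerivAt Z
      (Real.exp (-(A * (s - s₀))) * -A * E s + Real.exp (-(A * (s - s₀))) * E' s - D) s := by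
    intro s hs
    have h0 : HasDerivAt (fun s => A * (s - s₀)) A s := by
      simpa using ((hasDerivAt_id s).sub_const s₀).const_mul A
    have h1 : HasDerivAt (fun s => -(A * (s - s₀))) (-A) s := h0.fun_neg
    have h2 : HasDerivAt (fun s => D * (s - s₀)) D s := by
      simpa using ((hasDerivAt_id s).sub_const s₀).const_mul D
    exact (h1.exp.mul (hd s hs)).sub h2
  have hanti : AntitoneOn Z (Icc s₀ s₁) := by
    refine antitoneOn_of_deriv_nonpos (convex_Icc _ _) ?_ ?_ ?_
    · exact (Continuous.continuousOn (by fun_prop)).mul hc |>.sub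
        (Continuous.continuousOn (by fun_prop))
    · rw [interior_Icc]
      exact fun s hs => (hder s hs).differentiableAt.differentiableWithinAt
    · rw [interior_Icc]
      intro s hs
      rw [(hder s hs).deriv]
      have h1 : Real.exp (-(A * (s - s₀))) ≤ 1 := by
        rw [Real.exp_le_one_iff]
        have := mul_nonneg hA (sub_nonneg.2 hs.1.le)
        linarith
      have h2 := mul_le_mul_of_nonneg_left (hE s hs) (Real.exp_pos (-(A * (s - s₀)))).le
      have h3 := mul_le_mul_of_nonneg_right h1 hD
      nlinarith
  have h := hanti (left_mem_Icc.2 h01) (right_mem_Icc.2 h01) h01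
  simp only [hZ, sub_self, mul_zero, neg_zero, Real.exp_zero, one_mul, sub_zero] at h
  have h2 : Real.exp (-(A * (s₁ - s₀))) * E s₁ ≤ E s₀ + D * (s₁ - s₀) := by linarith
  calc E s₁ = Real.exp (A * (s₁ - s₀)) * (Real.exp (-(A * (s₁ - s₀))) * E s₁) := by
        rw [← mul_assoc, ← Real.exp_add]; simp
    _ ≤ _ := mul_le_mul_of_nonneg_left h2 (Real.exp_pos _).le

/-- Gronwall's inequality over all time steps. -/
theorem discrete_gronwall {E : ℕ → ℝ} {A D τ : ℝ} {N : ℕ} (hA : 0 ≤ A) (hD : 0 ≤ D) (hτ : 0 ≤ τ)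
    (h : ∀ n, 1 ≤ n → n ≤ N → E n ≤ Real.exp (A * τ) * (E (n - 1) + D * τ)) :
    ∀ n ≤ N, E n ≤ Real.exp (A * (n * τ)) * (E 0 + D * (n * τ)) := by
  intro n
  induction n with
  | zero => intro _; simp
  | succ n ih =>
    intro hn
    have h1 := h (n + 1) (by omega) hn
    rw [Nat.add_sub_cancel] at h1
    have h2 := ih (by omega)
    have h3 : D * τ ≤ Real.exp (A * (n * τ)) * (D * τ) :=
      le_mul_of_one_le_left (by positivity) (Real.one_le_exp (by positivity))
    refine h1.trans ?_
    calc Real.exp (A * τ) * (E n + D * τ)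
        ≤ Real.exp (A * τ) * (Real.exp (A * (n * τ)) * (E 0 + D * (n * τ))
          + Real.exp (A * (n * τ)) * (D * τ)) := by gcongr
      _ = Real.exp (A * τ) * Real.exp (A * (n * τ)) * (E 0 + D * ((n + 1 : ℕ) * τ)) := by
          push_cast; ring
      _ = _ := by rw [← Real.exp_add]; congr 2; push_cast; ring

/-- In every factor `(s - t_{n-i}) / (t_{n-j} - t_{n-i})` the numerator is at most `k τ` and the
denominator at least `τ`. Hence the Lagrange basis at the equidistant points `t_{n-1}, …, t_{n-k}` is bounded on
`[t_{n-1}, t_n]` uniformly in the step size. -/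
theorem abs_basis_equidistant_le {k : ℕ} {n τ s : ℝ} (hτ : 0 < τ)
    (hs : s ∈ Icc ((n - 1) * τ) (n * τ)) (j : Fin k) :
    |(Lagrange.basis Finset.univ (fun i : Fin k => (n - (i + 1)) * τ) j).eval s|
      ≤ (k : ℝ) ^ k := by
  have hk : 1 ≤ k := Nat.one_le_iff_ne_zero.2 fun h => by subst h; exact j.elim0
  have hk' : (1 : ℝ) ≤ k := by exact_mod_cast hk
  rw [Lagrange.basis, Polynomial.eval_prod, Finset.abs_prod]
  have hfac : ∀ i ∈ Finset.univ.erase j,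
      |(Lagrange.basisDivisor ((n - ((j : ℕ) + 1)) * τ) ((n - ((i : ℕ) + 1)) * τ)).eval s| ≤ k := by
    intro i hi
    have hij : (i : ℕ) ≠ (j : ℕ) := fun h => Finset.ne_of_mem_erase hi (Fin.ext h)
    have hik : ((i : ℕ) : ℝ) + 1 ≤ k := by exact_mod_cast i.is_lt
    have h1 : |s - (n - ((i : ℕ) + 1)) * τ| ≤ k * τ := by
      have h0 : (0 : ℝ) ≤ (i : ℕ) := Nat.cast_nonneg _
      rw [abs_of_nonneg (by nlinarith [hs.1])]
      nlinarith [hs.2]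
    have h2 : τ ≤ |(n - ((j : ℕ) + 1)) * τ - (n - ((i : ℕ) + 1)) * τ| := by
      have : (n - ((j : ℕ) + 1)) * τ - (n - ((i : ℕ) + 1)) * τ
          = (((i : ℕ) : ℤ) - ((j : ℕ) : ℤ) : ℤ) * τ := by push_cast; ring
      rw [this, abs_mul, abs_of_pos hτ]
      refine le_mul_of_one_le_left hτ.le ?_
      rw [← Int.cast_abs]
      have : (1 : ℤ) ≤ |((i : ℕ) : ℤ) - ((j : ℕ) : ℤ)| := Int.one_le_abs (by omega)
      exact_mod_cast this
    simp only [Lagrange.basisDivisor, Polynomial.eval_mul, Polynomial.eval_C, Polynomial.eval_sub,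
      Polynomial.eval_X, abs_mul, abs_inv]
    rw [inv_mul_le_iff₀ (lt_of_lt_of_le hτ h2)]
    refine h1.trans ?_
    rw [mul_comm]
    exact mul_le_mul_of_nonneg_right h2 (by positivity)
  refine (Finset.prod_le_prod (fun i _ => abs_nonneg _) hfac).trans ?_
  rw [Finset.prod_const]
  refine pow_le_pow_right₀ hk' ?_
  refine (Finset.card_le_univ _).trans ?_
  simp

section Sobolev

variable {a b : ℝ} {m : ℕ}

/-- The successive derivatives of `g ∈ H^m`, with continuous representatives below order `n`. -/
noncomputable def derivChain (g : Sobolev a b m) (n i : ℕ) : ℝ → ℝ :=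
  if i < n then contRep (wderiv g i) else wderiv g i

theorem isPrimitive_derivChain (hab : a < b) (g : Sobolev a b m) {n : ℕ} (hn : n ≤ m) :
    ∀ i < n, IsPrimitive a b (derivChain g n i) (derivChain g n (i + 1)) := by
  intro i hi
  rw [derivChain, derivChain, if_pos hi]
  split_ifs with h
  · exact isPrimitive_contRep_contRep hab g (by omega)
  · exact isPrimitive_contRep hab g (by omega)

theorem derivChain_self (g : Sobolev a b m) (n : ℕ) : derivChain g n n = wderiv g n :=
  if_neg (lt_irrefl n)

theorem derivChain_of_lt (g : Sobolev a b m) {n i : ℕ} (h : i < n) :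
    derivChain g n i = contRep (wderiv g i) := if_pos h

theorem intervalIntegrable_derivChain_sq (hab : a < b) (g : Sobolev a b m) (n : ℕ) :
    IntervalIntegrable (fun x => derivChain g n n x ^ 2) volume a b := by
  rw [derivChain_self]
  exact L2.intervalIntegrable_sq hab.le _

theorem integral_derivChain_sq_le (hab : a < b) (g : Sobolev a b m) (n : ℕ) :
    ∫ x in a..b, derivChain g n n x ^ 2 ≤ ‖g‖ ^ 2 := by
  rw [derivChain_self, ← setIntegral_Ioo_eq hab.le (fun x => wderiv g n x ^ 2), ← L2.norm_sq]
  exact pow_le_pow_left₀ (norm_nonneg _) (norm_wderiv_le g n) 2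

theorem integral_contRep_sq (hab : a < b) (hm : 0 < m) (g : Sobolev a b m) :
    ∫ x in a..b, contRep (wderiv g 0) x ^ 2 = ‖wderiv g 0‖ ^ 2 := by
  rw [L2.norm_sq, ← setIntegral_Ioo_eq hab.le]
  refine integral_congr_ae ?_
  filter_upwards [wderiv_ae_eq_contRep hab g hm] with x hx
  simp only [hx]

theorem contRep_nonneg (hab : a < b) (hm : 0 < m) (g : Sobolev a b m)
    (h : ∀ᵐ x ∂(volume.restrict (Ioo a b)), 0 ≤ wderiv g 0 x) {x : ℝ} (hx : x ∈ Icc a b) :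
    0 ≤ contRep (wderiv g 0) x := by
  have hc := continuousOn_contRep hab g hm
  have h1 : EqOn (contRep (wderiv g 0)) (fun x => max (contRep (wderiv g 0) x) 0) (Icc a b) := by
    refine eqOn_Icc_of_ae_eq hab hc (hc.sup continuousOn_const) ?_
    filter_upwards [h, wderiv_ae_eq_contRep hab g hm] with y h1 h2
    rw [max_eq_left]
    rw [← h2]; exact h1
  rw [h1 hx]
  exact le_max_right _ _

end Sobolev

theorem normL2_sq {a b : ℝ} (hab : a < b) {v w : ℝ → ℝ} (hw : ContinuousOn w (Icc a b))
    (h : v =ᵐ[volume.restrict (Ioo a b)] w) :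
    normL2 a b v ^ 2 = ∫ x in a..b, w x ^ 2 := by
  have hmeas : AEStronglyMeasurable w (volume.restrict (Ioo a b)) :=
    (hw.mono Ioo_subset_Icc_self).aestronglyMeasurable measurableSet_Ioo
  have hmem : MemLp w 2 (volume.restrict (Ioo a b)) := by
    rw [memLp_two_iff_integrable_sq hmeas]
    exact ((hw.pow 2).integrableOn_Icc).mono_set Ioo_subset_Icc_self
  have h1 := L2.norm_sq (hmem.toLp w)
  rw [Lp.norm_toLp] at h1
  rw [normL2, eLpNorm_congr_ae h, h1, ← setIntegral_Ioo_eq hab.le]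
  refine integral_congr_ae ?_
  filter_upwards [hmem.coeFn_toLp] with x hx
  rw [hx]

/-! ### The exact solution and the extrapolated source -/

section Solution

variable {a b T : ℝ} {m : ℕ}

/-- Point values of a curve in `H^m` that is differentiable in time. -/
theorem hasDerivWithinAt_contRep (hab : a < b) (hm : 0 < m) {u : ℝ → Sobolev a b m}
    (hu : ContDiffOn ℝ 1 u (Icc 0 T)) {t : ℝ} (ht : t ∈ Icc 0 T) {x : ℝ} (hx : x ∈ Icc a b) :
    HasDerivWithinAt (fun s => contRep (wderiv (u s) 0) x)
      (contRep (wderiv (derivWithin u (Icc 0 T) t) 0) x) (Icc 0 T) t := by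
  have h1 := (hu.differentiableOn (by simp) t ht).hasDerivWithinAt
  exact (evalCLM hab hm hx).hasFDerivAt.comp_hasDerivWithinAt t h1

/-- For a solution `u` of the heat equation, `uₓₓ = uₜ - f` has a continuous representative. -/
theorem isPrimitive_contRep_heat (hab : a < b) (hm : 1 < m) {u f : ℝ → Sobolev a b m}
    (hsol : IsNeumannHeatSolution a b T u f) {t : ℝ} (ht : t ∈ Ioc 0 T) :
    IsPrimitive a b (contRep (wderiv (u t) 1))
      (contRep (wderiv (derivWithin u (Icc 0 T) t - f t) 0)) := by
  have h1 : wderiv (derivWithin u (Icc 0 T) t - f t) 0 = wderiv (u t) 2 := by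
    have h2 := (wderivₗ a b m 0).map_sub (derivWithin u (Icc 0 T) t) (f t)
    have h3 := (hsol t ht).1
    simp only [wderivₗ, LinearMap.coe_mk, AddHom.coe_mk] at h2
    rw [h2, ← h3]
    abel
  have h2 := isPrimitive_contRep hab (u t) hm
  rw [← h1] at h2
  exact h2.congr_right hab.le (wderiv_ae_eq_contRep hab _ (by omega))

/-- The maximum principle for the solution. -/
theorem le_contRep_of_heat (hab : a < b) (hm : 1 < m) {u f : ℝ → Sobolev a b m}
    (hu : ContDiffOn ℝ 1 u (Icc 0 T)) (hsol : IsNeumannHeatSolution a b T u f)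
    (hf0 : ∀ t ∈ Icc 0 T, ∀ᵐ x ∂(volume.restrict (Ioo a b)), 0 ≤ wderiv (f t) 0 x)
    {μ : ℝ} (hμ : ∀ x ∈ Icc a b, μ ≤ contRep (wderiv (u 0) 0) x) :
    ∀ t ∈ Icc 0 T, ∀ x ∈ Icc a b, μ ≤ contRep (wderiv (u t) 0) x := by
  have hm0 : 0 < m := by omega
  refine le_of_heat_supersolution hab
    (U := fun t => contRep (wderiv (u t) 0)) (Ux := fun t => contRep (wderiv (u t) 1))
    (Uxx := fun t => contRep (wderiv (derivWithin u (Icc 0 T) t - f t) 0))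
    (Ut := fun t => contRep (wderiv (derivWithin u (Icc 0 T) t) 0))
    ?_ ?_ ?_ ?_ ?_ ?_ ?_ ?_ hμ
  · -- Joint continuity: the evaluation functionals are equicontinuous.
    rintro ⟨t₀, x₀⟩ ⟨ht₀, hx₀⟩
    simp only at ht₀ hx₀
    set C := 1 / √(b - a) + √(b - a)
    have h1 : Filter.Tendsto (fun p : ℝ × ℝ => C * ‖u p.1 - u t₀‖ +
        |contRep (wderiv (u t₀) 0) p.2 - contRep (wderiv (u t₀) 0) x₀|)
        (nhdsWithin (t₀, x₀) (Icc 0 T ×ˢ Icc a b)) (nhds 0) := by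
      have e1 : ContinuousWithinAt (fun p : ℝ × ℝ => u p.1) (Icc 0 T ×ˢ Icc a b) (t₀, x₀) :=
        (hu.continuousOn t₀ ht₀).comp continuousWithinAt_fst fun p hp => hp.1
      have e2 : ContinuousWithinAt (fun p : ℝ × ℝ => contRep (wderiv (u t₀) 0) p.2)
          (Icc 0 T ×ˢ Icc a b) (t₀, x₀) :=
        (continuousOn_contRep hab (u t₀) hm0 x₀ hx₀).comp continuousWithinAt_snd fun p hp => hp.2
      have e3 : ContinuousWithinAt (fun p : ℝ × ℝ => C * ‖u p.1 - u t₀‖ +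
          |contRep (wderiv (u t₀) 0) p.2 - contRep (wderiv (u t₀) 0) x₀|)
          (Icc 0 T ×ˢ Icc a b) (t₀, x₀) :=
        (continuousWithinAt_const.mul (e1.sub continuousWithinAt_const).norm).add
          (e2.sub continuousWithinAt_const).abs
      simpa [ContinuousWithinAt] using e3
    refine tendsto_iff_dist_tendsto_zero.2 (squeeze_zero' (Filter.Eventually.of_forall
      fun _ => dist_nonneg) ?_ h1)
    filter_upwards [self_mem_nhdsWithin] with p hp
    rw [Real.dist_eq]
    have h2 := abs_contRep_le hab (u p.1 - u t₀) hm0 hp.2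
    rw [contRep_sub hab _ _ hm0 hp.2] at h2
    have h3 := abs_add_le (contRep (wderiv (u p.1) 0) p.2 - contRep (wderiv (u t₀) 0) p.2)
      (contRep (wderiv (u t₀) 0) p.2 - contRep (wderiv (u t₀) 0) x₀)
    rw [sub_add_sub_cancel] at h3
    linarith
  · exact fun t ht x hx => hasDerivWithinAt_contRep hab hm0 hu ⟨ht.1.le, ht.2⟩ hx
  · exact fun t _ => isPrimitive_contRep_contRep hab (u t) hm
  · exact fun t ht => isPrimitive_contRep_heat hab hm hsol ht
  · exact fun t _ => continuousOn_contRep hab _ hm0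
  · exact fun t ht => (hsol t ht).2.1
  · exact fun t ht => (hsol t ht).2.2
  · intro t ht x hx
    rw [contRep_sub hab _ _ hm0 hx]
    have := contRep_nonneg hab hm0 (f t) (hf0 t ⟨ht.1.le, ht.2⟩) hx
    linarith

end Solution

section Extrapolation

variable {a b : ℝ} {m : ℕ}

/-- The extrapolation error `F(s) - ∑_j L_j(s) F(t_{n-j})` as an element of `H^m`. -/
noncomputable def extrapError (τ : ℝ) (k n : ℕ) (F : ℝ → Sobolev a b m) (s : ℝ) : Sobolev a b m :=
  F s - ∑ j : Fin k,
    (Lagrange.basis Finset.univ (fun i : Fin k => ((n : ℝ) - (i + 1)) * τ) j).eval s •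
      F (((n : ℝ) - (j + 1)) * τ)

/-- Nodal evaluation commutes with the extrapolation in time, being linear on `H^m`. -/
theorem nodalVec_extrapError (hab : a < b) (hm : 0 < m) {M r : ℕ} (hM : 1 ≤ M) (hr : 1 ≤ r)
    (τ : ℝ) (k n : ℕ) (F : ℝ → Sobolev a b m) (s : ℝ) :
    nodalVec a b M r (contRep (wderiv (extrapError τ k n F s) 0))
      = nodalVec a b M r (contRep (wderiv (F s) 0)) - extrapolation a b τ M r k n F s := by
  funext i
  have hx := node_mem hab hM hr (Nat.le_of_lt_succ i.is_lt)
  have h1 : contRep (wderiv (extrapError τ k n F s) 0) (node a b M r i)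
    = evalCLM hab hm hx (extrapError τ k n F s) := rfl
  rw [nodalVec, h1, extrapError, map_sub, map_sum]
  simp only [map_smul, evalCLM_apply, Pi.sub_apply, extrapolation, Finset.sum_apply, Pi.smul_apply,
    nodalVec]

theorem continuous_extrapolation (τ : ℝ) (M r k n : ℕ) (F : ℝ → Sobolev a b m) :
    Continuous (extrapolation a b τ M r k n F) := by
  unfold extrapolation
  exact continuous_finsetSum _ fun j _ => (Polynomial.continuous _).smul continuous_const

variable {T τ : ℝ} {k n : ℕ} (hk : 1 ≤ k) (hT : 0 < T) (hτ : 0 < τ) (hτT : τ ≤ T) (hn : 1 ≤ n)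
  (hnT : n * τ ≤ T)
include hk hτ hτT hn

/-- The oldest time level `t_{n-k}` of the extrapolation lies in `[-(k - 1) T, T]`, the interval on
which the source is given. -/
theorem le_base_point : -(((k : ℝ) - 1) * T) ≤ ((n : ℝ) - k) * τ := by
  have h1 : (1 : ℝ) ≤ n := by exact_mod_cast hn
  have h2 : (1 : ℝ) ≤ k := by exact_mod_cast hk
  nlinarith

include hnT

theorem time_point_mem (j : Fin k) :
    ((n : ℝ) - (j + 1)) * τ ∈ Icc (((n : ℝ) - k) * τ) (((n : ℝ) - k) * τ + k * τ) ∧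
      ((n : ℝ) - (j + 1)) * τ ∈ Icc (-(((k : ℝ) - 1) * T)) T := by
  have h1 : ((j : ℕ) : ℝ) + 1 ≤ k := by exact_mod_cast j.is_lt
  have h2 : (0 : ℝ) ≤ ((j : ℕ) : ℝ) := Nat.cast_nonneg _
  have h3 := le_base_point hk hτ hτT hn
  have h4 : ((n : ℝ) - k) * τ ≤ ((n : ℝ) - (j + 1)) * τ := by nlinarith
  refine ⟨⟨h4, by nlinarith⟩, h3.trans h4, by nlinarith⟩

include hT

/-- The extrapolation error is of order `τ^k` in `L²`. -/
theorem norm_wderiv_extrapError_le {F : ℝ → Sobolev a b m} {C : ℝ}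
    (hF : ContDiffOn ℝ k (fun t => wderiv (F t) 0) (Icc (-(((k : ℝ) - 1) * T)) T))
    (hC : ∀ t ∈ Icc (-(((k : ℝ) - 1) * T)) T, ‖iteratedDerivWithin k (fun t => wderiv (F t) 0)
      (Icc (-(((k : ℝ) - 1) * T)) T) t‖ ≤ C) {s : ℝ} (hs : s ∈ Icc (((n : ℝ) - 1) * τ) (n * τ)) :
    ‖wderiv (extrapError τ k n F s) 0‖ ≤ (1 + k * (k : ℝ) ^ k) * (C * (k * τ) ^ k) := by
  have hk' : (1 : ℝ) ≤ k := by exact_mod_cast hk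
  have h0 : wderiv (extrapError τ k n F s) 0 = wderiv (F s) 0 - ∑ j : Fin k,
      (Lagrange.basis Finset.univ (fun i : Fin k => ((n : ℝ) - (i + 1)) * τ) j).eval s •
      wderiv (F (((n : ℝ) - (j + 1)) * τ)) 0 := by
    have h1 : wderiv (extrapError τ k n F s) 0 = wderivₗ a b m 0 (extrapError τ k n F s) := rfl
    rw [h1, extrapError, map_sub, map_sum]
    simp only [map_smul]
    rfl
  rw [h0]
  refine norm_sub_lagrange_le (g := fun t => wderiv (F t) 0) (x₀ := ((n : ℝ) - k) * τ)
    hk (by nlinarith) hF hC ?_ (le_base_point hk hτ hτT hn)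
    (fun j => (time_point_mem hk hτ hτT hn hnT j).1)
    (fun j => (time_point_mem hk hτ hτT hn hnT j).2.2) ?_ (hs.2.trans hnT)
    (fun j => abs_basis_equidistant_le hτ hs j)
  · intro i j hij
    have h1 := mul_right_cancel₀ hτ.ne' hij
    have h2 : ((i : ℕ) : ℝ) = (j : ℕ) := by linarith
    exact Fin.ext (by exact_mod_cast h2)
  · exact ⟨by nlinarith [hs.1], by nlinarith [hs.2]⟩

omit hT in
/-- The extrapolation error is bounded in `H^m`; together with the `L²`-bound this controls its nodal
values. -/
theorem norm_extrapError_le {F : ℝ → Sobolev a b m} {R : ℝ}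
    (hR : ∀ t ∈ Icc (-(((k : ℝ) - 1) * T)) T, ‖F t‖ ≤ R) {s : ℝ}
    (hs : s ∈ Icc (((n : ℝ) - 1) * τ) (n * τ)) :
    ‖extrapError τ k n F s‖ ≤ (1 + k * (k : ℝ) ^ k) * R := by
  have hk' : (1 : ℝ) ≤ k := by exact_mod_cast hk
  have hsI : s ∈ Icc (-(((k : ℝ) - 1) * T)) T :=
    ⟨(le_base_point hk hτ hτT hn).trans (by nlinarith [hs.1]), hs.2.trans hnT⟩
  have h1 : ‖∑ j : Fin k,
      (Lagrange.basis Finset.univ (fun i : Fin k => ((n : ℝ) - (i + 1)) * τ) j).eval s •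
      F (((n : ℝ) - (j + 1)) * τ)‖ ≤ ∑ _j : Fin k, (k : ℝ) ^ k * R := by
    refine norm_sum_le_of_le _ fun j _ => ?_
    rw [norm_smul, Real.norm_eq_abs]
    exact mul_le_mul (abs_basis_equidistant_le hτ hs j)
      (hR _ (time_point_mem hk hτ hτT hn hnT j).2) (norm_nonneg _) (by positivity)
  rw [Finset.sum_const, Finset.card_univ, Fintype.card_fin, nsmul_eq_mul] at h1
  refine (norm_sub_le _ _).trans ((add_le_add (hR s hsI) h1).trans (le_of_eq (by ring)))

end Extrapolation

/-! ### Propagation of the nodal error -/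

section Lump

variable {a b : ℝ} {M r : ℕ}

theorem lumpForm_add_left (U U' V : Fin (M * r + 1) → ℝ) :
    lumpForm a b (U + U') V = lumpForm a b U V + lumpForm a b U' V := by
  simp only [lumpForm, ← Finset.sum_add_distrib]
  exact Finset.sum_congr rfl fun _ _ => by simp only [Pi.add_apply]; ring

theorem lumpForm_sub_left (U U' V : Fin (M * r + 1) → ℝ) :
    lumpForm a b (U - U') V = lumpForm a b U V - lumpForm a b U' V := by
  simp only [lumpForm, ← Finset.sum_sub_distrib]
  exact Finset.sum_congr rfl fun _ _ => by simp only [Pi.sub_apply]; ring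

theorem lumpForm_le_half (hab : a < b) (hM : 1 ≤ M) (hr : 1 ≤ r) (U V : Fin (M * r + 1) → ℝ) :
    2 * lumpForm a b U V ≤ lumpForm a b U U + lumpForm a b V V := by
  simp only [lumpForm, ← Finset.sum_add_distrib, Finset.mul_sum]
  refine Finset.sum_le_sum fun m _ => ?_
  have h := mul_nonneg (nodeWeight_pos hab hM hr m).le (sq_nonneg (U m - V m))
  nlinarith

theorem stiffForm_sub_left (U U' V : Fin (M * r + 1) → ℝ) :
    stiffForm a b (U - U') V = stiffForm a b U V - stiffForm a b U' V := by
  simp only [stiffForm, ← Finset.sum_sub_distrib]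
  refine Finset.sum_congr rfl fun e _ => ?_
  rw [← intervalIntegral.integral_sub]
  · congr 1
    funext x
    have h : elemPoly a b (U - U') e = elemPoly a b U e - elemPoly a b U' e :=
      elemInterp_sub _ _ _ _ _
    rw [h, Polynomial.derivative_sub, Polynomial.eval_sub, sub_mul]
  all_goals exact ((Polynomial.continuous _).mul (Polynomial.continuous _)).intervalIntegrable _ _

theorem stiffForm_self_nonneg (hab : a < b) (hM : 1 ≤ M) (V : Fin (M * r + 1) → ℝ) :
    0 ≤ stiffForm a b V V := by
  have hh := meshSize_pos hab hM
  exact Finset.sum_nonneg fun e _ => intervalIntegral.integral_nonneg (by linarith)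
    fun x _ => mul_self_nonneg _

theorem hasDerivAt_lumpForm_self {e : ℝ → Fin (M * r + 1) → ℝ} {e' : Fin (M * r + 1) → ℝ} {s : ℝ}
    (he : ∀ m, HasDerivAt (fun t => e t m) (e' m) s) :
    HasDerivAt (fun t => lumpForm a b (e t) (e t)) (2 * lumpForm a b e' (e s)) s := by
  have h := HasDerivAt.fun_sum (u := Finset.univ) fun m _ =>
    ((he m).const_mul (nodeWeight a b M r m)).mul (he m)
  refine h.congr_deriv ?_
  rw [lumpForm, Finset.mul_sum]
  exact Finset.sum_congr rfl fun m _ => by ring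

end Lump

theorem expStep_eq_duhamel (a b τ : ℝ) (M r k n : ℕ) {m : ℕ} (F : ℝ → Sobolev a b m)
    (z : Fin (M * r + 1) → ℝ) :
    expStep a b τ M r k n F z
      = duhamel ((massMatrix a b M r)⁻¹ * stiffMatrix a b M r) (((n : ℝ) - 1) * τ) z
          (extrapolation a b τ M r k n F) (n * τ) := by
  rw [expStep, duhamel, show (n : ℝ) * τ - ((n : ℝ) - 1) * τ = τ by ring]

/-- The propagation of the error, measured in the lumped norm, over one time step before the
cut-off. The nodal error `e` against the semidiscrete solution started from `z` solves an ordinary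
differential equation; testing it with `e` in the lumped inner product and bounding the consistency
and extrapolation errors gives a differential inequality for the squared norm of `e`. -/
theorem error_step {a b T τ K R C : ℝ} (hab : a < b) (hT : 0 < T) {M r k n : ℕ} (hM : 1 ≤ M)
    (hr : 1 ≤ r) (hk : 1 ≤ k) (hK : RefBound r K) (hτ : 0 < τ) (hτT : τ ≤ T) (hn : 1 ≤ n)
    (hnT : n * τ ≤ T) {u f F : ℝ → Sobolev a b (2 * r)} (hu : ContDiffOn ℝ 1 u (Icc 0 T))
    (hsol : IsNeumannHeatSolution a b T u f) (hFf : EqOn F f (Icc 0 T))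
    (hFk : ContDiffOn ℝ k (fun t => wderiv (F t) 0) (Icc (-(((k : ℝ) - 1) * T)) T))
    (hC : ∀ t ∈ Icc (-(((k : ℝ) - 1) * T)) T, ‖iteratedDerivWithin k (fun t => wderiv (F t) 0)
      (Icc (-(((k : ℝ) - 1) * T)) T) t‖ ≤ C)
    (hFR : ∀ t ∈ Icc (-(((k : ℝ) - 1) * T)) T, ‖F t‖ ≤ R)
    (huR : ∀ t ∈ Icc 0 T, ‖u t‖ ≤ R) (hdR : ∀ t ∈ Icc 0 T, ‖derivWithin u (Icc 0 T) t‖ ≤ R)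
    {D : ℝ}
    (hD : D = 2 * meshSize a b M ^ (2 * r) *
          (K ^ 2 * (2 * R) ^ 2 + (1 + 2 * K * (r + 1)) ^ 2 / 2 * R ^ 2)
        + 4 * K ^ 2 * (((1 + k * (k : ℝ) ^ k) * (C * (k * τ) ^ k)) ^ 2
          + (1 + K * (r + 1)) ^ 2 *
            (meshSize a b M ^ (2 * r) * ((1 + k * (k : ℝ) ^ k) * R) ^ 2)))
    (z : Fin (M * r + 1) → ℝ) :
    lumpForm a b (nodalVec a b M r (contRep (wderiv (u (n * τ)) 0)) - expStep a b τ M r k n F z)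
        (nodalVec a b M r (contRep (wderiv (u (n * τ)) 0)) - expStep a b τ M r k n F z)
      ≤ Real.exp ((4 * K * (r + 1) + 1) * τ) *
        (lumpForm a b (nodalVec a b M r (contRep (wderiv (u (((n : ℝ) - 1) * τ)) 0)) - z)
          (nodalVec a b M r (contRep (wderiv (u (((n : ℝ) - 1) * τ)) 0)) - z) + D * τ) := by
  have hm1 : 1 < 2 * r := by omega
  have hm0 : 0 < 2 * r := by omega
  have hK1 := hK.one_le
  have hh := meshSize_pos hab hM
  have hn1 : (1 : ℝ) ≤ n := by exact_mod_cast hn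
  set s₀ := ((n : ℝ) - 1) * τ with hs₀
  have hs₀0 : 0 ≤ s₀ := mul_nonneg (by linarith) hτ.le
  have hs01 : n * τ - s₀ = τ := by rw [hs₀]; ring
  set h := meshSize a b M with hhdef
  set B := (massMatrix a b M r)⁻¹ * stiffMatrix a b M r with hB
  set Φ := extrapolation a b τ M r k n F with hΦ
  set y := duhamel B s₀ z Φ with hy
  set U : ℝ → Fin (M * r + 1) → ℝ := fun s => nodalVec a b M r (contRep (wderiv (u s) 0)) with hU
  set e : ℝ → Fin (M * r + 1) → ℝ := fun s => U s - y s with he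
  have hyd := hasDerivAt_duhamel B s₀ z (continuous_extrapolation (a := a) (b := b) τ M r k n F)
  rw [← hΦ, ← hy] at hyd
  have hnode : ∀ i : Fin (M * r + 1), node a b M r i ∈ Icc a b := fun i =>
    node_mem hab hM hr (Nat.le_of_lt_succ i.is_lt)
  set du : ℝ → Sobolev a b (2 * r) := fun s => derivWithin u (Icc 0 T) s with hdu
  set e' : ℝ → Fin (M * r + 1) → ℝ := fun s =>
    nodalVec a b M r (contRep (wderiv (du s) 0)) - (B *ᵥ y s + Φ s) with he'
  have hsub : Ioo s₀ (n * τ) ⊆ Ioo 0 T := Ioo_subset_Ioo hs₀0 hnT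
  have hderiv : ∀ s ∈ Ioo s₀ (n * τ), ∀ i, HasDerivAt (fun t => e t i) (e' s i) s := by
    intro s hs i
    have hsT := hsub hs
    have h1 := (hasDerivWithinAt_contRep hab hm0 hu (Ioo_subset_Icc_self hsT)
      (hnode i)).hasDerivAt (Icc_mem_nhds hsT.1 hsT.2)
    exact h1.sub (hasDerivAt_pi.1 (hyd s) i)
  have hcont : ContinuousOn (fun s => lumpForm a b (e s) (e s)) (Icc s₀ (n * τ)) := by
    have hei : ∀ i, ContinuousOn (fun t => e t i) (Icc s₀ (n * τ)) := by
      intro i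
      have h1 : ContinuousOn (fun t => U t i) (Icc s₀ (n * τ)) := fun t ht =>
        ((hasDerivWithinAt_contRep hab hm0 hu (Icc_subset_Icc hs₀0 hnT ht)
          (hnode i)).continuousWithinAt).mono (Icc_subset_Icc hs₀0 hnT)
      have h2 : Continuous fun t => y t i :=
        continuous_iff_continuousAt.2 fun t => (hasDerivAt_pi.1 (hyd t) i).continuousAt
      exact h1.sub h2.continuousOn
    exact continuousOn_finsetSum _ fun i _ => (continuousOn_const.mul (hei i)).mul (hei i)
  -- The energy estimate.
  have henergy : ∀ s ∈ Ioo s₀ (n * τ), 2 * lumpForm a b (e' s) (e s)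
      ≤ (4 * K * (r + 1) + 1) * lumpForm a b (e s) (e s) + D := by
    intro s hs
    have hsT := hsub hs
    have hsT' : s ∈ Icc 0 T := Ioo_subset_Icc_self hsT
    have hsIoc : s ∈ Ioc 0 T := ⟨hsT.1, hsT.2.le⟩
    have hsn : s ∈ Icc (((n : ℝ) - 1) * τ) (n * τ) := Ioo_subset_Icc_self hs
    have hR0 : 0 ≤ R := (norm_nonneg _).trans (huR s hsT')
    set g := du s - f s with hg
    have hgR : ‖g‖ ≤ 2 * R := by
      refine (norm_sub_le _ _).trans ?_
      have h1 := hdR s hsT'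
      have h2 : ‖f s‖ ≤ R := by
        rw [← hFf hsT']
        refine hFR s ⟨?_, hsT.2.le⟩
        have : (1 : ℝ) ≤ k := by exact_mod_cast hk
        have : 0 ≤ ((k : ℝ) - 1) * T := mul_nonneg (by linarith) hT.le
        linarith [hsT.1]
      simp only [hdu]
      linarith
    set d := extrapError τ k n F s with hd
    have hdecomp : e' s = nodalVec a b M r (contRep (wderiv g 0))
        + nodalVec a b M r (contRep (wderiv d 0)) - B *ᵥ y s := by
      rw [he', hd, nodalVec_extrapError hab hm0 hM hr, hFf hsT']
      funext i
      have h1 := contRep_sub hab (du s) (f s) hm0 (hnode i)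
      simp only [Pi.sub_apply, Pi.add_apply, nodalVec, hg, h1]
      ring
    have hcons := consistency_le hab hM hr hK (G := derivChain (u s) (r + 1)) (H := derivChain g r)
      (isPrimitive_derivChain hab (u s) (by omega)) (intervalIntegrable_derivChain_sq hab (u s) _)
      (isPrimitive_derivChain hab g (by omega)) (intervalIntegrable_derivChain_sq hab g _)
      (by
        rw [derivChain_of_lt _ (by omega), derivChain_of_lt _ (by omega)]
        exact isPrimitive_contRep_heat hab hm1 hsol hsIoc)
      (by rw [derivChain_of_lt _ (by omega)]; exact (hsol s hsIoc).2.1)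
      (by rw [derivChain_of_lt _ (by omega)]; exact (hsol s hsIoc).2.2) (e s)
    rw [derivChain_of_lt _ (by omega), derivChain_of_lt _ (by omega), ← hhdef] at hcons
    have hQ1 : ∫ x in a..b, derivChain g r r x ^ 2 ≤ (2 * R) ^ 2 :=
      (integral_derivChain_sq_le hab g r).trans (pow_le_pow_left₀ (norm_nonneg _) hgR 2)
    have hQ2 : ∫ x in a..b, derivChain (u s) (r + 1) (r + 1) x ^ 2 ≤ R ^ 2 :=
      (integral_derivChain_sq_le hab (u s) (r + 1)).trans
        (pow_le_pow_left₀ (norm_nonneg _) (huR s hsT') 2)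
    have hQ : h ^ (2 * r) * (K ^ 2 * (∫ x in a..b, derivChain g r r x ^ 2)
          + (1 + 2 * K * (r + 1)) ^ 2 / 2 * ∫ x in a..b, derivChain (u s) (r + 1) (r + 1) x ^ 2)
        ≤ h ^ (2 * r) * (K ^ 2 * (2 * R) ^ 2 + (1 + 2 * K * (r + 1)) ^ 2 / 2 * R ^ 2) := by
      gcongr
    -- The extrapolation error.
    have hdn : lumpForm a b (nodalVec a b M r (contRep (wderiv d 0)))
        (nodalVec a b M r (contRep (wderiv d 0)))
        ≤ 4 * K ^ 2 * (((1 + k * (k : ℝ) ^ k) * (C * (k * τ) ^ k)) ^ 2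
          + (1 + K * (r + 1)) ^ 2 * (h ^ (2 * r) * ((1 + k * (k : ℝ) ^ k) * R) ^ 2)) := by
      have h1 := integral_sq_sub_interp_le hab hM hr hK (H := derivChain d r)
        (isPrimitive_derivChain hab d (by omega)) (intervalIntegrable_derivChain_sq hab d _)
      rw [derivChain_of_lt _ (by omega)] at h1
      have h2 := lumpForm_nodalVec_le hab hM hK (continuousOn_contRep hab d hm0) h1
      rw [integral_contRep_sq hab hm0] at h2
      refine h2.trans ?_
      have h3 := norm_wderiv_extrapError_le hk hT hτ hτT hn hnT hFk hC hsn
      have h4 := norm_extrapError_le hk hτ hτT hn hnT hFR hsn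
      have h5 : ∫ x in a..b, derivChain d r r x ^ 2 ≤ ((1 + k * (k : ℝ) ^ k) * R) ^ 2 :=
        (integral_derivChain_sq_le hab d r).trans (pow_le_pow_left₀ (norm_nonneg _) h4 2)
      have h6 := pow_le_pow_left₀ (norm_nonneg _) h3 2
      gcongr
    have hdl := lumpForm_le_half hab hM hr (nodalVec a b M r (contRep (wderiv d 0))) (e s)
    have hlap := lumpForm_laplace hab hM hr (y s) (e s)
    rw [← hB] at hlap
    have hst : stiffForm a b (U s) (e s) - stiffForm a b (y s) (e s) = stiffForm a b (e s) (e s) :=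
      (stiffForm_sub_left (U s) (y s) (e s)).symm
    have hpos := stiffForm_self_nonneg hab hM (e s)
    rw [hdecomp, lumpForm_sub_left, lumpForm_add_left, hlap, hD]
    simp only [hU] at hst
    linarith
  have hstep := gronwall_step (s₀ := s₀) (s₁ := n * τ) (A := 4 * K * (r + 1) + 1) (D := D)
    (by linarith) (by positivity) (by rw [hD]; positivity) hcont
    (fun s hs => hasDerivAt_lumpForm_self (hderiv s hs)) henergy
  rw [hs01] at hstep
  have hy0 : y s₀ = z := duhamel_self _ _ _ _
  simp only [he, hy0] at hstep
  rw [expStep_eq_duhamel]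
  exact hstep

/-- The cut-off does not increase the error, as the exact solution lies above the threshold. -/
theorem lumpForm_cutoff_le {a b : ℝ} (hab : a < b) {M r : ℕ} (hM : 1 ≤ M) (hr : 1 ≤ r) {μ : ℝ}
    {U V W : Fin (M * r + 1) → ℝ} (hU : ∀ i, μ ≤ U i) (hW : ∀ i, W i = max (V i) μ) :
    lumpForm a b (U - W) (U - W) ≤ lumpForm a b (U - V) (U - V) := by
  refine Finset.sum_le_sum fun i _ => ?_
  rw [mul_assoc, mul_assoc]
  refine mul_le_mul_of_nonneg_left ?_ (nodeWeight_pos hab hM hr i).le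
  simp only [Pi.sub_apply, hW]
  rw [← sq, ← sq]
  refine sq_le_sq.2 ?_
  have h1 := abs_max_sub_max_le_abs (U i) (V i) μ
  rwa [max_eq_left (hU i)] at h1

section L2Estimates

variable {a b : ℝ} {M r : ℕ} (hab : a < b) (hM : 1 ≤ M) (hr : 1 ≤ r)
include hab hM hr

/-- The `L²`-error in terms of the lumped norm of the nodal error. -/
theorem normL2_sq_le {K : ℝ} (hK : RefBound r K) (g : Sobolev a b (2 * r)) {v : ℝ → ℝ}
    (hv : v ∈ feSpace a b M r) :
    normL2 a b (fun x => wderiv g 0 x - v x) ^ 2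
      ≤ 2 * ((1 + K * (r + 1)) ^ 2 * (meshSize a b M ^ (2 * r) * ‖g‖ ^ 2))
        + 4 * K ^ 3 * (r + 1) *
          lumpForm a b (nodalVec a b M r (contRep (wderiv g 0)) - nodalVec a b M r v)
            (nodalVec a b M r (contRep (wderiv g 0)) - nodalVec a b M r v) := by
  have hm0 : 0 < 2 * r := by omega
  have hh := meshSize_pos hab hM
  have hwc := continuousOn_contRep hab g hm0
  have hI := integral_sq_sub_interp_le hab hM hr hK (H := derivChain g r)
    (isPrimitive_derivChain hab g (by omega)) (intervalIntegrable_derivChain_sq hab g _)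
  rw [derivChain_of_lt _ (by omega)] at hI
  set w := contRep (wderiv g 0) with hw
  set h := meshSize a b M
  set E := nodalVec a b M r w - nodalVec a b M r v with hE
  rw [normL2_sq hab (w := fun x => w x - v x) (hwc.sub hv.1) (by
    filter_upwards [wderiv_ae_eq_contRep hab g hm0] with x hx
    rw [hx])]
  have hint : IntervalIntegrable (fun x => (w x - v x) ^ 2) volume a b := by
    apply ContinuousOn.intervalIntegrable
    rw [uIcc_of_le hab.le]
    exact (hwc.sub hv.1).pow 2
  rw [integral_eq_sum_elem' hab hM hint]
  have hterm : ∀ e ∈ Finset.range M, ∫ x in (a + e * h)..(a + e * h + h), (w x - v x) ^ 2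
      ≤ 2 * (∫ x in (a + e * h)..(a + e * h + h),
          (w x - (elemPoly a b (nodalVec a b M r w) e).eval x) ^ 2)
        + 2 * ∫ x in (a + e * h)..(a + e * h + h), (elemPoly a b E e).eval x ^ 2 := by
    intro e he
    have he' := Finset.mem_range.1 he
    have hle : a + e * h ≤ a + e * h + h := by linarith
    have hwe := hwc.mono (elem_subset hab hM he')
    have hve := hv.1.mono (elem_subset hab hM he')
    set p := elemPoly a b (nodalVec a b M r w) e with hp
    set q := elemPoly a b E e with hq
    have hq' : q = p - elemPoly a b (nodalVec a b M r v) e := elemInterp_sub _ _ _ _ _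
    have hi : ∀ {k : ℝ → ℝ}, ContinuousOn k (Icc (a + e * h) (a + e * h + h)) →
        IntervalIntegrable k volume (a + e * h) (a + e * h + h) := fun hk => by
      apply ContinuousOn.intervalIntegrable; rwa [uIcc_of_le hle]
    have i1 : IntervalIntegrable (fun x => (w x - p.eval x) ^ 2) volume _ _ :=
      hi ((hwe.sub p.continuousOn).pow 2)
    have i2 : IntervalIntegrable (fun x => q.eval x ^ 2) volume _ _ := hi (q.continuousOn.pow 2)
    rw [← intervalIntegral.integral_const_mul, ← intervalIntegral.integral_const_mul,
      ← intervalIntegral.integral_add (i1.const_mul 2) (i2.const_mul 2)]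
    refine intervalIntegral.integral_mono_on hle (hi ((hwe.sub hve).pow 2))
      ((i1.const_mul 2).add (i2.const_mul 2)) fun x hx => ?_
    rw [feSpace_eq_elemPoly hab hM hr hv he' hx, hq', Polynomial.eval_sub]
    nlinarith [sq_nonneg (w x - p.eval x -
      (p.eval x - (elemPoly a b (nodalVec a b M r v) e).eval x))]
  refine (Finset.sum_le_sum hterm).trans ?_
  rw [Finset.sum_add_distrib, ← Finset.mul_sum, ← Finset.mul_sum]
  have hL := sum_integral_sq_elemPoly_le hab hM hr hK E
  have hg := integral_derivChain_sq_le hab g r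
  have h1 : (1 + K * (r + 1)) ^ 2 * (h ^ (2 * r) * ∫ x in a..b, derivChain g r r x ^ 2)
      ≤ (1 + K * (r + 1)) ^ 2 * (h ^ (2 * r) * ‖g‖ ^ 2) := by gcongr
  linarith

/-- The lumped norm of the nodal error in terms of the `L²`-error. -/
theorem lumpForm_le_normL2_sq {K : ℝ} (hK : RefBound r K) (g : Sobolev a b (2 * r)) {v : ℝ → ℝ}
    (hv : v ∈ feSpace a b M r) :
    lumpForm a b (nodalVec a b M r (contRep (wderiv g 0)) - nodalVec a b M r v)
        (nodalVec a b M r (contRep (wderiv g 0)) - nodalVec a b M r v)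
      ≤ 4 * K ^ 2 * (normL2 a b (fun x => wderiv g 0 x - v x) ^ 2
        + (1 + K * (r + 1)) ^ 2 * (meshSize a b M ^ (2 * r) * ‖g‖ ^ 2)) := by
  have hm0 : 0 < 2 * r := by omega
  have hh := meshSize_pos hab hM
  have hwc := continuousOn_contRep hab g hm0
  have hI := integral_sq_sub_interp_le hab hM hr hK (H := derivChain g r)
    (isPrimitive_derivChain hab g (by omega)) (intervalIntegrable_derivChain_sq hab g _)
  rw [derivChain_of_lt _ (by omega)] at hI
  set w := contRep (wderiv g 0) with hw
  set h := meshSize a b M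
  rw [normL2_sq hab (w := fun x => w x - v x) (hwc.sub hv.1) (by
    filter_upwards [wderiv_ae_eq_contRep hab g hm0] with x hx
    rw [hx])]
  have hsub : nodalVec a b M r w - nodalVec a b M r v = nodalVec a b M r (fun x => w x - v x) := rfl
  rw [hsub]
  refine lumpForm_nodalVec_le hab hM hK (hwc.sub hv.1) ?_
  have hg := integral_derivChain_sq_le hab g r
  have h1 : (1 + K * (r + 1)) ^ 2 * (h ^ (2 * r) * ∫ x in a..b, derivChain g r r x ^ 2)
      ≤ (1 + K * (r + 1)) ^ 2 * (h ^ (2 * r) * ‖g‖ ^ 2) := by gcongr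
  refine le_trans (le_of_eq ?_) (hI.trans h1)
  refine Finset.sum_congr rfl fun e he => ?_
  have he' := Finset.mem_range.1 he
  refine intervalIntegral.integral_congr fun x hx => ?_
  rw [uIcc_of_le (by linarith)] at hx
  have hq : elemPoly a b (nodalVec a b M r (fun x => w x - v x)) e
      = elemPoly a b (nodalVec a b M r w) e - elemPoly a b (nodalVec a b M r v) e :=
    elemInterp_sub _ _ _ _ _
  rw [Pi.sub_apply, hq, Polynomial.eval_sub, feSpace_eq_elemPoly hab hM hr hv he' hx]
  ring

end L2Estimates

/-! ### The error estimate -/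

/-- Passage from squared norms to norms in the final estimate. -/
theorem le_mul_add_mul_of_sq_le {P Q X Y z : ℝ} (hP : 0 ≤ P) (hQ : 0 ≤ Q) (hY : 0 ≤ Y) (hz : 0 ≤ z)
    (h : X ^ 2 ≤ P * z ^ 2 + Q * Y ^ 2) : X ≤ (√(P + Q) + 1) * z + (√(P + Q) + 1) * Y := by
  refine (abs_le_of_sq_le_sq' ?_ (by positivity)).2
  have hs := Real.sq_sqrt (add_nonneg hP hQ)
  have h1 : P + Q ≤ (√(P + Q) + 1) ^ 2 := by nlinarith [Real.sqrt_nonneg (P + Q)]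
  have h2 : z ^ 2 + Y ^ 2 ≤ (z + Y) ^ 2 := by nlinarith [mul_nonneg hz hY]
  calc X ^ 2 ≤ P * z ^ 2 + Q * Y ^ 2 := h
    _ ≤ (P + Q) * (z ^ 2 + Y ^ 2) := by
        nlinarith [mul_nonneg hP (sq_nonneg Y), mul_nonneg hQ (sq_nonneg z)]
    _ ≤ (√(P + Q) + 1) ^ 2 * (z + Y) ^ 2 := by gcongr
    _ = _ := by ring

end ExpCutoff

set_option maxHeartbeats 1000000 in
theorem theorem2p2 (a b T : ℝ) (hab : a < b) (hT : 0 < T) (r k : ℕ) (hr : 1 ≤ r) (hk : 1 ≤ k)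
    (u f : ℝ → Sobolev a b (2 * r))
    -- the regularity of `u` and `f` on `[0, T]`
    (hu : ContDiffOn ℝ 1 u (Icc 0 T))
    (hfk : ContDiffOn ℝ k (fun t => wderiv (f t) 0) (Icc 0 T))
    (hf : ContinuousOn f (Icc 0 T))
    -- the initial-boundary value problem with a nonnegative source
    (hsol : IsNeumannHeatSolution a b T u f)
    (hf0 : ∀ t ∈ Icc 0 T, ∀ᵐ x ∂(volume.restrict (Ioo a b)), 0 ≤ wderiv (f t) 0 x)
    -- `umin` is the minimum of the initial value
    (umin : ℝ) (humin : IsLeast (contRep (wderiv (u 0) 0) '' Icc a b) umin)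
    -- `F` is an extension of `f` to `t ≤ 0` with the same regularity
    (F : ℝ → Sobolev a b (2 * r)) (hFf : EqOn F f (Icc 0 T))
    (hFk : ContDiffOn ℝ k (fun t => wderiv (F t) 0) (Icc (-(((k : ℝ) - 1) * T)) T))
    (hF : ContinuousOn F (Icc (-(((k : ℝ) - 1) * T)) T)) :
    (∀ M N : ℕ, 1 ≤ M → 1 ≤ N → ∀ uh : ℕ → ℝ → ℝ,
      IsCutoffScheme a b (T / N) M r k N F umin uh →
        ∀ n, 1 ≤ n → n ≤ N → ∀ j ≤ M * r, umin ≤ uh n (node a b M r j)) ∧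
    ∃ c : ℝ, 0 < c ∧ ∀ M N : ℕ, 1 ≤ M → 1 ≤ N → ∀ uh : ℕ → ℝ → ℝ,
      IsCutoffScheme a b (T / N) M r k N F umin uh →
        ∀ n, 1 ≤ n → n ≤ N →
          normL2 a b (fun x => wderiv (u (n * (T / N))) 0 x - uh n x)
            ≤ c * ((T / N) ^ k + meshSize a b M ^ r)
              + c * normL2 a b (fun x => wderiv (u 0) 0 x - uh 0 x) := by
  refine ⟨fun M N _ _ uh hs n hn hnN j hj => ?_, ?_⟩
  · have h := hs.step n hn hnN ⟨j, Nat.lt_succ_of_le hj⟩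
    have h1 : umin ≤ nodalVec a b M r (uh n) ⟨j, Nat.lt_succ_of_le hj⟩ := by
      rw [h]; exact le_max_right _ _
    exact h1
  have hk1 : (1 : ℝ) ≤ k := by exact_mod_cast hk
  have hJ : -(((k : ℝ) - 1) * T) < T := by nlinarith
  obtain ⟨K, hK⟩ := exists_refBound hr
  have hK1 := hK.one_le
  -- Uniform bounds for `u`, `∂ₜu`, `F` and the `k`-th time derivative of `F` by compactness.
  obtain ⟨R₁, hR₁⟩ := isCompact_Icc.exists_bound_of_continuousOn hu.continuousOn
  obtain ⟨R₂, hR₂⟩ := isCompact_Icc.exists_bound_of_continuousOn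
    (hu.continuousOn_derivWithin (uniqueDiffOn_Icc hT) le_rfl)
  obtain ⟨R₃, hR₃⟩ := isCompact_Icc.exists_bound_of_continuousOn hF
  obtain ⟨C, hC⟩ := isCompact_Icc.exists_bound_of_continuousOn
    (hFk.continuousOn_iteratedDerivWithin le_rfl (uniqueDiffOn_Icc hJ))
  set R := max R₁ (max R₂ R₃) with hR
  have huR : ∀ t ∈ Icc 0 T, ‖u t‖ ≤ R := fun t ht => (hR₁ t ht).trans (le_max_left _ _)
  have hdR : ∀ t ∈ Icc 0 T, ‖derivWithin u (Icc 0 T) t‖ ≤ R := fun t ht =>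
    (hR₂ t ht).trans ((le_max_left _ _).trans (le_max_right _ _))
  have hFR : ∀ t ∈ Icc (-(((k : ℝ) - 1) * T)) T, ‖F t‖ ≤ R := fun t ht =>
    (hR₃ t ht).trans ((le_max_right _ _).trans (le_max_right _ _))
  have hmax := le_contRep_of_heat hab (by omega) hu hsol hf0
    (fun x hx => humin.2 (mem_image_of_mem _ hx))
  -- `A` is the Gronwall rate and `Dc` the constant of the local error; `P` and `Q` are the factors
  -- of the squared discretization and initial errors in the squared final error.
  set A := 4 * K * (r + 1) + 1 with hA
  have hA0 : 0 ≤ A := by positivity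
  set c₁ := (1 + K * ((r : ℝ) + 1)) ^ 2 with hc₁
  set L := 1 + k * (k : ℝ) ^ k with hL
  set Dc := 2 * (K ^ 2 * (2 * R) ^ 2 + (1 + 2 * K * (r + 1)) ^ 2 / 2 * R ^ 2)
    + 4 * K ^ 2 * ((L * (C * (k : ℝ) ^ k)) ^ 2 + c₁ * (L * R) ^ 2) with hDc
  have hDc0 : 0 ≤ Dc := by positivity
  set P := 2 * (c₁ * R ^ 2) + 4 * K ^ 3 * (r + 1) *
    (Real.exp (A * T) * (4 * K ^ 2 * (c₁ * R ^ 2) + Dc * T)) with hP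
  set Q := 4 * K ^ 3 * (r + 1) * (Real.exp (A * T) * (4 * K ^ 2)) with hQ
  refine ⟨√(P + Q) + 1, by positivity, fun M N hM hN uh hs n hn hnN => ?_⟩
  have hN0 : (0 : ℝ) < N := by exact_mod_cast hN
  have hN1 : (1 : ℝ) ≤ N := by exact_mod_cast hN
  set τ := T / N with hτdef
  have hτ : 0 < τ := div_pos hT hN0
  have hτT : τ ≤ T := div_le_self hT.le hN1
  have hnT : ∀ i ≤ N, (i : ℝ) * τ ≤ T := fun i hi => by
    have h1 : (i : ℝ) ≤ N := by exact_mod_cast hi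
    calc (i : ℝ) * τ ≤ N * τ := by gcongr
      _ = T := by rw [hτdef]; field_simp
  have hh := meshSize_pos hab hM
  set h := meshSize a b M with hhdef
  set z := τ ^ k + h ^ r with hz
  have hz1 : (τ ^ k) ^ 2 ≤ z ^ 2 :=
    pow_le_pow_left₀ (by positivity) (by rw [hz]; linarith [pow_pos hh r]) 2
  have hz2 : h ^ (2 * r) ≤ z ^ 2 := by
    rw [mul_comm 2 r, pow_mul]
    exact pow_le_pow_left₀ (by positivity) (by rw [hz]; linarith [pow_pos hτ k]) 2
  set E : ℕ → ℝ := fun i => lumpForm a b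
    (nodalVec a b M r (contRep (wderiv (u (i * τ)) 0)) - nodalVec a b M r (uh i))
    (nodalVec a b M r (contRep (wderiv (u (i * τ)) 0)) - nodalVec a b M r (uh i)) with hE
  have hDle : 2 * h ^ (2 * r) * (K ^ 2 * (2 * R) ^ 2 + (1 + 2 * K * (r + 1)) ^ 2 / 2 * R ^ 2)
        + 4 * K ^ 2 * ((L * (C * (k * τ) ^ k)) ^ 2 + c₁ * (h ^ (2 * r) * (L * R) ^ 2))
      ≤ Dc * z ^ 2 := by
    calc _ = h ^ (2 * r) * (2 * (K ^ 2 * (2 * R) ^ 2 + (1 + 2 * K * (r + 1)) ^ 2 / 2 * R ^ 2)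
          + 4 * K ^ 2 * (c₁ * (L * R) ^ 2))
          + (τ ^ k) ^ 2 * (4 * K ^ 2 * (L * (C * (k : ℝ) ^ k)) ^ 2) := by
          rw [mul_pow (k : ℝ) τ k]; ring
      _ ≤ z ^ 2 * (2 * (K ^ 2 * (2 * R) ^ 2 + (1 + 2 * K * (r + 1)) ^ 2 / 2 * R ^ 2)
          + 4 * K ^ 2 * (c₁ * (L * R) ^ 2))
          + z ^ 2 * (4 * K ^ 2 * (L * (C * (k : ℝ) ^ k)) ^ 2) := by gcongr
      _ = _ := by rw [hDc]; ring
  have hEstep : ∀ i, 1 ≤ i → i ≤ N → E i ≤ Real.exp (A * τ) * (E (i - 1) + Dc * z ^ 2 * τ) := by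
    intro i hi hiN
    have hti : (i : ℝ) * τ ∈ Icc 0 T := ⟨by positivity, hnT i hiN⟩
    have h1 := lumpForm_cutoff_le hab hM hr
      (U := nodalVec a b M r (contRep (wderiv (u (i * τ)) 0)))
      (fun m => hmax _ hti _ (node_mem hab hM hr (Nat.le_of_lt_succ m.is_lt)))
      (hs.step i hi hiN)
    have h2 := error_step hab hT hM hr hk hK hτ hτT hi (hnT i hiN) hu hsol hFf hFk hC hFR huR hdR
      rfl (nodalVec a b M r (uh (i - 1)))
    refine (h1.trans h2).trans ?_
    have h3 : ((i : ℝ) - 1) * τ = ((i - 1 : ℕ) : ℝ) * τ := by rw [Nat.cast_pred (by omega)]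
    rw [h3]
    have h4 := mul_le_mul_of_nonneg_right hDle hτ.le
    gcongr
  have hEn := discrete_gronwall hA0 (by positivity) hτ.le hEstep n hnN
  have hE0nn : 0 ≤ E 0 := lumpForm_self_nonneg hab hM hr _
  have hEn' : E n ≤ Real.exp (A * T) * (E 0 + Dc * z ^ 2 * T) := by
    refine hEn.trans ?_
    have := hnT n hnN
    gcongr
  set Y := normL2 a b (fun x => wderiv (u 0) 0 x - uh 0 x) with hY
  have hY0 : 0 ≤ Y := ENNReal.toReal_nonneg
  have h0T : (0 : ℝ) ∈ Icc 0 T := ⟨le_rfl, hT.le⟩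
  have hE0 : E 0 ≤ 4 * K ^ 2 * (Y ^ 2 + c₁ * (z ^ 2 * R ^ 2)) := by
    have h1 := lumpForm_le_normL2_sq hab hM hr hK (u 0) (hs.mem_feSpace 0 (Nat.zero_le _))
    have h2 : E 0 ≤ 4 * K ^ 2 * (Y ^ 2 + c₁ * (h ^ (2 * r) * ‖u 0‖ ^ 2)) := by
      simpa [hE] using h1
    refine h2.trans ?_
    have h3 := huR 0 h0T
    gcongr
  have hX := normL2_sq_le hab hM hr hK (u (n * τ)) (hs.mem_feSpace n hnN)
  have hun := huR (n * τ) ⟨by positivity, hnT n hnN⟩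
  refine le_mul_add_mul_of_sq_le (by positivity) (by positivity) hY0 (by positivity) (hX.trans ?_)
  calc _ ≤ 2 * (c₁ * (z ^ 2 * R ^ 2)) + 4 * K ^ 3 * (r + 1) * (Real.exp (A * T) *
        (4 * K ^ 2 * (Y ^ 2 + c₁ * (z ^ 2 * R ^ 2)) + Dc * z ^ 2 * T)) := by
        have h5 : E n ≤ Real.exp (A * T) *
            (4 * K ^ 2 * (Y ^ 2 + c₁ * (z ^ 2 * R ^ 2)) + Dc * z ^ 2 * T) :=
          hEn'.trans (by gcongr)
        gcongr
    _ = P * z ^ 2 + Q * Y ^ 2 := by rw [hP, hQ]; ring
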